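/- Notation. Put $\gamma=(1+\sqrt5)/2$. A real number $\xi$ is called \emph{extremal} if it is neither rational nor quadratic over $\mathbb{Q}$ and if there is a constant $c>0$ such that, for each real $X\ge 1$, the system $$|x_0|\le X,\quad |x_0\xi-x_1|\le cX^{-1/\gamma},\quad |x_0\xi^2-x_2|\le cX^{-1/\gamma}$$ has a non-zero solution $(x_0,x_1,x_2)\in\mathbb{Z}^3$. The norm $\|A\|$ of a real matrix $A$ is the largest absolute value of its entries. A non-zero integer $2\times 2$ matrix is \emph{primitive} if the greatest common divisor $c(A)$ of its entries is $1$, and $A^{\mathrm{red}}$ denotes the primitive matrix with $A=c(A)A^{\mathrm{red}}$, where $c(A)>0$. Let $\mathcal{P}$ be the group of all primitive integer $2\times 2$ matrices with non-zero determinant, under the operation $A*B=(AB)^{\mathrm{red}}$. A \emph{Fibonacci sequence} in a monoid is a sequence $(w_i)_{i\ge1}$ of its elements with $w_{i+2}=w_{i+1}w_i$ for all $i\ge 1$. A Fibonacci sequence $(W_i)_{i\ge1}$ in $\mathcal{P}$ is \emph{admissible} if there is $N\in\mathcal{P}$ which is neither symmetric nor skew-symmetric and such that, with $N_i={}^tN$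 for $i$ odd and $N_i=N$ for $i$ even, the matrix $W_iN_i$ is symmetric for each $i\ge1$. It is \emph{unbounded} if the norms $\|W_i\|$ $(i\ge 1)$ are unbounded. For sequences of non-negative reals, $f_i\ll g_i$ means that there is a constant $C>0$, independent of $i$, with $f_i\le Cg_i$ for all $i\ge1$; $f_i\gg g_i$ means $g_i\ll f_i$; and $f_i\asymp g_i$ means $f_i\ll g_i\ll f_i$. Theorem. (1) For each extremal real number $\xi$ there exists an unbounded admissible Fibonacci sequence $(W_i)_{i\ge1}$ in $\mathcal{P}$ which satisfies $$\|W_{i+1}\|\asymp\|W_i\|^{\gamma},\qquad \|(\xi,-1)W_i\|\asymp\|W_i\|^{-1},\qquad |\det W_i|\asymp 1. \tag{E}$$ (2) Such a sequence is uniquely determined by $\xi$ up to its first terms and up to term-by-term multiplication by a Fibonacci sequence in $\{\pm1\}$: if $(W_i)_{i\ge1}$ and $(W'_i)_{i\ge1}$ are unbounded admissible Fibonacci sequences in $\mathcal{P}$ which both satisfy (E) for the same extremal $\xi$, then there are integers $k,\ell\ge0$ and a Fibonacci sequence $(\varepsilon_i)_{i\ge1}$ in the multiplicative group $\{\pm1\}$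 such that $W'_{i+k}=\varepsilon_iW_{i+\ell}$ for all $i\ge1$. (3) Conversely, for any unbounded admissible Fibonacci sequence $(W_i)_{i\ge1}$ in $\mathcal{P}$ which satisfies $$\|W_{i+2}\|\gg\|W_{i+1}\|\,\|W_i\|\qquad\text{and}\qquad|\det W_i|\ll 1,$$ there is an extremal real number $\xi$ such that (E) holds. -/

import Mathlib

open scoped Matrix

-- The norm `‖A‖` of a matrix is the largest absolute value of its entries.
attribute [local instance] Matrix.normedAddCommGroup

/-- The ring of integer `2 × 2` matrices. -/
abbrev IntMat2 : Type := Matrix (Fin 2) (Fin 2) ℤ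

namespace IntMat2

/-- The content of `A`: the (non-negative) greatest common divisor of its entries. -/
def content (A : IntMat2) : ℤ :=
  Finset.univ.gcd fun p : Fin 2 × Fin 2 => A p.1 p.2

/-- `A` divided by its content. -/
def red (A : IntMat2) : IntMat2 :=
  Matrix.of fun i j => A i j / content A

theorem content_dvd (A : IntMat2) (i j : Fin 2) : content A ∣ A i j :=
  Finset.gcd_dvd (f := fun p : Fin 2 × Fin 2 => A p.1 p.2) (Finset.mem_univ (i, j))

theorem content_smul_red (A : IntMat2) : content A • red A = A := by
  ext i j
  simp only [red, Matrix.smul_apply, Matrix.of_apply, smul_eq_mul]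
  exact Int.mul_ediv_cancel' (content_dvd A i j)

theorem content_nonneg (A : IntMat2) : 0 ≤ content A := by
  have h : normalize (content A) = content A := Finset.normalize_gcd
  rw [← h, ← Int.abs_eq_normalize]
  positivity

theorem content_ne_zero {A : IntMat2} (hA : A.det ≠ 0) : content A ≠ 0 := by
  intro h
  apply hA
  rw [← content_smul_red A, h, zero_smul]
  simp

theorem content_smul (k : ℤ) (A : IntMat2) : content (k • A) = |k| * content A := by
  have h := Finset.gcd_mul_left (s := Finset.univ)
    (f := fun p : Fin 2 × Fin 2 => A p.1 p.2) (a := k)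
  simpa [content, ← Int.abs_eq_normalize] using h

theorem content_red {A : IntMat2} (hA : A.det ≠ 0) : content (red A) = 1 := by
  have h := content_smul (content A) (red A)
  rw [content_smul_red, abs_of_nonneg (content_nonneg A)] at h
  exact mul_left_cancel₀ (content_ne_zero hA) (by rw [← h, mul_one])

theorem det_red_ne_zero {A : IntMat2} (hA : A.det ≠ 0) : (red A).det ≠ 0 := by
  intro h
  apply hA
  rw [← content_smul_red A, Matrix.det_smul, h, mul_zero]

theorem red_smul {k : ℤ} (hk : 0 < k) (A : IntMat2) : red (k • A) = red A := by
  ext i j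
  simp only [red, Matrix.of_apply, content_smul, abs_of_pos hk, Matrix.smul_apply, smul_eq_mul]
  exact Int.mul_ediv_mul_of_pos _ _ hk

theorem red_eq_self {A : IntMat2} (hA : content A = 1) : red A = A := by
  ext i j
  simp [red, hA]

theorem content_one : content (1 : IntMat2) = 1 := by
  decide

theorem red_red_mul {A : IntMat2} (hA : A.det ≠ 0) (B : IntMat2) :
    red (red A * B) = red (A * B) := by
  have hc : 0 < content A := lt_of_le_of_ne (content_nonneg A) (content_ne_zero hA).symm
  conv_rhs => rw [← content_smul_red A, Matrix.smul_mul, red_smul hc]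

theorem red_mul_red (A : IntMat2) {B : IntMat2} (hB : B.det ≠ 0) :
    red (A * red B) = red (A * B) := by
  have hc : 0 < content B := lt_of_le_of_ne (content_nonneg B) (content_ne_zero hB).symm
  conv_rhs => rw [← content_smul_red B, Matrix.mul_smul, red_smul hc]

theorem det_mul_ne_zero {A B : IntMat2} (hA : A.det ≠ 0) (hB : B.det ≠ 0) :
    (A * B).det ≠ 0 := by
  rw [Matrix.det_mul]
  exact mul_ne_zero hA hB

theorem det_inv_aux {A : IntMat2} (hA : A.det ≠ 0) : (A.det • A.adjugate).det ≠ 0 := by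
  rw [Matrix.det_smul, Matrix.det_adjugate]
  exact mul_ne_zero (pow_ne_zero _ hA) (pow_ne_zero _ hA)

end IntMat2

/-- The set of primitive integer `2 × 2` matrices with non-zero determinant. -/
def PrimMat : Type :=
  {A : IntMat2 // IntMat2.content A = 1 ∧ A.det ≠ 0}

namespace PrimMat

open IntMat2

/-- The underlying integer matrix. -/
def toMat (A : PrimMat) : IntMat2 := A.1

/-- The underlying matrix, viewed with real entries. -/
def toReal (A : PrimMat) : Matrix (Fin 2) (Fin 2) ℝ :=
  A.toMat.map (Int.cast : ℤ → ℝ)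

/-- The primitive matrix `A^red` of a matrix `A` with non-zero determinant. -/
def ofRed (A : IntMat2) (hA : A.det ≠ 0) : PrimMat :=
  ⟨red A, content_red hA, det_red_ne_zero hA⟩

/-- Primitive matrices of non-zero determinant form a group for `A * B = (A B)^red`. -/
instance : Group PrimMat where
  mul A B := ofRed (A.1 * B.1) (det_mul_ne_zero A.2.2 B.2.2)
  one := ⟨1, content_one, by simp⟩
  inv A := ofRed (A.1.det • A.1.adjugate) (det_inv_aux A.2.2)
  mul_assoc A B C := Subtype.ext (by
    change red (red (A.1 * B.1) * C.1) = red (A.1 * red (B.1 * C.1))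
    rw [red_red_mul (det_mul_ne_zero A.2.2 B.2.2), red_mul_red _ (det_mul_ne_zero B.2.2 C.2.2),
      Matrix.mul_assoc])
  one_mul A := Subtype.ext (by
    change red (1 * A.1) = A.1
    rw [Matrix.one_mul, red_eq_self A.2.1])
  mul_one A := Subtype.ext (by
    change red (A.1 * 1) = A.1
    rw [Matrix.mul_one, red_eq_self A.2.1])
  inv_mul_cancel A := Subtype.ext (by
    change red (red (A.1.det • A.1.adjugate) * A.1) = 1
    rw [red_red_mul (det_inv_aux A.2.2), Matrix.smul_mul, Matrix.adjugate_mul, smul_smul,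
      red_smul (mul_self_pos.2 A.2.2), red_eq_self content_one])

theorem toMat_mul (A B : PrimMat) : (A * B).toMat = red (A.toMat * B.toMat) := rfl

end PrimMat

/-- A Fibonacci sequence `(w_i)_{i ≥ 1}` in a monoid; here and below the value of a sequence
at the index `0` plays no role. -/
def IsFibonacciSeq {M : Type*} [Monoid M] (w : ℕ → M) : Prop :=
  ∀ i, 1 ≤ i → w (i + 2) = w (i + 1) * w i

/-- The admissibility condition for a Fibonacci sequence `(W_i)_{i ≥ 1}` of primitive matrices. -/
def IsAdmissible (W : ℕ → PrimMat) : Prop :=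
  ∃ N : PrimMat, N.toMatᵀ ≠ N.toMat ∧ N.toMatᵀ ≠ -N.toMat ∧
    ∀ i, 1 ≤ i → ((W i).toMat * (if Odd i then N.toMatᵀ else N.toMat)).IsSymm

/-- The sequence `(W_i)_{i ≥ 1}` is unbounded. -/
def IsUnboundedSeq (W : ℕ → PrimMat) : Prop :=
  ∀ B : ℝ, ∃ i, 1 ≤ i ∧ B < ‖(W i).toReal‖

/-- `f_i ≪ g_i` for `i ≥ 1`, with an implied constant independent of `i`. -/
def SeqLL (f g : ℕ → ℝ) : Prop :=
  ∃ c : ℝ, 0 < c ∧ ∀ i, 1 ≤ i → f i ≤ c * g i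

/-- `f_i ≍ g_i` for `i ≥ 1`, with implied constants independent of `i`. -/
def SeqAsymp (f g : ℕ → ℝ) : Prop :=
  SeqLL f g ∧ SeqLL g f

/-- A real number `ξ` is extremal if it is neither rational nor quadratic over `ℚ` and if, for
some `c > 0`, the system `|x₀| ≤ X`, `|x₀ ξ - x₁| ≤ c X^(-1/γ)`, `|x₀ ξ² - x₂| ≤ c X^(-1/γ)`
has a non-zero integer solution for each real `X ≥ 1`. -/
def IsExtremal (ξ : ℝ) : Prop :=
  (∀ a b c : ℤ, (a : ℝ) * ξ ^ 2 + (b : ℝ) * ξ + (c : ℝ) = 0 → a = 0 ∧ b = 0 ∧ c = 0) ∧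
  ∃ c : ℝ, 0 < c ∧ ∀ X : ℝ, 1 ≤ X → ∃ x₀ x₁ x₂ : ℤ, (x₀, x₁, x₂) ≠ (0, 0, 0) ∧
    |(x₀ : ℝ)| ≤ X ∧
    |(x₀ : ℝ) * ξ - (x₁ : ℝ)| ≤ c * X ^ (-(1 / Real.goldenRatio)) ∧
    |(x₀ : ℝ) * ξ ^ 2 - (x₂ : ℝ)| ≤ c * X ^ (-(1 / Real.goldenRatio))

/-- The estimates `‖W_{i+1}‖ ≍ ‖W_i‖^γ`, `‖(ξ,-1) W_i‖ ≍ ‖W_i‖⁻¹`, `|det W_i| ≍ 1`. -/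
def SatisfiesEstimates (ξ : ℝ) (W : ℕ → PrimMat) : Prop :=
  SeqAsymp (fun i => ‖(W (i + 1)).toReal‖) (fun i => ‖(W i).toReal‖ ^ Real.goldenRatio) ∧
  SeqAsymp (fun i => ‖!![ξ, -1] * (W i).toReal‖) (fun i => ‖(W i).toReal‖⁻¹) ∧
  SeqAsymp (fun i => |(W i).toReal.det|) (fun _ => 1)

/-- `(W_i)_{i ≥ 1}` is an unbounded admissible Fibonacci sequence of primitive matrices
associated to `ξ`. -/
def IsAssociated (ξ : ℝ) (W : ℕ → PrimMat) : Prop :=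
  IsFibonacciSeq W ∧ IsAdmissible W ∧ IsUnboundedSeq W ∧ SatisfiesEstimates ξ W

/-! A point of ℤ³ is read as a symmetric integer matrix, and its quality as an approximation to ξ is
measured by the errors ξx₀ − x₁ and ξx₁ − x₂. All three assertions pass through one object,
`ApproxSeq`: points y_k of size about e^{a_k} with a_{k+1} = γ a_k + O(1), errors ≪ e^{-a_k}, any
three consecutive ones being independent. The determinant of three integer points vanishes once it
is below 1 in absolute value. Hence a point that approximates ξ as well as the y_k do lies in two
consecutive planes ⟨y_k, y_{k+1}⟩ and ⟨y_{k+1}, y_{k+2}⟩, and is proportional to y_{k+1}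
(`ApproxSeq.exists_proportional`).

Existence. The minimal points of an extremal ξ eventually have non-zero determinant, and the middle
points of their independent consecutive triples form an `ApproxSeq` (`MinimalSeq.exists_approxSeq`).
The matrix y_{k+2} adj(y_{k+3}) y_{k+2} has first entry ≪ e^{a_k} and error ≪ e^{-a_k}, hence is
eventually proportional to y_k. This makes y_k adj(y_{k+2}) y_{k+1} constant up to scalars and
transposition: it is N, and the primitive matrices proportional to y_k adj(N_k) form the Fibonacci
sequence (`ApproxSeq.exists_associated_of_bracket`).

Uniqueness. The points W_i N_i of two sequences attached to ξ are both `ApproxSeq`s. Each late term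
of one is proportional to a term of the other, and the growth rate forces the indices to advance
together (`ApproxSeq.exists_shift_proportional`). So, after a shift, W'_i is proportional to W_i A_i
with A_i depending only on the parity of i, and the two Fibonacci recurrences force A_i to be
scalar.

Converse. With J the standard skew matrix, ᵗW J W = det(W) J reduces x_{i+1} J x_{i+2} to a matrix
of norm ≪ ‖W_i‖, where x_i = W_i N_i. Consecutive x_i are therefore nearly proportional; their
directions converge, and bounded determinants put the limit on the conic, at (1, ξ, ξ²)
(`exists_errVec_le`). The resulting `ApproxSeq` yields extremality and (E). -/

open Filter

/-! ### Proportionality of integer matrices -/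

namespace IntMat2

/-- Two integer matrices are proportional if they have a common non-zero integer multiple. -/
def Proportional (A B : IntMat2) : Prop :=
  ∃ p q : ℤ, p ≠ 0 ∧ q ≠ 0 ∧ p • A = q • B

namespace Proportional

theorem refl (A : IntMat2) : Proportional A A :=
  ⟨1, 1, one_ne_zero, one_ne_zero, rfl⟩

theorem symm {A B : IntMat2} (h : Proportional A B) : Proportional B A := by
  obtain ⟨p, q, hp, hq, h⟩ := h
  exact ⟨q, p, hq, hp, h.symm⟩

theorem trans {A B C : IntMat2} (h : Proportional A B) (h' : Proportional B C) :
    Proportional A C := by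
  obtain ⟨p, q, hp, hq, h⟩ := h
  obtain ⟨r, s, hr, hs, h'⟩ := h'
  refine ⟨r * p, q * s, mul_ne_zero hr hp, mul_ne_zero hq hs, ?_⟩
  rw [mul_smul, h, smul_comm, h', smul_smul]

theorem smul_left {k : ℤ} (hk : k ≠ 0) (A : IntMat2) : Proportional (k • A) A :=
  ⟨1, k, one_ne_zero, hk, by simp⟩

theorem mul {A B C D : IntMat2} (h : Proportional A B) (h' : Proportional C D) :
    Proportional (A * C) (B * D) := by
  obtain ⟨p, q, hp, hq, h⟩ := h
  obtain ⟨r, s, hr, hs, h'⟩ := h'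
  refine ⟨p * r, q * s, mul_ne_zero hp hr, mul_ne_zero hq hs, ?_⟩
  rw [← smul_mul_smul_comm, h, h', smul_mul_smul_comm]

theorem transpose {A B : IntMat2} (h : Proportional A B) : Proportional Aᵀ Bᵀ := by
  obtain ⟨p, q, hp, hq, h⟩ := h
  exact ⟨p, q, hp, hq, by rw [← Matrix.transpose_smul, h, Matrix.transpose_smul]⟩

theorem adjugate {A B : IntMat2} (h : Proportional A B) :
    Proportional A.adjugate B.adjugate := by
  obtain ⟨p, q, hp, hq, h⟩ := h
  refine ⟨p, q, hp, hq, ?_⟩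
  have := congrArg Matrix.adjugate h
  rwa [Matrix.adjugate_smul, Matrix.adjugate_smul, Fintype.card_fin, pow_one, pow_one] at this

theorem det_ne_zero {A B : IntMat2} (h : Proportional A B) (hA : A.det ≠ 0) : B.det ≠ 0 := by
  obtain ⟨p, q, hp, hq, h⟩ := h
  intro hB
  have := congrArg Matrix.det h
  rw [Matrix.det_smul, Matrix.det_smul, hB, mul_zero] at this
  exact mul_ne_zero (pow_ne_zero _ hp) hA this

theorem adjugate_mul_cancel {A : IntMat2} (hA : A.det ≠ 0) (B : IntMat2) :
    Proportional (A.adjugate * (A * B)) B := by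
  rw [← Matrix.mul_assoc, Matrix.adjugate_mul, Matrix.smul_mul, Matrix.one_mul]
  exact smul_left hA B

theorem mul_adjugate_cancel {A : IntMat2} (hA : A.det ≠ 0) (B : IntMat2) :
    Proportional (A * (A.adjugate * B)) B := by
  rw [← Matrix.mul_assoc, Matrix.mul_adjugate, Matrix.smul_mul, Matrix.one_mul]
  exact smul_left hA B

theorem mul_mul_adjugate_cancel {A : IntMat2} (hA : A.det ≠ 0) (B : IntMat2) :
    Proportional (B * A * A.adjugate) B := by
  rw [Matrix.mul_assoc, Matrix.mul_adjugate, Matrix.mul_smul, Matrix.mul_one]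
  exact smul_left hA B

theorem mul_adjugate_mul_cancel {A : IntMat2} (hA : A.det ≠ 0) (B : IntMat2) :
    Proportional (B * A.adjugate * A) B := by
  rw [Matrix.mul_assoc, Matrix.adjugate_mul, Matrix.mul_smul, Matrix.mul_one]
  exact smul_left hA B

theorem cancel_left {A B C : IntMat2} (hA : A.det ≠ 0) (h : Proportional (A * B) (A * C)) :
    Proportional B C :=
  (adjugate_mul_cancel hA B).symm.trans (((refl A.adjugate).mul h).trans (adjugate_mul_cancel hA C))

theorem cancel_right {A B C : IntMat2} (hA : A.det ≠ 0) (h : Proportional (B * A) (C * A)) :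
    Proportional B C :=
  (mul_mul_adjugate_cancel hA B).symm.trans
    ((h.mul (refl A.adjugate)).trans (mul_mul_adjugate_cancel hA C))

end Proportional

theorem red_proportional {A : IntMat2} (hA : A.det ≠ 0) : Proportional (red A) A :=
  ⟨content A, 1, content_ne_zero hA, one_ne_zero, by rw [content_smul_red, one_smul]⟩

theorem content_pos {A : IntMat2} (hA : A.det ≠ 0) : 0 < content A :=
  lt_of_le_of_ne (content_nonneg A) (content_ne_zero hA).symm

/-- Taking contents of p • A = q • B gives |p| = |q|. -/
theorem eq_or_eq_neg_of_proportional {A B : IntMat2} (hA : content A = 1) (hB : content B = 1)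
    (h : Proportional A B) : A = B ∨ A = -B := by
  obtain ⟨p, q, hp, hq, h⟩ := h
  have hc := congrArg content h
  rw [content_smul, content_smul, hA, hB, mul_one, mul_one] at hc
  rcases abs_eq_abs.1 hc with rfl | rfl
  · exact Or.inl (smul_right_injective _ hp h)
  · refine Or.inr (smul_right_injective _ hq ?_)
    simpa [neg_smul, neg_eq_iff_eq_neg] using h

theorem content_le_abs_det {A : IntMat2} (hA : A.det ≠ 0) : content A ≤ |A.det| := by
  have h1 : content A ∣ A.det := by
    conv_rhs => rw [← content_smul_red A, Matrix.det_smul]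
    exact (dvd_pow_self _ (by simp)).mul_right _
  exact Int.le_of_dvd (abs_pos.2 hA) ((dvd_abs _ _).2 h1)

/-- Up to sign both matrices are multiples of the same primitive matrix, the multipliers being their
contents. -/
theorem content_smul_eq_or_of_proportional {A B : IntMat2} (hA : A.det ≠ 0)
    (h : Proportional A B) :
    content B • A = content A • B ∨ content B • A = -(content A • B) := by
  have hB := h.det_ne_zero hA
  have h' := (red_proportional hA).trans (h.trans (red_proportional hB).symm)
  have e1 : content B • A = (content A * content B) • red A := by
    conv_lhs => rw [← content_smul_red A, smul_smul, mul_comm]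
  have e2 : content A • B = (content A * content B) • red B := by
    conv_lhs => rw [← content_smul_red B, smul_smul]
  rcases eq_or_eq_neg_of_proportional (content_red hA) (content_red hB) h' with h | h
  · left; rw [e1, e2, h]
  · right; rw [e1, e2, h, smul_neg]

/-- The matrix with real entries underlying an integer matrix. -/
def real (A : IntMat2) : Matrix (Fin 2) (Fin 2) ℝ := A.map (Int.cast : ℤ → ℝ)

theorem real_apply (A : IntMat2) (i j : Fin 2) : real A i j = (A i j : ℝ) := rfl

theorem real_mul (A B : IntMat2) : real (A * B) = real A * real B := by
  ext i j
  simp [real_apply, Matrix.mul_apply]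

theorem real_smul (k : ℤ) (A : IntMat2) : real (k • A) = (k : ℝ) • real A := by
  ext i j
  simp only [real_apply, Matrix.smul_apply, smul_eq_mul, Int.cast_mul]

theorem real_transpose (A : IntMat2) : real Aᵀ = (real A)ᵀ := rfl

theorem det_real (A : IntMat2) : (real A).det = (A.det : ℝ) := by
  simp [Matrix.det_fin_two, real_apply]

theorem one_le_norm_real {A : IntMat2} (hA : A.det ≠ 0) : 1 ≤ ‖real A‖ := by
  by_contra! h
  apply hA
  have : ∀ i j, A i j = 0 := fun i j => by
    have h1 := (Matrix.norm_entry_le_entrywise_sup_norm (real A) (i := i) (j := j)).trans_lt h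
    rw [real_apply, Real.norm_eq_abs] at h1
    exact Int.abs_lt_one_iff.1 (by exact_mod_cast h1)
  simp [Matrix.det_fin_two, this]

end IntMat2

/-- The supremum norm is submultiplicative up to a factor `2` on products through dimension two. -/
theorem Matrix.norm_mul_le_two {m n : Type*} [Fintype m] [Fintype n] (A : Matrix m (Fin 2) ℝ)
    (B : Matrix (Fin 2) n ℝ) : ‖A * B‖ ≤ 2 * (‖A‖ * ‖B‖) := by
  rw [Matrix.norm_le_iff (by positivity)]
  intro i j
  rw [Matrix.mul_apply, Fin.sum_univ_two]
  refine (norm_add_le _ _).trans ?_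
  rw [norm_mul, norm_mul, two_mul]
  gcongr <;> exact Matrix.norm_entry_le_entrywise_sup_norm _

theorem Matrix.norm_adjugate_fin_two (A : Matrix (Fin 2) (Fin 2) ℝ) : ‖A.adjugate‖ ≤ ‖A‖ := by
  rw [Matrix.norm_le_iff (by positivity)]
  intro i j
  rw [Matrix.adjugate_fin_two]
  fin_cases i <;> fin_cases j <;> simp only [Matrix.of_apply, Matrix.cons_val', Matrix.cons_val_zero, Matrix.cons_val_one, Fin.mk_zero,
    Fin.mk_one, Fin.isValue, norm_neg, Matrix.cons_val_fin_one] <;>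
    exact Matrix.norm_entry_le_entrywise_sup_norm _

/-- For a real `2 × 2` matrix, `|det A|` is at most `2 ‖A‖ ‖(ξ, -1) A‖`. -/
theorem Matrix.abs_det_le_two_mul (ξ : ℝ) (A : Matrix (Fin 2) (Fin 2) ℝ) :
    |A.det| ≤ 2 * (‖A‖ * ‖!![ξ, -1] * A‖) := by
  have h0 := Matrix.norm_entry_le_entrywise_sup_norm (!![ξ, -1] * A) (i := 0) (j := 0)
  have h1 := Matrix.norm_entry_le_entrywise_sup_norm (!![ξ, -1] * A) (i := 0) (j := 1)
  have k0 := Matrix.norm_entry_le_entrywise_sup_norm A (i := 0) (j := 0)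
  have k1 := Matrix.norm_entry_le_entrywise_sup_norm A (i := 0) (j := 1)
  rw [Real.norm_eq_abs] at h0 h1 k0 k1
  simp only [Matrix.mul_apply, Fin.sum_univ_two, Matrix.of_apply, Matrix.cons_val', Matrix.cons_val_zero, Matrix.cons_val_one, Matrix.cons_val_fin_one] at h0 h1
  have : A.det = A 0 1 * (ξ * A 0 0 + -1 * A 1 0) - A 0 0 * (ξ * A 0 1 + -1 * A 1 1) := by
    rw [Matrix.det_fin_two]; ring
  rw [this]
  refine (abs_sub _ _).trans ?_
  rw [abs_mul, abs_mul, two_mul]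
  gcongr

/-! ### Integer points, their errors and their determinants -/

/-- The symmetric integer matrix with rows `(x₀, x₁)` and `(x₁, x₂)`. -/
def symMat (x : Fin 3 → ℤ) : IntMat2 := !![x 0, x 1; x 1, x 2]

theorem det_symMat (x : Fin 3 → ℤ) : (symMat x).det = x 0 * x 2 - x 1 * x 1 := by
  simp [symMat, Matrix.det_fin_two]

theorem symMat_transpose (x : Fin 3 → ℤ) : (symMat x)ᵀ = symMat x := by
  ext i j
  fin_cases i <;> fin_cases j <;> rfl

theorem symMat_smul (p : ℤ) (x : Fin 3 → ℤ) : symMat (p • x) = p • symMat x := by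
  ext i j
  fin_cases i <;> fin_cases j <;> rfl

theorem symMat_neg (x : Fin 3 → ℤ) : symMat (-x) = -symMat x := by
  ext i j
  fin_cases i <;> fin_cases j <;> rfl

theorem symMat_injective : Function.Injective symMat := by
  intro x y h
  ext i
  fin_cases i
  · exact congrFun (congrFun h 0) 0
  · exact congrFun (congrFun h 0) 1
  · exact congrFun (congrFun h 1) 1

theorem exists_symMat_eq {A : IntMat2} (hA : A.IsSymm) : ∃ x, symMat x = A := by
  refine ⟨![A 0 0, A 0 1, A 1 1], ?_⟩
  ext i j
  fin_cases i <;> fin_cases j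
  · rfl
  · rfl
  · exact (hA.apply 1 0)
  · rfl

/-- The pair of errors `(ξ x₀ - x₁, ξ x₁ - x₂)`. -/
def errVec (ξ : ℝ) : (Fin 3 → ℤ) →+ ℝ × ℝ :=
  AddMonoidHom.mk' (fun x => (ξ * x 0 - x 1, ξ * x 1 - x 2)) fun x y => by
    ext <;> simp <;> ring

theorem errVec_fst (ξ : ℝ) (x : Fin 3 → ℤ) : (errVec ξ x).1 = ξ * x 0 - x 1 := rfl

theorem errVec_snd (ξ : ℝ) (x : Fin 3 → ℤ) : (errVec ξ x).2 = ξ * x 1 - x 2 := rfl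

theorem abs_errVec_fst_le (ξ : ℝ) (x : Fin 3 → ℤ) : |ξ * x 0 - x 1| ≤ ‖errVec ξ x‖ :=
  norm_fst_le (errVec ξ x)

theorem abs_errVec_snd_le (ξ : ℝ) (x : Fin 3 → ℤ) : |ξ * x 1 - x 2| ≤ ‖errVec ξ x‖ :=
  norm_snd_le (errVec ξ x)

theorem abs_coord_bounds (ξ : ℝ) (x : Fin 3 → ℤ) :
    |(x 1 : ℝ)| ≤ |ξ| * |(x 0 : ℝ)| + ‖errVec ξ x‖ ∧
    |(x 2 : ℝ)| ≤ |ξ| * |(x 1 : ℝ)| + ‖errVec ξ x‖ := by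
  have h1 := abs_errVec_fst_le ξ x
  have h2 := abs_errVec_snd_le ξ x
  rw [← abs_mul, ← abs_mul]
  constructor
  · have := abs_sub (ξ * x 0) (ξ * x 0 - x 1)
    rw [sub_sub_cancel] at this
    linarith
  · have := abs_sub (ξ * x 1) (ξ * x 1 - x 2)
    rw [sub_sub_cancel] at this
    linarith

theorem norm_errVec_le {ξ : ℝ} {x : Fin 3 → ℤ} {e : ℝ} (h1 : |ξ * x 0 - x 1| ≤ e)
    (h2 : |ξ * x 1 - x 2| ≤ e) : ‖errVec ξ x‖ ≤ e :=
  max_le h1 h2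

theorem norm_errVec_smul (ξ : ℝ) (p : ℤ) (x : Fin 3 → ℤ) :
    ‖errVec ξ (p • x)‖ = |(p : ℝ)| * ‖errVec ξ x‖ := by
  rw [map_zsmul, ← Int.cast_smul_eq_zsmul ℝ, norm_smul, Real.norm_eq_abs]

/-- The determinant of three points of `ℤ³`. -/
def triple (x y z : Fin 3 → ℤ) : ℤ :=
  x 0 * (y 1 * z 2 - y 2 * z 1) - x 1 * (y 0 * z 2 - y 2 * z 0) + x 2 * (y 0 * z 1 - y 1 * z 0)

/-- Cramer's identity expresses `triple x y w • z` as a combination of `x`, `y`, `w`; the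
coefficients of `x` and `w` are the two determinants assumed to vanish. -/
theorem triple_smul_eq {x y w z : Fin 3 → ℤ} (h1 : triple z x y = 0) (h2 : triple z y w = 0) :
    triple x y w • z = triple x z w • y := by
  have key : ∀ i, triple x y w * z i
      = triple z y w * x i + triple x z w * y i + triple z x y * w i := by
    intro i
    fin_cases i <;> simp [triple] <;> ring
  ext i
  have := key i
  rw [h1, h2] at this
  simpa using this

/-- Subtracting from each of the last two columns ξ times the preceding one replaces them by errors,
so each term of the expansion contains one first coordinate and two errors. -/
theorem abs_triple_le (ξ : ℝ) (x y z : Fin 3 → ℤ) :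
    |(triple x y z : ℝ)| ≤ 2 * (|(x 0 : ℝ)| * ‖errVec ξ y‖ * ‖errVec ξ z‖
      + |(y 0 : ℝ)| * ‖errVec ξ x‖ * ‖errVec ξ z‖ + |(z 0 : ℝ)| * ‖errVec ξ x‖ * ‖errVec ξ y‖) := by
  have aux : ∀ (t : ℝ) (u v : ℝ × ℝ),
      |t * (u.1 * v.2 - u.2 * v.1)| ≤ 2 * (|t| * ‖u‖ * ‖v‖) := by
    intro t u v
    rw [abs_mul]
    have h : |u.1 * v.2 - u.2 * v.1| ≤ ‖u‖ * ‖v‖ + ‖u‖ * ‖v‖ := by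
      refine (abs_sub _ _).trans ?_
      rw [abs_mul, abs_mul]
      gcongr
      · exact norm_fst_le u
      · exact norm_snd_le v
      · exact norm_snd_le u
      · exact norm_fst_le v
    calc |t| * |u.1 * v.2 - u.2 * v.1| ≤ |t| * (‖u‖ * ‖v‖ + ‖u‖ * ‖v‖) := by gcongr
      _ = _ := by ring
  have e : (triple x y z : ℝ) =
      (x 0 : ℝ) * ((errVec ξ y).1 * (errVec ξ z).2 - (errVec ξ y).2 * (errVec ξ z).1)
      - (y 0 : ℝ) * ((errVec ξ x).1 * (errVec ξ z).2 - (errVec ξ x).2 * (errVec ξ z).1)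
      + (z 0 : ℝ) * ((errVec ξ x).1 * (errVec ξ y).2 - (errVec ξ x).2 * (errVec ξ y).1) := by
    simp only [triple, errVec_fst, errVec_snd]
    push_cast
    ring
  rw [e]
  refine (abs_add_le _ _).trans ((add_le_add_left (abs_sub _ _) _).trans ?_)
  linarith [aux (x 0) (errVec ξ y) (errVec ξ z), aux (y 0) (errVec ξ x) (errVec ξ z),
    aux (z 0) (errVec ξ x) (errVec ξ y)]

/-- An integer of absolute value below 1 is zero. The threshold −2 suffices because the three terms,
doubled, add up to at most 6e⁻² < 1. -/
theorem triple_eq_zero_of_le {ξ : ℝ} {x y z : Fin 3 → ℤ} {p₁ p₂ p₃ q₁ q₂ q₃ : ℝ}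
    (hx : |(x 0 : ℝ)| ≤ Real.exp p₁) (hx' : ‖errVec ξ x‖ ≤ Real.exp q₁)
    (hy : |(y 0 : ℝ)| ≤ Real.exp p₂) (hy' : ‖errVec ξ y‖ ≤ Real.exp q₂)
    (hz : |(z 0 : ℝ)| ≤ Real.exp p₃) (hz' : ‖errVec ξ z‖ ≤ Real.exp q₃)
    (h1 : p₁ + q₂ + q₃ ≤ -2) (h2 : p₂ + q₁ + q₃ ≤ -2) (h3 : p₃ + q₁ + q₂ ≤ -2) :
    triple x y z = 0 := by
  have aux : ∀ {a b c p q r : ℝ}, 0 ≤ a → 0 ≤ b → 0 ≤ c → a ≤ Real.exp p → b ≤ Real.exp q →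
      c ≤ Real.exp r → p + q + r ≤ -2 → a * b * c ≤ Real.exp (-2) := by
    intro a b c p q r ha hb hc h1 h2 h3 h
    calc a * b * c ≤ Real.exp p * Real.exp q * Real.exp r := by gcongr
      _ = Real.exp (p + q + r) := by rw [Real.exp_add, Real.exp_add]
      _ ≤ _ := Real.exp_le_exp.2 h
  have b1 := aux (abs_nonneg _) (norm_nonneg _) (norm_nonneg _) hx hy' hz' h1
  have b2 := aux (abs_nonneg _) (norm_nonneg _) (norm_nonneg _) hy hx' hz' h2
  have b3 := aux (abs_nonneg _) (norm_nonneg _) (norm_nonneg _) hz hx' hy' h3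
  have hexp : Real.exp (-2) < 1 / 6 := by
    rw [Real.exp_neg, one_div]
    gcongr
    have : Real.exp 2 = Real.exp 1 * Real.exp 1 := by rw [← Real.exp_add]; norm_num
    rw [this]
    nlinarith [Real.exp_one_gt_d9]
  have : |(triple x y z : ℝ)| < 1 := by linarith [abs_triple_le ξ x y z]
  exact Int.abs_lt_one_iff.1 (by exact_mod_cast this)

/-! ### Sequences of good approximations -/

/-- A sequence of points of `ℤ³` whose sizes `exp (a k)` grow like iterated powers of exponent
the golden ratio, whose errors with respect to `ξ` are at most of the order of the inverse of their
sizes, and of which any three consecutive terms are linearly independent. -/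
structure ApproxSeq (ξ : ℝ) (y : ℕ → Fin 3 → ℤ) (a : ℕ → ℝ) (K : ℝ) : Prop where
  growth : ∀ k, |a (k + 1) - Real.goldenRatio * a k| ≤ K
  tendsto : Tendsto a atTop atTop
  a_nonneg : ∀ k, 0 ≤ a k
  abs_zero_le : ∀ k, |(y k 0 : ℝ)| ≤ Real.exp (a k + K)
  err_le : ∀ k, ‖errVec ξ (y k)‖ ≤ Real.exp (-a k + K)
  le_size : ∀ k, Real.exp (a k - K) ≤ |(y k 0 : ℝ)| + ‖errVec ξ (y k)‖
  triple_ne : ∀ k, triple (y k) (y (k + 1)) (y (k + 2)) ≠ 0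

theorem goldenRatio_bounds : 3 / 2 < Real.goldenRatio ∧ Real.goldenRatio < 7 / 4 := by
  have h := Real.goldenRatio_sq
  have h1 := Real.one_lt_goldenRatio
  constructor <;> nlinarith

namespace ApproxSeq

variable {ξ : ℝ} {y : ℕ → Fin 3 → ℤ} {a : ℕ → ℝ} {K : ℝ}

theorem nonneg (h : ApproxSeq ξ y a K) : 0 ≤ K := (abs_nonneg _).trans (h.growth 0)

theorem shift (h : ApproxSeq ξ y a K) (m : ℕ) :
    ApproxSeq ξ (fun k => y (k + m)) (fun k => a (k + m)) K where
  growth k := by simpa [add_right_comm] using h.growth (k + m)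
  tendsto := h.tendsto.comp (tendsto_add_atTop_nat m)
  a_nonneg k := h.a_nonneg _
  abs_zero_le k := h.abs_zero_le _
  err_le k := h.err_le _
  le_size k := h.le_size _
  triple_ne k := by simpa [add_right_comm] using h.triple_ne (k + m)

/-- As γ² = γ + 1, this quantity is the growth defect at k + 1 plus γ − 1 times the one at k. -/
theorem growth_two (h : ApproxSeq ξ y a K) (k : ℕ) : |a (k + 2) - a (k + 1) - a k| ≤ 2 * K := by
  have h1 := abs_le.1 (h.growth k)
  have h2 := abs_le.1 (h.growth (k + 1))
  have hg := Real.goldenRatio_sq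
  have hb := goldenRatio_bounds
  have e : a (k + 2) - a (k + 1) - a k = (a (k + 2) - Real.goldenRatio * a (k + 1))
      + (Real.goldenRatio - 1) * (a (k + 1) - Real.goldenRatio * a k) := by
    linear_combination a k * hg
  rw [e, abs_le]
  constructor <;> nlinarith

/-- A point approximating `ξ` as well as the terms of the sequence is proportional to one of
these terms. -/
theorem exists_proportional (h : ApproxSeq ξ y a K) {K' : ℝ} (hK' : 0 ≤ K') :
    ∃ (T : ℝ) (k₀ : ℕ), 0 ≤ T ∧ ∀ k ≥ k₀, ∀ (z : Fin 3 → ℤ) (b : ℝ),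
      |(z 0 : ℝ)| ≤ Real.exp (b + K') → ‖errVec ξ z‖ ≤ Real.exp (-b + K') →
      a k + T ≤ b → b ≤ a (k + 1) + T →
      triple (y k) (y (k + 1)) (y (k + 2)) • z = triple (y k) z (y (k + 2)) • y (k + 1) := by
  have hK := h.nonneg
  obtain ⟨k₀, hk₀⟩ := eventually_atTop.1
    (h.tendsto.eventually_ge_atTop (20 * (K' + 5 * K + 2)))
  -- The value of T is dictated by one product, the size of y_{k+2} times the errors of z and
  -- y_{k+1}, whose exponent is at most 4K + K' − T. In every other product a positive multiple of a
  -- k is left over, which the choice of k₀ makes large enough.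
  refine ⟨K' + 4 * K + 2, k₀, by positivity, fun k hk z b hz hz' hb hb' => ?_⟩
  have ha0 := hk₀ k hk
  have ha1 := hk₀ (k + 1) (by omega)
  have g0 := abs_le.1 (h.growth k)
  have g1 := abs_le.1 (h.growth_two k)
  have hg := goldenRatio_bounds
  have hmul : Real.goldenRatio * a k ≤ 7 / 4 * a k := by nlinarith
  -- z lies in the planes of (y_k, y_{k+1}) and of (y_{k+1}, y_{k+2}), which meet in the line of
  -- y_{k+1}.
  apply triple_smul_eq
  · exact triple_eq_zero_of_le hz hz' (h.abs_zero_le k) (h.err_le k) (h.abs_zero_le (k + 1))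
      (h.err_le (k + 1)) (by linarith) (by linarith) (by linarith)
  · exact triple_eq_zero_of_le hz hz' (h.abs_zero_le (k + 1)) (h.err_le (k + 1)) (h.abs_zero_le (k + 2))
      (h.err_le (k + 2)) (by linarith) (by linarith) (by linarith)

theorem eventually_add_le_succ (h : ApproxSeq ξ y a K) (T : ℝ) :
    ∀ᶠ k in atTop, a k + T ≤ a (k + 1) := by
  filter_upwards [h.tendsto.eventually_ge_atTop (2 * (T + K)), h.tendsto.eventually_ge_atTop 0]
    with k hk h0
  have g0 := abs_le.1 (h.growth k)
  have hg := goldenRatio_bounds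
  nlinarith

end ApproxSeq

/-! ### Effect on norms of multiplication by a fixed matrix -/

namespace IntMat2

/-- The left factor R stays general: R = 1 gives norms, and R = (ξ, −1) gives errors. -/
theorem norm_mul_real_mul_le {m : Type*} [Fintype m] (R : Matrix m (Fin 2) ℝ) (A N : IntMat2) :
    ‖R * real (A * N)‖ ≤ 2 * ‖real N‖ * ‖R * real A‖ := by
  rw [real_mul, ← Matrix.mul_assoc]
  exact (Matrix.norm_mul_le_two _ _).trans_eq (by ring)

theorem real_adjugate (A : IntMat2) : real A.adjugate = (real A).adjugate := by
  ext i j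
  fin_cases i <;> fin_cases j <;> simp [real_apply, Matrix.adjugate_fin_two]

theorem norm_real_adjugate_le (A : IntMat2) : ‖real A.adjugate‖ ≤ ‖real A‖ := by
  rw [real_adjugate]
  exact Matrix.norm_adjugate_fin_two _

theorem norm_mul_real_le_smul {m : Type*} [Fintype m] (R : Matrix m (Fin 2) ℝ) (A : IntMat2)
    {k : ℤ} (hk : k ≠ 0) : ‖R * real A‖ ≤ ‖R * real (k • A)‖ := by
  rw [Matrix.norm_le_iff (norm_nonneg _)]
  intro i j
  refine le_trans ?_ (Matrix.norm_entry_le_entrywise_sup_norm (R * real (k • A)) (i := i) (j := j))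
  rw [real_smul, Matrix.mul_smul, Matrix.smul_apply, norm_smul]
  refine le_mul_of_one_le_left (norm_nonneg _) ?_
  rw [Real.norm_eq_abs]
  exact_mod_cast Int.one_le_abs hk

/-- Multiplying back by adj N returns A times det N, a non-zero integer. -/
theorem norm_mul_real_le_mul {m : Type*} [Fintype m] (R : Matrix m (Fin 2) ℝ) (A : IntMat2)
    {N : IntMat2} (hN : N.det ≠ 0) : ‖R * real A‖ ≤ 2 * ‖real N‖ * ‖R * real (A * N)‖ := by
  have h : A * N * N.adjugate = N.det • A := by
    rw [Matrix.mul_assoc, Matrix.mul_adjugate, Matrix.mul_smul, Matrix.mul_one]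
  calc ‖R * real A‖ ≤ ‖R * real (N.det • A)‖ := norm_mul_real_le_smul R A hN
    _ ≤ 2 * ‖real N.adjugate‖ * ‖R * real (A * N)‖ := by
        rw [← h]; exact norm_mul_real_mul_le R _ _
    _ ≤ _ := by gcongr; exact norm_real_adjugate_le N

theorem norm_real_mul_le (A N : IntMat2) : ‖real (A * N)‖ ≤ 2 * ‖real N‖ * ‖real A‖ := by
  have h := norm_mul_real_mul_le (1 : Matrix (Fin 2) (Fin 2) ℝ) A N
  rwa [Matrix.one_mul, Matrix.one_mul] at h

/-- `N` with its transpose taken at the odd indices. -/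
def alternate (N : IntMat2) (i : ℕ) : IntMat2 := if Odd i then Nᵀ else N

theorem alternate_add_two (N : IntMat2) (i : ℕ) : alternate N (i + 2) = alternate N i := by
  have : Odd (i + 2) ↔ Odd i := by grind
  simp only [alternate, this]

theorem alternate_succ (N : IntMat2) (i : ℕ) : alternate N (i + 1) = (alternate N i)ᵀ := by
  have : Odd (i + 1) ↔ ¬ Odd i := by grind
  by_cases h : Odd i <;> simp [alternate, this, h]

theorem det_alternate (N : IntMat2) (i : ℕ) : (alternate N i).det = N.det := by
  unfold alternate
  split_ifs <;> simp

theorem norm_alternate (N : IntMat2) (i : ℕ) : ‖real (alternate N i)‖ = ‖real N‖ := by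
  unfold alternate
  split_ifs
  · rw [real_transpose, Matrix.norm_transpose]
  · rfl

theorem alternate_off_diag (N : IntMat2) (i : ℕ) (h : Nᵀ ≠ N) :
    alternate N i 0 1 - alternate N i 1 0 ≠ 0 := by
  have h' : N 0 1 - N 1 0 ≠ 0 := by
    intro h0
    apply h
    ext i j
    fin_cases i <;> fin_cases j <;> simp [Matrix.transpose_apply] <;> omega
  unfold alternate
  split_ifs
  · simp only [Matrix.transpose_apply]; omega
  · exact h'

end IntMat2

open IntMat2

theorem PrimMat.toReal_eq (A : PrimMat) : A.toReal = real A.toMat := rfl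

theorem PrimMat.det_ne_zero (A : PrimMat) : A.toMat.det ≠ 0 := A.2.2

theorem PrimMat.content_eq_one (A : PrimMat) : content A.toMat = 1 := A.2.1

theorem PrimMat.mul_proportional (A B : PrimMat) :
    Proportional (A * B).toMat (A.toMat * B.toMat) := by
  rw [PrimMat.toMat_mul]
  exact red_proportional (det_mul_ne_zero A.det_ne_zero B.det_ne_zero)

theorem PrimMat.one_le_norm (A : PrimMat) : 1 ≤ ‖A.toReal‖ := one_le_norm_real A.det_ne_zero

theorem norm_row_mul_symMat (ξ : ℝ) (x : Fin 3 → ℤ) :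
    ‖!![ξ, -1] * real (symMat x)‖ = ‖errVec ξ x‖ := by
  have h0 : (!![ξ, -1] * real (symMat x)) 0 0 = ξ * x 0 - x 1 := by
    simp [Matrix.mul_apply, real_apply, symMat, sub_eq_add_neg]
  have h1 : (!![ξ, -1] * real (symMat x)) 0 1 = ξ * x 1 - x 2 := by
    simp [Matrix.mul_apply, real_apply, symMat, sub_eq_add_neg]
  apply le_antisymm
  · rw [Matrix.norm_le_iff (norm_nonneg _)]
    intro i j
    fin_cases i
    fin_cases j
    · exact (congrArg norm h0).trans_le (abs_errVec_fst_le ξ x)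
    · exact (congrArg norm h1).trans_le (abs_errVec_snd_le ξ x)
  · apply norm_errVec_le
    · rw [← h0]
      exact Matrix.norm_entry_le_entrywise_sup_norm (!![ξ, -1] * real (symMat x))
    · rw [← h1]
      exact Matrix.norm_entry_le_entrywise_sup_norm (!![ξ, -1] * real (symMat x))

theorem abs_le_norm_symMat (x : Fin 3 → ℤ) :
    |(x 0 : ℝ)| ≤ ‖real (symMat x)‖ ∧ |(x 1 : ℝ)| ≤ ‖real (symMat x)‖ ∧
      |(x 2 : ℝ)| ≤ ‖real (symMat x)‖ :=
  ⟨Matrix.norm_entry_le_entrywise_sup_norm (real (symMat x)) (i := 0) (j := 0),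
    Matrix.norm_entry_le_entrywise_sup_norm (real (symMat x)) (i := 0) (j := 1),
    Matrix.norm_entry_le_entrywise_sup_norm (real (symMat x)) (i := 1) (j := 1)⟩

theorem norm_symMat_le_of {x : Fin 3 → ℤ} {B : ℝ} (h0 : |(x 0 : ℝ)| ≤ B) (h1 : |(x 1 : ℝ)| ≤ B)
    (h2 : |(x 2 : ℝ)| ≤ B) : ‖real (symMat x)‖ ≤ B := by
  rw [Matrix.norm_le_iff ((abs_nonneg _).trans h0)]
  intro i j
  fin_cases i <;> fin_cases j
  exacts [h0, h1, h1, h2]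

theorem norm_symMat_le (ξ : ℝ) (x : Fin 3 → ℤ) :
    ‖real (symMat x)‖ ≤ (1 + |ξ|) ^ 2 * (|(x 0 : ℝ)| + ‖errVec ξ x‖) := by
  obtain ⟨h1, h2⟩ := abs_coord_bounds ξ x
  have e0 := norm_nonneg (errVec ξ x)
  have e1 := abs_nonneg (x 0 : ℝ)
  have e2 := abs_nonneg ξ
  have e3 := mul_nonneg e2 e0
  have e4 := mul_nonneg e2 e1
  have e5 := mul_nonneg e2 e3
  have e6 := mul_nonneg e2 e4
  have h3 : |ξ| * |(x 1 : ℝ)| ≤ |ξ| * (|ξ| * |(x 0 : ℝ)| + ‖errVec ξ x‖) := by gcongr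
  apply norm_symMat_le_of <;> nlinarith

/-- Linear independence criterion for a symmetric matrix proportional to a product of two symmetric
matrices and the adjugate of a third matrix. -/
theorem triple_eq_of_smul_symMat {x y z : Fin 3 → ℤ} {N : IntMat2} {p q : ℤ}
    (h : p • symMat z = q • (symMat y * (N.adjugate * symMat x))) :
    p * triple x y z = q * ((symMat x).det * (symMat y).det * (N 0 1 - N 1 0)) := by
  have h00 := congrFun (congrFun h 0) 0
  have h01 := congrFun (congrFun h 0) 1
  have h10 := congrFun (congrFun h 1) 0
  have h11 := congrFun (congrFun h 1) 1
  simp only [symMat, Matrix.adjugate_fin_two, Matrix.smul_apply, Matrix.mul_apply,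
    Fin.sum_univ_two, Matrix.of_apply, Matrix.cons_val', Matrix.cons_val_zero,
    Matrix.cons_val_one, Matrix.cons_val_fin_one, smul_eq_mul] at h00 h01 h10 h11
  rw [det_symMat, det_symMat, triple]
  have : (2 : ℤ) ≠ 0 := two_ne_zero
  apply mul_left_cancel₀ this
  linear_combination 2 * (x 1 * y 2 - x 2 * y 1) * h00 + (x 2 * y 0 - x 0 * y 2) * (h01 + h10)
    + 2 * (x 0 * y 1 - x 1 * y 0) * h11 + (x 0 * y 2 + x 2 * y 0 - 2 * x 1 * y 1) * (h10 - h01)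

/-! ### Symmetric points of an admissible Fibonacci sequence -/

/-- The integer points attached to an admissible Fibonacci sequence. -/
structure SymmetricPoints (W : ℕ → PrimMat) (N : IntMat2) (x : ℕ → Fin 3 → ℤ) : Prop where
  det_ne : N.det ≠ 0
  not_symm : Nᵀ ≠ N
  eq : ∀ i, 1 ≤ i → symMat (x i) = (W i).toMat * alternate N i

theorem IsAdmissible.exists_symmetricPoints {W : ℕ → PrimMat} (h : IsAdmissible W) :
    ∃ N x, SymmetricPoints W N x := by
  obtain ⟨N, h1, -, h3⟩ := h
  have : ∀ i, ∃ x, 1 ≤ i → symMat x = (W i).toMat * alternate N.toMat i := by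
    intro i
    by_cases hi : 1 ≤ i
    · obtain ⟨x, hx⟩ := exists_symMat_eq (h3 i hi)
      exact ⟨x, fun _ => hx⟩
    · exact ⟨0, fun h => absurd h hi⟩
  choose x hx using this
  exact ⟨N.toMat, x, N.det_ne_zero, h1, hx⟩

theorem IsFibonacciSeq.proportional {W : ℕ → PrimMat} (hW : IsFibonacciSeq W) {i : ℕ}
    (hi : 1 ≤ i) : Proportional (W (i + 2)).toMat ((W (i + 1)).toMat * (W i).toMat) := by
  rw [hW i hi]
  exact PrimMat.mul_proportional _ _

namespace SymmetricPoints

variable {W : ℕ → PrimMat} {N : IntMat2} {x : ℕ → Fin 3 → ℤ}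

theorem det_eq (h : SymmetricPoints W N x) {i : ℕ} (hi : 1 ≤ i) :
    (symMat (x i)).det = (W i).toMat.det * N.det := by
  rw [h.eq i hi, Matrix.det_mul, det_alternate]

theorem det_symMat_ne (h : SymmetricPoints W N x) {i : ℕ} (hi : 1 ≤ i) :
    (symMat (x i)).det ≠ 0 := by
  rw [h.det_eq hi]
  exact mul_ne_zero (W i).det_ne_zero h.det_ne

/-- Insert N_{i+1} adj(N_{i+1}), a scalar, between W_{i+1} and W_i, and use N_{i+2} = N_i. -/
theorem proportional (h : SymmetricPoints W N x) (hW : IsFibonacciSeq W) {i : ℕ} (hi : 1 ≤ i) :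
    Proportional (symMat (x (i + 2)))
      (symMat (x (i + 1)) * ((alternate N (i + 1)).adjugate * symMat (x i))) := by
  have hd : (alternate N (i + 1)).det ≠ 0 := by rw [det_alternate]; exact h.det_ne
  rw [h.eq (i + 2) (by omega), h.eq (i + 1) (by omega), h.eq i hi, alternate_add_two,
    ← Matrix.mul_assoc]
  refine ((hW.proportional hi).mul (.refl _)).trans ?_
  rw [Matrix.mul_assoc]
  exact ((Proportional.mul_mul_adjugate_cancel hd _).symm).mul (.refl _)

/-- By the recurrence this determinant is, up to non-zero factors, N₀₁ − N₁₀; this is where the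
asymmetry of N enters. -/
theorem triple_ne (h : SymmetricPoints W N x) (hW : IsFibonacciSeq W) {i : ℕ} (hi : 1 ≤ i) :
    triple (x i) (x (i + 1)) (x (i + 2)) ≠ 0 := by
  obtain ⟨p, q, hp, hq, hpq⟩ := h.proportional hW hi
  intro h0
  have := triple_eq_of_smul_symMat hpq
  rw [h0, mul_zero] at this
  exact mul_ne_zero hq (mul_ne_zero (mul_ne_zero (h.det_symMat_ne hi)
    (h.det_symMat_ne (by omega))) (alternate_off_diag N _ h.not_symm)) this.symm

theorem norm_mul_symMat_le (h : SymmetricPoints W N x) {m : Type*} [Fintype m]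
    (R : Matrix m (Fin 2) ℝ) {i : ℕ} (hi : 1 ≤ i) :
    ‖R * real (symMat (x i))‖ ≤ 2 * ‖real N‖ * ‖R * (W i).toReal‖ := by
  rw [h.eq i hi, ← norm_alternate N i]
  exact norm_mul_real_mul_le R _ _

theorem norm_mul_le_symMat (h : SymmetricPoints W N x) {m : Type*} [Fintype m]
    (R : Matrix m (Fin 2) ℝ) {i : ℕ} (hi : 1 ≤ i) :
    ‖R * (W i).toReal‖ ≤ 2 * ‖real N‖ * ‖R * real (symMat (x i))‖ := by
  have hd : (alternate N i).det ≠ 0 := by rw [det_alternate]; exact h.det_ne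
  rw [h.eq i hi, ← norm_alternate N i]
  exact norm_mul_real_le_mul R _ hd

theorem norm_symMat_le (h : SymmetricPoints W N x) {i : ℕ} (hi : 1 ≤ i) :
    ‖real (symMat (x i))‖ ≤ 2 * ‖real N‖ * ‖(W i).toReal‖ := by
  have h1 := h.norm_mul_symMat_le (1 : Matrix (Fin 2) (Fin 2) ℝ) hi
  rwa [Matrix.one_mul, Matrix.one_mul] at h1

theorem norm_le_symMat (h : SymmetricPoints W N x) {i : ℕ} (hi : 1 ≤ i) :
    ‖(W i).toReal‖ ≤ 2 * ‖real N‖ * ‖real (symMat (x i))‖ := by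
  have h1 := h.norm_mul_le_symMat (1 : Matrix (Fin 2) (Fin 2) ℝ) hi
  rwa [Matrix.one_mul, Matrix.one_mul] at h1

end SymmetricPoints

/-! ### Logarithmic form of the estimates -/

theorem SeqAsymp.exists_abs_log_sub_le {f g : ℕ → ℝ} (hf : ∀ i, 1 ≤ i → 0 < f i)
    (hg : ∀ i, 1 ≤ i → 0 < g i) (h : SeqAsymp f g) :
    ∃ K, ∀ i, 1 ≤ i → |Real.log (f i) - Real.log (g i)| ≤ K := by
  obtain ⟨⟨c, hc, h1⟩, d, hd, h2⟩ := h
  refine ⟨max (Real.log c) (Real.log d), fun i hi => ?_⟩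
  have e1 := Real.log_le_log (hf i hi) (h1 i hi)
  have e2 := Real.log_le_log (hg i hi) (h2 i hi)
  rw [Real.log_mul hc.ne' (hg i hi).ne'] at e1
  rw [Real.log_mul hd.ne' (hf i hi).ne'] at e2
  rw [abs_le]
  constructor
  · linarith [le_max_right (Real.log c) (Real.log d)]
  · linarith [le_max_left (Real.log c) (Real.log d)]

theorem seqAsymp_of_abs_log_sub_le {f g : ℕ → ℝ} {K : ℝ} (hf : ∀ i, 1 ≤ i → 0 < f i)
    (hg : ∀ i, 1 ≤ i → 0 < g i) (h : ∀ i, 1 ≤ i → |Real.log (f i) - Real.log (g i)| ≤ K) :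
    SeqAsymp f g := by
  refine ⟨⟨Real.exp K, Real.exp_pos _, fun i hi => ?_⟩, Real.exp K, Real.exp_pos _,
    fun i hi => ?_⟩
  · rw [← Real.log_le_log_iff (hf i hi) (mul_pos (Real.exp_pos _) (hg i hi)),
      Real.log_mul (Real.exp_pos _).ne' (hg i hi).ne', Real.log_exp]
    linarith [(abs_le.1 (h i hi)).2]
  · rw [← Real.log_le_log_iff (hg i hi) (mul_pos (Real.exp_pos _) (hf i hi)),
      Real.log_mul (Real.exp_pos _).ne' (hf i hi).ne', Real.log_exp]
    linarith [(abs_le.1 (h i hi)).1]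

/-- Once a term exceeds 2K + 1, the bound γ > 3/2 makes each later step add at least 1/2. -/
theorem tendsto_atTop_of_growth {a : ℕ → ℝ} {K : ℝ} (hK : 0 ≤ K)
    (h : ∀ k, |a (k + 1) - Real.goldenRatio * a k| ≤ K) (hub : ∀ B, ∃ k, B < a k) :
    Tendsto a atTop atTop := by
  obtain ⟨m, hm⟩ := hub (2 * K + 1)
  have key : ∀ n : ℕ, 2 * K + 1 + n / 2 ≤ a (n + m) := by
    intro n
    induction n with
    | zero => simpa using hm.le
    | succ n ih =>
      have h1 := abs_le.1 (h (n + m))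
      have hg := goldenRatio_bounds
      have hn : (0 : ℝ) ≤ n := n.cast_nonneg
      have : (3 / 2) * a (n + m) ≤ Real.goldenRatio * a (n + m) := by
        apply mul_le_mul_of_nonneg_right hg.1.le; linarith
      rw [add_right_comm n 1 m]
      push_cast
      linarith
  rw [← tendsto_add_atTop_iff_nat m]
  refine tendsto_atTop_mono key (tendsto_atTop_add_const_left _ _ ?_)
  exact tendsto_natCast_atTop_atTop.atTop_div_const two_pos

/-- Replacing W_i by W_i N_i changes norms and errors by bounded factors only. Indices move by one
because Fibonacci sequences start at 1. -/
theorem SymmetricPoints.exists_approxSeq {W : ℕ → PrimMat} {N : IntMat2} {x : ℕ → Fin 3 → ℤ}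
    {ξ : ℝ} (h : SymmetricPoints W N x) (hF : IsFibonacciSeq W) (hU : IsUnboundedSeq W)
    (hE : SatisfiesEstimates ξ W) :
    ∃ K, ApproxSeq ξ (fun k => x (k + 1)) (fun k => Real.log ‖(W (k + 1)).toReal‖) K := by
  have hpos : ∀ i, 0 < ‖(W i).toReal‖ := fun i => one_pos.trans_le (W i).one_le_norm
  obtain ⟨K₁, h1⟩ := hE.1.exists_abs_log_sub_le (fun i _ => hpos _)
    (fun i _ => Real.rpow_pos_of_pos (hpos i) _)
  obtain ⟨c, hc, h2⟩ := hE.2.1.1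
  have hNpos : 0 < ‖real N‖ := one_pos.trans_le (one_le_norm_real h.det_ne)
  set K₂ := Real.log (2 * ‖real N‖)
  set K₃ := Real.log (2 * ‖real N‖ * c)
  set K₄ := Real.log (2 * ‖real N‖ * (1 + |ξ|) ^ 2)
  have hξ : 0 < 1 + |ξ| := by positivity
  set K := max (max K₁ K₂) (max K₃ K₄)
  have b1 : K₁ ≤ K := (le_max_left _ _).trans (le_max_left _ _)
  have b2 : K₂ ≤ K := (le_max_right _ _).trans (le_max_left _ _)
  have b3 : K₃ ≤ K := (le_max_left _ _).trans (le_max_right _ _)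
  have b4 : K₄ ≤ K := (le_max_right _ _).trans (le_max_right _ _)
  have hgrow : ∀ k, |Real.log ‖(W (k + 1 + 1)).toReal‖
      - Real.goldenRatio * Real.log ‖(W (k + 1)).toReal‖| ≤ K := by
    intro k
    rw [← Real.log_rpow (hpos _)]
    exact (h1 (k + 1) (by omega)).trans b1
  refine ⟨K, hgrow, ?_, fun k => Real.log_nonneg (W (k + 1)).one_le_norm, ?_, ?_, ?_, ?_⟩
  · refine tendsto_atTop_of_growth ((abs_nonneg _).trans (hgrow 0)) hgrow fun B => ?_
    obtain ⟨i, hi, hB⟩ := hU (Real.exp B)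
    refine ⟨i - 1, ?_⟩
    rw [Nat.sub_add_cancel hi]
    exact (Real.lt_log_iff_exp_lt (hpos i)).2 hB
  · intro k
    refine (abs_le_norm_symMat _).1.trans ((h.norm_symMat_le (by omega)).trans ?_)
    rw [Real.exp_add, Real.exp_log (hpos _), mul_comm]
    gcongr
    exact (Real.log_le_iff_le_exp (by positivity)).1 b2
  · intro k
    rw [← norm_row_mul_symMat]
    refine (h.norm_mul_symMat_le _ (by omega)).trans ?_
    rw [Real.exp_add, Real.exp_neg, Real.exp_log (hpos _), mul_comm (_)⁻¹]
    refine (mul_le_mul_of_nonneg_left (h2 (k + 1) (by omega)) (by positivity)).trans ?_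
    rw [← mul_assoc]
    gcongr
    exact (Real.log_le_iff_le_exp (by positivity)).1 b3
  · intro k
    have e1 := (h.norm_le_symMat (i := k + 1) (by omega)).trans
      (mul_le_mul_of_nonneg_left (_root_.norm_symMat_le ξ (x (k + 1))) (by positivity))
    have e2 := (Real.log_le_iff_le_exp (by positivity)).1 b4
    rw [Real.exp_sub, Real.exp_log (hpos _), div_le_iff₀ (Real.exp_pos _), mul_comm]
    refine e1.trans ?_
    rw [← mul_assoc]
    gcongr
  · intro k
    exact h.triple_ne hF (by omega)

/-! ### Uniqueness -/

/-- Up to sign, x is z multiplied by the ratio of the two contents, a ratio at most M since the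
content of z is at least 1. -/
theorem size_le_of_proportional (ξ : ℝ) {x z : Fin 3 → ℤ} {M : ℝ}
    (hz : (symMat z).det ≠ 0) (hM : (content (symMat x) : ℝ) ≤ M)
    (h : Proportional (symMat x) (symMat z)) :
    |(x 0 : ℝ)| ≤ M * |(z 0 : ℝ)| ∧ ‖errVec ξ x‖ ≤ M * ‖errVec ξ z‖ := by
  have hx := h.symm.det_ne_zero hz
  set c := content (symMat x)
  set d := content (symMat z)
  have hd : 1 ≤ d := content_pos hz
  have hc : 1 ≤ c := content_pos hx
  have key : ∀ w : Fin 3 → ℤ, symMat (d • x) = symMat (c • w) →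
      |(x 0 : ℝ)| ≤ M * |(w 0 : ℝ)| ∧ ‖errVec ξ x‖ ≤ M * ‖errVec ξ w‖ := by
    intro w hw
    have hw' := symMat_injective hw
    have hd0 : (0 : ℝ) ≤ d := by exact_mod_cast (by omega : 0 ≤ d)
    have hc0 : (0 : ℝ) ≤ c := by exact_mod_cast (by omega : 0 ≤ c)
    have e1 : (d : ℝ) * ‖errVec ξ x‖ = c * ‖errVec ξ w‖ := by
      have := congrArg (fun v => ‖errVec ξ v‖) hw'
      simp only [norm_errVec_smul] at this
      rwa [abs_of_nonneg hd0, abs_of_nonneg hc0] at this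
    have e2 : (d : ℝ) * |(x 0 : ℝ)| = c * |(w 0 : ℝ)| := by
      have h0 : d * x 0 = c * w 0 := by simpa using congrFun hw' 0
      have := congrArg (fun t : ℤ => |(t : ℝ)|) h0
      simp only [Int.cast_mul, abs_mul] at this
      rwa [abs_of_nonneg hd0, abs_of_nonneg hc0] at this
    have hd' : (1 : ℝ) ≤ d := by exact_mod_cast hd
    constructor
    · refine (le_mul_of_one_le_left (abs_nonneg _) hd').trans ?_
      rw [e2]
      gcongr
    · refine (le_mul_of_one_le_left (norm_nonneg _) hd').trans ?_
      rw [e1]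
      gcongr
  rcases content_smul_eq_or_of_proportional hx h with h | h
  · exact key z (by rw [symMat_smul, symMat_smul, h])
  · have := key (-z) (by rw [symMat_smul, symMat_smul, symMat_neg, h, smul_neg])
    simpa using this

namespace ApproxSeq

variable {ξ : ℝ} {y y' : ℕ → Fin 3 → ℤ} {a a' : ℕ → ℝ} {K K' : ℝ}

/-- Proportional points of bounded content have comparable sizes; the opposite inequality follows by
exchanging the two sequences. -/
theorem le_add_of_proportional (h : ApproxSeq ξ y a K) (h' : ApproxSeq ξ y' a' K') {M : ℝ}
    (hM : 0 < M) {j k : ℕ} (hc : (content (symMat (y' j)) : ℝ) ≤ M)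
    (hd : (symMat (y k)).det ≠ 0) (hp : Proportional (symMat (y' j)) (symMat (y k)))
    (ha : 0 ≤ a k) : a' j ≤ a k + (Real.log (2 * M) + K + K') := by
  have h1 : |(y' j 0 : ℝ)| + ‖errVec ξ (y' j)‖ ≤ M * (|(y k 0 : ℝ)| + ‖errVec ξ (y k)‖) := by
    obtain ⟨h1, h2⟩ := size_le_of_proportional ξ hd hc hp
    linarith
  have h2 : |(y k 0 : ℝ)| + ‖errVec ξ (y k)‖ ≤ 2 * Real.exp (a k + K) := by
    have : Real.exp (-a k + K) ≤ Real.exp (a k + K) := Real.exp_le_exp.2 (by linarith)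
    linarith [h.abs_zero_le k, h.err_le k]
  have h3 : Real.exp (a' j - K') ≤ Real.exp (Real.log (2 * M) + (a k + K)) := by
    rw [Real.exp_add, Real.exp_log (by positivity)]
    refine (h'.le_size j).trans (h1.trans ?_)
    rw [mul_comm 2 M, mul_assoc]
    gcongr
  linarith [Real.exp_le_exp.1 h3]

/-- The index is the least k ≥ k₁ with b ≤ a (k + 1) + T. -/
theorem exists_between (h : ApproxSeq ξ y a K) {T b : ℝ} {k₁ : ℕ} (hb : a k₁ + T ≤ b) :
    ∃ k ≥ k₁, a k + T ≤ b ∧ b ≤ a (k + 1) + T := by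
  have hex : ∃ k, k₁ ≤ k ∧ b ≤ a (k + 1) + T := by
    obtain ⟨n, hn⟩ := eventually_atTop.1 (h.tendsto.eventually_ge_atTop (b - T))
    exact ⟨max n k₁, le_max_right _ _, by linarith [hn (max n k₁ + 1) (by omega)]⟩
  classical
  obtain ⟨h1, h2⟩ := Nat.find_spec hex
  refine ⟨Nat.find hex, h1, ?_, h2⟩
  rcases h1.eq_or_lt with h0 | h0
  · rwa [← h0]
  · have hlt := Nat.find_min hex (m := Nat.find hex - 1) (by omega)
    have h3 : ¬ b ≤ a (Nat.find hex - 1 + 1) + T := fun hcon => hlt ⟨by omega, hcon⟩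
    rw [Nat.sub_add_cancel (by omega)] at h3
    linarith

/-- Two sequences of approximations to `ξ` eventually agree up to proportionality and a shift. -/
theorem exists_shift_proportional (h : ApproxSeq ξ y a K) (h' : ApproxSeq ξ y' a' K')
    (hd : ∀ k, (symMat (y k)).det ≠ 0) (hd' : ∀ k, (symMat (y' k)).det ≠ 0) {M : ℝ}
    (hM : ∀ k, (content (symMat (y k)) : ℝ) ≤ M) (hM' : ∀ k, (content (symMat (y' k)) : ℝ) ≤ M) :
    ∃ p q : ℕ, ∀ n, Proportional (symMat (y' (p + n))) (symMat (y (q + n))) := by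
  have hMpos : 0 < M := lt_of_lt_of_le (by exact_mod_cast content_pos (hd 0)) (hM 0)
  obtain ⟨T, k₀, -, hT⟩ := h.exists_proportional h'.nonneg
  have hg := goldenRatio_bounds
  set C := Real.log (2 * M) + K + K'
  -- Largest possible distance between a at i (j + 1) and at i j + 1: C to reach a' (j + 1), K' to γ
  -- a' j, 2C (as γ < 2) to γ a (i j), and K to the end. Beyond k₁ the values of a at distinct
  -- indices are further apart, so these two indices coincide.
  set C₂ := 3 * C + K' + K
  obtain ⟨k₁, hk₁⟩ := eventually_atTop.1 ((h.eventually_add_le_succ (C₂ + 1)).and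
    ((h.tendsto.eventually_ge_atTop 0).and (eventually_ge_atTop k₀)))
  obtain ⟨j₀, hj₀⟩ := eventually_atTop.1 ((h'.tendsto.eventually_ge_atTop (a k₁ + T)).and
    (h'.tendsto.eventually_ge_atTop 0))
  have step : ∀ j, ∃ i, k₁ ≤ i ∧ (j₀ ≤ j →
      Proportional (symMat (y' j)) (symMat (y i)) ∧ |a' j - a i| ≤ C) := by
    intro j
    by_cases hj : j₀ ≤ j
    · obtain ⟨k, hk, hb, hb'⟩ := h.exists_between (hj₀ j hj).1
      refine ⟨k + 1, by omega, fun _ => ?_⟩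
      have heq := hT k (hk₁ k hk).2.2 (y' j) (a' j) (h'.abs_zero_le j) (h'.err_le j) hb hb'
      have hp : Proportional (symMat (y' j)) (symMat (y (k + 1))) := by
        refine ⟨_, _, h.triple_ne k, ?_, by rw [← symMat_smul, heq, symMat_smul]⟩
        intro h0
        rw [h0, zero_smul] at heq
        rcases smul_eq_zero.1 heq with h1 | h1
        · exact h.triple_ne k h1
        · exact hd' j (by rw [h1]; simp [det_symMat])
      refine ⟨hp, abs_le.2 ⟨?_, ?_⟩⟩
      · have := h'.le_add_of_proportional h hMpos (hM (k + 1)) (hd' j) hp.symm (hj₀ j hj).2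
        linarith
      · have := h.le_add_of_proportional h' hMpos (hM' j) (hd (k + 1)) hp
          (hk₁ (k + 1) (by omega)).2.1
        linarith
    · exact ⟨k₁, le_rfl, fun h => absurd h hj⟩
  choose i hik hi using step
  have hCnn : 0 ≤ C := (abs_nonneg _).trans (hi j₀ le_rfl).2
  have gap : ∀ n m, k₁ ≤ m → a m + (C₂ + 1) ≤ a (m + n + 1) := by
    intro n
    have hC₂' : 0 ≤ C₂ := by
      have := h.nonneg
      have := h'.nonneg
      positivity
    induction n with
    | zero => exact fun m hm => (hk₁ m hm).1
    | succ n ih =>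
      intro m hm
      have h1 := (hk₁ (m + n + 1) (by omega)).1
      rw [← add_assoc m n 1]
      linarith [ih m hm]
  have hsucc : ∀ j, j₀ ≤ j → i (j + 1) = i j + 1 := by
    intro j hj
    have e1 := abs_le.1 (hi j hj).2
    have e2 := abs_le.1 (hi (j + 1) (by omega)).2
    have e3 := abs_le.1 (h.growth (i j))
    have e4 := abs_le.1 (h'.growth j)
    have e5 : Real.goldenRatio * (a' j - a (i j)) ≤ 2 * C := by nlinarith
    have e6 : -(2 * C) ≤ Real.goldenRatio * (a' j - a (i j)) := by nlinarith
    rcases lt_trichotomy (i (j + 1)) (i j + 1) with hlt | heq | hgt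
    · obtain ⟨n, hn⟩ := Nat.exists_eq_add_of_lt hlt
      have := gap n _ (hik (j + 1))
      rw [← hn] at this
      linarith
    · exact heq
    · obtain ⟨n, hn⟩ := Nat.exists_eq_add_of_lt hgt
      have := gap n (i j + 1) ((hik j).trans (Nat.le_succ _))
      rw [← hn] at this
      linarith
  refine ⟨j₀, i j₀, fun n => ?_⟩
  have : i (j₀ + n) = i j₀ + n := by
    induction n with
    | zero => rfl
    | succ n ih => rw [← add_assoc, hsucc _ (by omega), ih, add_assoc]
  rw [← this]
  exact (hi _ (by omega)).1

end ApproxSeq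

theorem PrimMat.content_smul_toMat_mul (A B : PrimMat) :
    content (A.toMat * B.toMat) • (A * B).toMat = A.toMat * B.toMat := by
  rw [PrimMat.toMat_mul, content_smul_red]

theorem content_units_smul (u : ℤˣ) (A : IntMat2) : content ((u : ℤ) • A) = content A := by
  rw [content_smul, Int.abs_eq_natAbs, Int.units_natAbs]
  simp

theorem PrimMat.toMat_ne_zero (A : PrimMat) : A.toMat ≠ 0 := fun h =>
  A.det_ne_zero (by rw [h]; simp)

/-- Two Fibonacci sequences of primitive matrices which agree up to sign differ by a Fibonacci
sequence of signs. -/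
theorem exists_sign_fibonacci {W W' : ℕ → PrimMat} {p q : ℕ} (hW : IsFibonacciSeq W)
    (hW' : IsFibonacciSeq W')
    (h : ∀ i, 1 ≤ i → Proportional (W' (i + p)).toMat (W (i + q)).toMat) :
    ∃ ε : ℕ → ℤˣ, IsFibonacciSeq ε ∧
      ∀ i, 1 ≤ i → (W' (i + p)).toMat = (ε i : ℤ) • (W (i + q)).toMat := by
  have : ∀ i, ∃ u : ℤˣ, 1 ≤ i → (W' (i + p)).toMat = (u : ℤ) • (W (i + q)).toMat := by
    intro i
    by_cases hi : 1 ≤ i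
    · rcases eq_or_eq_neg_of_proportional (PrimMat.content_eq_one _) (PrimMat.content_eq_one _)
        (h i hi) with h | h
      · exact ⟨1, fun _ => by rw [h, Units.val_one, one_smul]⟩
      · exact ⟨-1, fun _ => by rw [h, Units.val_neg, Units.val_one, neg_smul, one_smul]⟩
    · exact ⟨1, fun h => absurd h hi⟩
  choose ε hε using this
  refine ⟨ε, fun i hi => ?_, hε⟩
  have e1 := PrimMat.content_smul_toMat_mul (W' (i + 1 + p)) (W' (i + p))
  have e2 := PrimMat.content_smul_toMat_mul (W (i + 1 + q)) (W (i + q))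
  have f1 : W' (i + 1 + p) * W' (i + p) = W' (i + 2 + p) := by
    have := hW' (i + p) (by omega)
    rw [show i + 2 + p = i + p + 2 by ring, this, show i + p + 1 = i + 1 + p by ring]
  have f2 : W (i + 1 + q) * W (i + q) = W (i + 2 + q) := by
    have := hW (i + q) (by omega)
    rw [show i + 2 + q = i + q + 2 by ring, this, show i + q + 1 = i + 1 + q by ring]
  have f3 : (W' (i + 1 + p)).toMat * (W' (i + p)).toMat
      = ((ε (i + 1) * ε i : ℤˣ) : ℤ) • ((W (i + 1 + q)).toMat * (W (i + q)).toMat) := by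
    rw [hε (i + 1) (by omega), hε i hi, smul_mul_smul_comm, Units.val_mul]
  rw [f2] at e2
  -- Signs do not affect the content, so both products are divided by the same c and only the signs
  -- remain to be compared.
  rw [f3, content_units_smul, f1, hε (i + 2) (by omega)] at e1
  set c := content ((W (i + 1 + q)).toMat * (W (i + q)).toMat)
  rw [← e2, smul_smul, smul_smul] at e1
  have hne : c ≠ 0 := content_ne_zero (det_mul_ne_zero (W (i + 1 + q)).det_ne_zero (W (i + q)).det_ne_zero)
  have := smul_left_injective ℤ (W (i + 2 + q)).toMat_ne_zero e1
  rw [mul_comm] at this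
  exact Units.ext (mul_right_cancel₀ hne this)

/-- The symmetric points of the two sequences agree up to shift and scalars; what remains is to
remove the matrices N and N'. -/
theorem IsAssociated.eq_up_to_shift_and_sign {ξ : ℝ} {W W' : ℕ → PrimMat}
    (h : IsAssociated ξ W) (h' : IsAssociated ξ W') :
    ∃ (k l : ℕ) (ε : ℕ → ℤˣ), IsFibonacciSeq ε ∧
      ∀ i, 1 ≤ i → (W' (i + k)).toMat = (ε i : ℤ) • (W (i + l)).toMat := by
  obtain ⟨hF, hA, hU, hE⟩ := h
  obtain ⟨hF', hA', hU', hE'⟩ := h'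
  obtain ⟨N, x, hx⟩ := hA.exists_symmetricPoints
  obtain ⟨N', x', hx'⟩ := hA'.exists_symmetricPoints
  obtain ⟨K, hK⟩ := hx.exists_approxSeq hF hU hE
  obtain ⟨K', hK'⟩ := hx'.exists_approxSeq hF' hU' hE'
  have bound : ∀ {V : ℕ → PrimMat} {P : IntMat2} {z : ℕ → Fin 3 → ℤ}, SymmetricPoints V P z →
      SatisfiesEstimates ξ V → ∃ M : ℝ, ∀ k, (content (symMat (z (k + 1))) : ℝ) ≤ M := by
    intro V P z hz hV
    obtain ⟨c, hc, hb⟩ := hV.2.2.1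
    refine ⟨c * |(P.det : ℝ)|, fun k => ?_⟩
    have h1 : (content (symMat (z (k + 1))) : ℝ) ≤ |((symMat (z (k + 1))).det : ℝ)| := by
      exact_mod_cast content_le_abs_det (hz.det_symMat_ne (by omega))
    have h2 := hb (k + 1) (by omega)
    simp only [PrimMat.toReal_eq, det_real, mul_one] at h2
    rw [hz.det_eq (by omega), Int.cast_mul, abs_mul] at h1
    exact h1.trans (by gcongr)
  obtain ⟨M, hM⟩ := bound hx hE
  obtain ⟨M', hM'⟩ := bound hx' hE'
  obtain ⟨p, q, hpq⟩ := hK.exists_shift_proportional hK' (fun k => hx.det_symMat_ne (by omega))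
    (fun k => hx'.det_symMat_ne (by omega)) (fun k => (hM k).trans (le_max_left M M'))
    (fun k => (hM' k).trans (le_max_right M M'))
  have hdN : ∀ i, (alternate N i).det ≠ 0 := fun i => by rw [det_alternate]; exact hx.det_ne
  have hdN' : ∀ i, (alternate N' i).det ≠ 0 := fun i => by rw [det_alternate]; exact hx'.det_ne
  set A : ℕ → IntMat2 := fun n => alternate N (q + n + 1) * (alternate N' (p + n + 1)).adjugate
    with hAdef
  have hA2 : ∀ n, A (n + 2) = A n := fun n => by
    simp only [hAdef]
    rw [show q + (n + 2) + 1 = q + n + 1 + 2 by ring, show p + (n + 2) + 1 = p + n + 1 + 2 by ring,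
      alternate_add_two, alternate_add_two]
  have hAdet : ∀ n, (A n).det ≠ 0 := fun n => by
    simp only [hAdef, Matrix.det_mul, Matrix.det_adjugate]
    exact mul_ne_zero (hdN _) (pow_ne_zero _ (hdN' _))
  have hWA : ∀ n, Proportional (W' (p + n + 1)).toMat ((W (q + n + 1)).toMat * A n) := by
    intro n
    have := hpq n
    rw [hx.eq _ (by omega), hx'.eq _ (by omega)] at this
    have h2 := this.mul (.refl (alternate N' (p + n + 1)).adjugate)
    rw [Matrix.mul_assoc (W (q + n + 1)).toMat] at h2
    exact (Proportional.mul_mul_adjugate_cancel (hdN' _) _).symm.trans h2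
  -- Since A has period two, W_{n+1} W_n A_n and W_{n+1} A_{n+1} W_n A_n are both proportional to
  -- the same term of W'; cancelling on both sides leaves A_{n+1}.
  have hA1 : ∀ n, Proportional (A (n + 1)) 1 := by
    intro n
    have h1 := hWA (n + 2)
    rw [hA2] at h1
    have h2 := (hF'.proportional (i := p + n + 1) (by omega)).trans ((hWA (n + 1)).mul (hWA n))
    have h3 := (hF.proportional (i := q + n + 1) (by omega)).mul (.refl (A n))
    have h4 := h3.symm.trans (h1.symm.trans h2)
    rw [Matrix.mul_assoc, Matrix.mul_assoc] at h4
    have h5 := Proportional.cancel_left (PrimMat.det_ne_zero _) h4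
    have hdet : ((W (q + n + 1)).toMat * A n).det ≠ 0 :=
      det_mul_ne_zero (PrimMat.det_ne_zero _) (hAdet n)
    refine (Proportional.cancel_right hdet ?_).symm
    rw [Matrix.one_mul]
    exact h5
  have hfin : ∀ i, 1 ≤ i → Proportional (W' (i + (p + 1))).toMat (W (i + (q + 1))).toMat := by
    intro i hi
    obtain ⟨n, rfl⟩ := Nat.exists_eq_add_of_le' hi
    have := (hWA (n + 1)).trans ((Proportional.refl _).mul (hA1 n))
    rw [Matrix.mul_one] at this
    rwa [show n + 1 + (p + 1) = p + (n + 1) + 1 by ring,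
      show n + 1 + (q + 1) = q + (n + 1) + 1 by ring]
  obtain ⟨ε, h1, h2⟩ := exists_sign_fibonacci hF hF' hfin
  exact ⟨p + 1, q + 1, ε, h1, h2⟩

/-! ### From good approximations to extremality and (E) -/

/-- The finitely many exceptional indices are absorbed into the constant. -/
theorem exists_forall_le_exp_add {f g : ℕ → ℝ} {K : ℝ}
    (h : ∀ᶠ k in atTop, f k ≤ Real.exp (g k + K)) : ∃ K', ∀ k, f k ≤ Real.exp (g k + K') := by
  have hb : BddAbove (Set.range fun k => f k * Real.exp (-g k)) := by
    apply Filter.IsBoundedUnder.bddAbove_range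
    refine ⟨Real.exp K, ?_⟩
    rw [eventually_map]
    filter_upwards [h] with k hk
    calc f k * Real.exp (-g k) ≤ Real.exp (g k + K) * Real.exp (-g k) := by gcongr
      _ = Real.exp K := by rw [← Real.exp_add]; ring_nf
  obtain ⟨C, hC⟩ := hb
  refine ⟨Real.log (max C 1), fun k => ?_⟩
  have h1 : f k * Real.exp (-g k) ≤ max C 1 := (hC ⟨k, rfl⟩).trans (le_max_left _ _)
  rw [Real.exp_add, Real.exp_log (by positivity)]
  calc f k = Real.exp (g k) * (f k * Real.exp (-g k)) := by
        rw [mul_comm, mul_assoc, ← Real.exp_add]; simp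
    _ ≤ _ := by gcongr

/-- The increments are dominated by a geometric series of ratio 1/2. -/
theorem exists_abs_sub_le_of_halving {v d : ℕ → ℝ} (h : ∀ k, |v (k + 1) - v k| ≤ d k)
    (hd : ∀ k, d (k + 1) ≤ d k / 2) : ∃ u, ∀ k, |v k - u| ≤ 2 * d k := by
  have geo : ∀ k n, d (k + n) ≤ d k / 2 ^ n := by
    intro k n
    induction n with
    | zero => simp
    | succ n ih =>
      rw [← add_assoc, pow_succ, ← div_div]
      linarith [hd (k + n)]
  have hdist : ∀ k n, dist (v (k + n)) (v (k + (n + 1))) ≤ 2 * d k / 2 / 2 ^ n := by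
    intro k n
    rw [dist_comm, Real.dist_eq, mul_div_cancel_left₀ _ two_ne_zero]
    exact (h (k + n)).trans (geo k n)
  have hcau : CauchySeq v := by
    refine cauchySeq_of_le_geometric_two (C := 2 * d 0) fun n => ?_
    simpa using hdist 0 n
  obtain ⟨u, hu⟩ := cauchySeq_tendsto_of_complete hcau
  refine ⟨u, fun k => ?_⟩
  have hk : Tendsto (fun n => v (k + n)) atTop (nhds u) := by
    simpa [add_comm] using (tendsto_add_atTop_iff_nat k).2 hu
  have := dist_le_of_le_geometric_two_of_tendsto₀ (hdist k) hk
  rwa [add_zero, Real.dist_eq] at this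

/-- The defect δ_k = a_{k+1} − γ a_k satisfies δ_{k+1} = O(K) − (γ − 1) δ_k. As γ − 1 < 3/4, any
bound B ≥ 4K for it propagates. -/
theorem exists_growth_of_additive {a : ℕ → ℝ} {K : ℝ}
    (h : ∀ k, |a (k + 2) - a (k + 1) - a k| ≤ K) :
    ∃ K', ∀ k, |a (k + 1) - Real.goldenRatio * a k| ≤ K' := by
  have hg := goldenRatio_bounds
  have hsq := Real.goldenRatio_sq
  have hK : 0 ≤ K := (abs_nonneg _).trans (h 0)
  set B := max |a 1 - Real.goldenRatio * a 0| (4 * K)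
  have hB : 4 * K ≤ B := le_max_right _ _
  refine ⟨B, fun k => ?_⟩
  induction k with
  | zero => exact le_max_left _ _
  | succ k ih =>
    have h1 := abs_le.1 (h k)
    have h2 := abs_le.1 ih
    have e : a (k + 1 + 1) - Real.goldenRatio * a (k + 1) = (a (k + 2) - a (k + 1) - a k)
        - (Real.goldenRatio - 1) * (a (k + 1) - Real.goldenRatio * a k) := by
      linear_combination -a k * hsq
    rw [e, abs_le]
    constructor <;> nlinarith

/-- With errors e₁, e₂ the determinant is x₁e₁ − x₀e₂. -/
theorem abs_det_symMat_le (ξ : ℝ) (x : Fin 3 → ℤ) :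
    |((symMat x).det : ℝ)| ≤ (1 + |ξ|) * (|(x 0 : ℝ)| + ‖errVec ξ x‖) * ‖errVec ξ x‖ := by
  have h1 := abs_errVec_fst_le ξ x
  have h2 := abs_errVec_snd_le ξ x
  have h3 := (abs_coord_bounds ξ x).1
  have e : ((symMat x).det : ℝ) = x 1 * (ξ * x 0 - x 1) - x 0 * (ξ * x 1 - x 2) := by
    rw [det_symMat]; push_cast; ring
  rw [e]
  refine (abs_sub _ _).trans ?_
  rw [abs_mul, abs_mul]
  have n0 := norm_nonneg (errVec ξ x)
  have n1 := abs_nonneg (x 0 : ℝ)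
  have n2 := abs_nonneg ξ
  calc |(x 1 : ℝ)| * |ξ * x 0 - x 1| + |(x 0 : ℝ)| * |ξ * x 1 - x 2|
      ≤ (|ξ| * |(x 0 : ℝ)| + ‖errVec ξ x‖) * ‖errVec ξ x‖ + |(x 0 : ℝ)| * ‖errVec ξ x‖ := by
        gcongr
    _ ≤ _ := by nlinarith [mul_nonneg n2 (mul_nonneg n0 n0)]

/-- A non-zero triple product excludes common linear relations. -/
theorem eq_zero_of_triple_ne {x y z : Fin 3 → ℤ} (h : triple x y z ≠ 0) {A B C : ℤ}
    (hx : C * x 0 + B * x 1 + A * x 2 = 0) (hy : C * y 0 + B * y 1 + A * y 2 = 0)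
    (hz : C * z 0 + B * z 1 + A * z 2 = 0) : A = 0 ∧ B = 0 ∧ C = 0 := by
  refine ⟨?_, ?_, ?_⟩ <;> refine (mul_eq_zero.1 (?_ : triple x y z * _ = 0)).resolve_left h <;>
    unfold triple
  · linear_combination (y 0 * z 1 - y 1 * z 0) * hx + (x 1 * z 0 - x 0 * z 1) * hy
      + (x 0 * y 1 - x 1 * y 0) * hz
  · linear_combination (y 2 * z 0 - y 0 * z 2) * hx + (x 0 * z 2 - x 2 * z 0) * hy
      + (x 2 * y 0 - x 0 * y 2) * hz
  · linear_combination (y 1 * z 2 - y 2 * z 1) * hx + (x 2 * z 1 - x 1 * z 2) * hy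
      + (x 1 * y 2 - x 2 * y 1) * hz

namespace ApproxSeq

variable {ξ : ℝ} {y : ℕ → Fin 3 → ℤ} {a : ℕ → ℝ} {K : ℝ}

/-- If ξ is a root, the integer C y₀ + B y₁ + A y₂ is a combination of the errors of y, so it
vanishes at all late terms, among which are three independent ones. -/
theorem not_quadratic (h : ApproxSeq ξ y a K) {A B C : ℤ}
    (hABC : (A : ℝ) * ξ ^ 2 + B * ξ + C = 0) : A = 0 ∧ B = 0 ∧ C = 0 := by
  set M := |(A : ℝ) * ξ + B| + |(A : ℝ)| with hM
  have hlim : Tendsto (fun k => M * Real.exp (-a k + K)) atTop (nhds (M * 0)) := by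
    refine Tendsto.const_mul _ (Real.tendsto_exp_atBot.comp ?_)
    exact tendsto_atBot_add_const_right _ _ (tendsto_neg_atTop_atBot.comp h.tendsto)
  rw [mul_zero] at hlim
  obtain ⟨k, hk⟩ := eventually_atTop.1 (hlim.eventually_lt_const one_pos)
  have key : ∀ n ≥ k, C * y n 0 + B * y n 1 + A * y n 2 = 0 := by
    intro n hn
    have h1 := (abs_errVec_fst_le ξ (y n)).trans (h.err_le n)
    have h2 := (abs_errVec_snd_le ξ (y n)).trans (h.err_le n)
    have e : (C : ℝ) * y n 0 + B * y n 1 + A * y n 2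
        = -((A * ξ + B) * (ξ * y n 0 - y n 1) + A * (ξ * y n 1 - y n 2)) := by
      linear_combination (y n 0 : ℝ) * hABC
    have : |(C : ℝ) * y n 0 + B * y n 1 + A * y n 2| < 1 := by
      refine lt_of_le_of_lt ?_ (hk n hn)
      rw [e, abs_neg]
      refine (abs_add_le _ _).trans ?_
      rw [abs_mul, abs_mul, hM, add_mul]
      gcongr
    exact Int.abs_lt_one_iff.1 (by exact_mod_cast this)
  exact eq_zero_of_triple_ne (h.triple_ne k) (key k le_rfl) (key _ (by omega)) (key _ (by omega))

/-- Choose k with log X between a k + K and a (k + 1) + K: then y_k has first coordinate at most X,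
and its error ≪ e^{-a_k} is ≪ X^{-1/γ} because a_{k+1} is about γ a_k. -/
theorem isExtremal (h : ApproxSeq ξ y a K) : IsExtremal ξ := by
  refine ⟨fun A B C hABC => h.not_quadratic hABC, ?_⟩
  have hK := h.nonneg
  have hg := goldenRatio_bounds
  have hgpos := Real.goldenRatio_pos
  have hξ : 1 ≤ 1 + |ξ| := by linarith [abs_nonneg ξ]
  set c := max ((1 + |ξ|) * Real.exp (3 * K)) (Real.exp (a 0 + K))
  have hc1 : (1 + |ξ|) * Real.exp (3 * K) ≤ c := le_max_left _ _
  have hc2 : Real.exp (a 0 + K) ≤ c := le_max_right _ _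
  refine ⟨c, (Real.exp_pos _).trans_le hc2, fun X hX => ?_⟩
  have hXpos : 0 < X := by linarith
  rw [Real.rpow_neg hXpos.le]
  have hpow : 0 < X ^ (1 / Real.goldenRatio) := Real.rpow_pos_of_pos hXpos _
  rcases le_or_gt (a 0 + K) (Real.log X) with hcase | hcase
  · obtain ⟨k, -, hk, hk'⟩ := h.exists_between hcase
    have herr : ‖errVec ξ (y k)‖ ≤ Real.exp (3 * K) * (X ^ (1 / Real.goldenRatio))⁻¹ := by
      refine (h.err_le k).trans ?_
      rw [Real.rpow_def_of_pos hXpos, ← Real.exp_neg, ← Real.exp_add]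
      apply Real.exp_le_exp.2
      have h1 := (abs_le.1 (h.growth k)).2
      have h2 : Real.log X * (1 / Real.goldenRatio) ≤ a k + 2 * K := by
        rw [mul_one_div, div_le_iff₀ hgpos]
        nlinarith
      linarith
    have hb1 := abs_errVec_fst_le ξ (y k)
    have hb2 := abs_errVec_snd_le ξ (y k)
    have hmain : (1 + |ξ|) * ‖errVec ξ (y k)‖ ≤ c * (X ^ (1 / Real.goldenRatio))⁻¹ := by
      calc _ ≤ (1 + |ξ|) * (Real.exp (3 * K) * (X ^ (1 / Real.goldenRatio))⁻¹) := by gcongr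
        _ = (1 + |ξ|) * Real.exp (3 * K) * (X ^ (1 / Real.goldenRatio))⁻¹ := by ring
        _ ≤ _ := by gcongr
    refine ⟨y k 0, y k 1, y k 2, ?_, ?_, ?_, ?_⟩
    · intro h0
      simp only [Prod.mk.injEq] at h0
      apply h.triple_ne k
      simp [triple, h0]
    · exact (h.abs_zero_le k).trans ((Real.le_log_iff_exp_le hXpos).1 hk)
    · rw [mul_comm]
      refine hb1.trans (le_trans ?_ hmain)
      exact le_mul_of_one_le_left (norm_nonneg _) hξ
    · refine le_trans ?_ hmain
      have e : (y k 0 : ℝ) * ξ ^ 2 - y k 2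
          = (ξ * y k 1 - y k 2) + ξ * (ξ * y k 0 - y k 1) := by ring
      rw [e, add_mul, one_mul]
      refine (abs_add_le _ _).trans ?_
      rw [abs_mul]
      gcongr
  -- X is bounded here, so a fixed point serves; the second term in the maximum c is there for this
  -- case.
  · refine ⟨0, 0, 1, by simp, by simpa using hXpos.le, ?_, ?_⟩
    · have := (Real.exp_pos (a 0 + K)).trans_le hc2
      simp only [Int.cast_zero, zero_mul, sub_zero, abs_zero]
      positivity
    · simp only [Int.cast_zero, zero_mul, zero_sub, Int.cast_one, abs_neg, abs_one]
      rw [← div_eq_mul_inv, le_div_iff₀ hpow, one_mul]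
      have h1 : X ^ (1 / Real.goldenRatio) ≤ X ^ (1 : ℝ) := by
        apply Real.rpow_le_rpow_of_exponent_le hX
        rw [div_le_one hgpos]; linarith
      rw [Real.rpow_one] at h1
      exact h1.trans (((Real.log_lt_iff_lt_exp hXpos).1 hcase).le.trans hc2)

end ApproxSeq

/-- The estimates for a Fibonacci sequence of matrices follow from those of its symmetric points. -/
theorem SymmetricPoints.satisfiesEstimates {W : ℕ → PrimMat} {N : IntMat2} {x : ℕ → Fin 3 → ℤ}
    {ξ : ℝ} {a : ℕ → ℝ} {K : ℝ} (h : SymmetricPoints W N x)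
    (hx : ApproxSeq ξ (fun k => x (k + 1)) a K) :
    IsUnboundedSeq W ∧ SatisfiesEstimates ξ W := by
  have hpos : ∀ i, 0 < ‖(W i).toReal‖ := fun i => one_pos.trans_le (W i).one_le_norm
  have hK := hx.nonneg
  have hNpos : 0 < ‖real N‖ := one_pos.trans_le (one_le_norm_real h.det_ne)
  have hξ : 0 < 1 + |ξ| := by positivity
  set A := Real.log (2 * ‖real N‖)
  have hAexp : Real.exp A = 2 * ‖real N‖ := Real.exp_log (by positivity)
  set B := Real.log (2 * (1 + |ξ|) ^ 2)
  have hBexp : Real.exp B = 2 * (1 + |ξ|) ^ 2 := Real.exp_log (by positivity)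
  have hBnn : 0 ≤ B := Real.log_nonneg (by nlinarith [abs_nonneg ξ])
  have hAnn : 0 ≤ A := Real.log_nonneg (by linarith [one_le_norm_real h.det_ne])
  have hsize : ∀ k, |(x (k + 1) 0 : ℝ)| + ‖errVec ξ (x (k + 1))‖ ≤ 2 * Real.exp (a k + K) := by
    intro k
    have := hx.a_nonneg k
    have h1 : Real.exp (-a k + K) ≤ Real.exp (a k + K) := Real.exp_le_exp.2 (by linarith)
    linarith [hx.abs_zero_le k, hx.err_le k]
  have hup : ∀ k, Real.log ‖(W (k + 1)).toReal‖ ≤ a k + (A + B + K) := by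
    intro k
    rw [Real.log_le_iff_le_exp (hpos _)]
    have h1 := (h.norm_le_symMat (i := k + 1) (by omega)).trans
      (mul_le_mul_of_nonneg_left (_root_.norm_symMat_le ξ (x (k + 1))) (by positivity))
    refine h1.trans ?_
    rw [show a k + (A + B + K) = A + (B + (a k + K)) by ring, Real.exp_add A, Real.exp_add B,
      hAexp, hBexp, mul_comm (2 : ℝ) ((1 + |ξ|) ^ 2), mul_assoc ((1 + |ξ|) ^ 2)]
    gcongr
    exact hsize k
  have hlow : ∀ k, a k - (A + B + K) ≤ Real.log ‖(W (k + 1)).toReal‖ := by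
    intro k
    rw [Real.le_log_iff_exp_le (hpos _)]
    have h1 := h.norm_symMat_le (i := k + 1) (by omega)
    have h2 := (abs_le_norm_symMat (x (k + 1))).1
    have h3 : ‖errVec ξ (x (k + 1))‖ ≤ (1 + |ξ|) * ‖real (symMat (x (k + 1)))‖ := by
      have h4 := (abs_le_norm_symMat (x (k + 1))).2
      apply norm_errVec_le
      · refine (abs_sub _ _).trans ?_
        rw [abs_mul, add_mul, one_mul, add_comm]
        gcongr
        exact h4.1
      · refine (abs_sub _ _).trans ?_
        rw [abs_mul, add_mul, one_mul, add_comm]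
        gcongr
        exacts [h4.2, h4.1]
    have h5 : Real.exp (a k - K) ≤ Real.exp B * ‖real (symMat (x (k + 1)))‖ := by
      refine (hx.le_size k).trans ((add_le_add h2 h3).trans ?_)
      rw [hBexp]
      have := norm_nonneg (real (symMat (x (k + 1))))
      have := abs_nonneg ξ
      nlinarith [mul_nonneg this (norm_nonneg (real (symMat (x (k + 1))))),
        mul_nonneg (mul_nonneg this this) (norm_nonneg (real (symMat (x (k + 1)))))]
    rw [show a k - (A + B + K) = (a k - K) - (B + A) by ring, Real.exp_sub,
      div_le_iff₀ (Real.exp_pos _), Real.exp_add, hAexp]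
    calc _ ≤ Real.exp B * ‖real (symMat (x (k + 1)))‖ := h5
      _ ≤ Real.exp B * (2 * ‖real N‖ * ‖(W (k + 1)).toReal‖) := by gcongr
      _ = _ := by ring
  have hg := goldenRatio_bounds
  refine ⟨fun b => ?_, ?_, ⟨?_, ?_⟩, ⟨?_, ?_⟩⟩
  · obtain ⟨k, hk⟩ := (hx.tendsto.eventually_gt_atTop (Real.log (max b 1) + (A + B + K))).exists
    refine ⟨k + 1, by omega, ?_⟩
    have h1 : Real.log (max b 1) < Real.log ‖(W (k + 1)).toReal‖ := by linarith [hlow k]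
    exact (le_max_left _ _).trans_lt ((Real.log_lt_log_iff (by positivity) (hpos _)).1 h1)
  · refine seqAsymp_of_abs_log_sub_le (K := 3 * (A + B + K) + K) (fun i _ => hpos _)
      (fun i _ => Real.rpow_pos_of_pos (hpos i) _) fun i hi => ?_
    obtain ⟨k, rfl⟩ := Nat.exists_eq_add_of_le' hi
    rw [Real.log_rpow (hpos _)]
    have e1 := hup k
    have e2 := hlow k
    have e3 := hup (k + 1)
    have e4 := hlow (k + 1)
    have e5 := abs_le.1 (hx.growth k)
    have e6 : Real.goldenRatio * (Real.log ‖(W (k + 1)).toReal‖ - a k) ≤ 2 * (A + B + K) := by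
      nlinarith
    have e7 : -(2 * (A + B + K)) ≤ Real.goldenRatio * (Real.log ‖(W (k + 1)).toReal‖ - a k) := by
      nlinarith
    rw [abs_le]
    constructor <;> linarith
  · refine ⟨Real.exp (A + K + (A + B + K)), Real.exp_pos _, fun i hi => ?_⟩
    obtain ⟨k, rfl⟩ := Nat.exists_eq_add_of_le' hi
    refine (h.norm_mul_le_symMat _ (by omega)).trans ?_
    rw [norm_row_mul_symMat, ← hAexp]
    have e1 : ‖(W (k + 1)).toReal‖⁻¹ = Real.exp (-Real.log ‖(W (k + 1)).toReal‖) := by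
      rw [Real.exp_neg, Real.exp_log (hpos _)]
    simp only [e1]
    rw [← Real.exp_add]
    refine (mul_le_mul_of_nonneg_left (hx.err_le k) (Real.exp_pos _).le).trans ?_
    rw [← Real.exp_add]
    apply Real.exp_le_exp.2
    linarith [hup k]
  -- The lower bound on the error costs nothing: a non-zero integer determinant is at least 1 and is
  -- bounded by twice the norm times the error.
  · refine ⟨2, two_pos, fun i hi => ?_⟩
    have h1 := Matrix.abs_det_le_two_mul ξ (W i).toReal
    have h2 : 1 ≤ |(W i).toReal.det| := by
      rw [PrimMat.toReal_eq, det_real]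
      exact_mod_cast Int.one_le_abs (W i).det_ne_zero
    change ‖(W i).toReal‖⁻¹ ≤ 2 * ‖!![ξ, -1] * (W i).toReal‖
    rw [inv_le_iff_one_le_mul₀ (hpos i)]
    linarith
  · refine ⟨(1 + |ξ|) * 2 * Real.exp (2 * K), by positivity, fun i hi => ?_⟩
    obtain ⟨k, rfl⟩ := Nat.exists_eq_add_of_le' hi
    have h1 := abs_det_symMat_le ξ (x (k + 1))
    rw [h.det_eq (by omega), Int.cast_mul, abs_mul] at h1
    have h2 : (1 : ℝ) ≤ |(N.det : ℝ)| := by exact_mod_cast Int.one_le_abs h.det_ne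
    simp only [PrimMat.toReal_eq, det_real, mul_one]
    calc _ ≤ |((W (k + 1)).toMat.det : ℝ)| * |(N.det : ℝ)| :=
          le_mul_of_one_le_right (abs_nonneg _) h2
      _ ≤ _ := h1
      _ ≤ (1 + |ξ|) * (2 * Real.exp (a k + K)) * Real.exp (-a k + K) := by
          gcongr
          exacts [hsize k, hx.err_le k]
      _ = (1 + |ξ|) * 2 * (Real.exp (a k + K) * Real.exp (-a k + K)) := by ring
      _ = _ := by rw [← Real.exp_add]; ring_nf
  · refine ⟨1, one_pos, fun i hi => ?_⟩
    simp only [PrimMat.toReal_eq, det_real, one_mul]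
    exact_mod_cast Int.one_le_abs (W i).det_ne_zero

/-! ### Construction of ξ from a Fibonacci sequence -/

/-- x₀² + 2x₁² + x₂² = (x₀ + x₂)² − 2 det, so a comparatively small determinant makes the trace
dominate. -/
theorem norm_symMat_le_two_mul_trace {x : Fin 3 → ℤ}
    (h : 4 * |((symMat x).det : ℝ)| ≤ ‖real (symMat x)‖ ^ 2) :
    ‖real (symMat x)‖ ≤ 2 * |(x 0 : ℝ) + x 2| := by
  have hd : ((symMat x).det : ℝ) = x 0 * x 2 - x 1 * x 1 := by rw [det_symMat]; push_cast; ring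
  have hd1 := neg_abs_le ((symMat x).det : ℝ)
  have hd2 := le_abs_self ((symMat x).det : ℝ)
  set D := |((symMat x).det : ℝ)|
  rw [hd] at hd1 hd2
  set t := (x 0 : ℝ) + x 2
  have hb : ‖real (symMat x)‖ ≤ √(t ^ 2 + 2 * D) := by
    apply norm_symMat_le_of <;> apply Real.abs_le_sqrt <;>
      nlinarith [sq_nonneg ((x 0 : ℝ) - x 2), sq_nonneg (x 1 : ℝ), sq_nonneg t]
  have hD : 0 ≤ t ^ 2 + 2 * D := by positivity
  have hsq : ‖real (symMat x)‖ ^ 2 ≤ t ^ 2 + 2 * D := by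
    rw [← Real.sq_sqrt hD]
    gcongr
  have h2 : ‖real (symMat x)‖ ^ 2 ≤ (2 * |t|) ^ 2 := by
    rw [mul_pow, sq_abs]
    nlinarith [sq_nonneg t]
  exact (abs_le_of_sq_le_sq' h2 (by positivity)).2

/-- Symmetric matrices of bounded determinant, of rapidly growing norm and such that consecutive
ones are nearly proportional define a real number which they approximate. -/
theorem exists_errVec_le {y : ℕ → Fin 3 → ℤ} {a : ℕ → ℝ} {K : ℝ} (hlim : Tendsto a atTop atTop)
    (hgrow : ∀ k, |a (k + 1) - Real.goldenRatio * a k| ≤ K)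
    (hadd : ∀ k, |a (k + 2) - a (k + 1) - a k| ≤ K)
    (hup : ∀ k, ‖real (symMat (y k))‖ ≤ Real.exp (a k + K))
    (hlow : ∀ k, Real.exp (a k - K) ≤ ‖real (symMat (y k))‖)
    (hdet : ∀ k, |((symMat (y k)).det : ℝ)| ≤ Real.exp K) (hdet0 : ∀ k, (symMat (y k)).det ≠ 0)
    (hminor : ∀ k, ∀ i j, |(y (k + 1) i * y (k + 2) j - y (k + 1) j * y (k + 2) i : ℝ)|
      ≤ Real.exp (a k + K)) :
    ∃ ξ K', ∀ k, ‖errVec ξ (y k)‖ ≤ Real.exp (-a k + K') := by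
  have hK : 0 ≤ K := (abs_nonneg _).trans (hgrow 0)
  obtain ⟨k₀, hk₀⟩ := eventually_atTop.1 (hlim.eventually_ge_atTop (4 * K + 4))
  -- The points are normalised by their trace, which is comparable to the norm; the same is not yet
  -- known of y₀.
  set t : ℕ → ℝ := fun k => (y k 0 : ℝ) + y k 2 with ht
  have hexp4 : (4 : ℝ) ≤ Real.exp 4 := by linarith [Real.add_one_le_exp (4 : ℝ)]
  have hexp2 : (2 : ℝ) ≤ Real.exp 2 := by linarith [Real.add_one_le_exp (2 : ℝ)]
  have htlow : ∀ k ≥ k₀, Real.exp (a k - K) ≤ 2 * |t k| := by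
    intro k hk
    refine (hlow k).trans (norm_symMat_le_two_mul_trace ?_)
    calc 4 * |((symMat (y k)).det : ℝ)| ≤ Real.exp 4 * Real.exp K := by
          gcongr
          exact hdet k
      _ = Real.exp (4 + K) := (Real.exp_add _ _).symm
      _ ≤ Real.exp ((a k - K) + (a k - K)) := Real.exp_le_exp.2 (by linarith [hk₀ k hk])
      _ = Real.exp (a k - K) ^ 2 := by rw [Real.exp_add, sq]
      _ ≤ _ := by gcongr; exact hlow k
  have htpos : ∀ k ≥ k₀, 0 < |t k| := fun k hk => by
    linarith [htlow k hk, Real.exp_pos (a k - K)]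
  have htne : ∀ k ≥ k₀, t k ≠ 0 := fun k hk => abs_pos.1 (htpos k hk)
  -- Shifted by one because the minor bound at m concerns the terms m + 1 and m + 2.
  set k₁ := k₀ + 1
  -- A minor of size e^{a_m} divided by two traces of sizes e^{a_{m+1}} and e^{a_{m+2}} is of order
  -- e^{-2a_{m+1}}, since a_{m+2} is about a_{m+1} + a_m. The 8 is 2 for the two minors times 2 · 2
  -- for the two trace bounds.
  set d : ℕ → ℝ := fun k => 8 * Real.exp (-2 * a (k + k₁) + 5 * K) with hd
  have hstep : ∀ j k, |(y (k + 1 + k₁) j : ℝ) / t (k + 1 + k₁) - y (k + k₁) j / t (k + k₁)|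
      ≤ d k := by
    intro j k
    have hkk : k + k₁ = k + k₀ + 1 := by omega
    have hkk' : k + 1 + k₁ = k + k₀ + 2 := by omega
    rw [hkk']
    simp only [hd, hkk]
    set m := k + k₀
    have h1 := htlow (m + 1) (by omega)
    have h2 := htlow (m + 2) (by omega)
    have p1 := htpos (m + 1) (by omega)
    have p2 := htpos (m + 2) (by omega)
    rw [div_sub_div _ _ (htne _ (by omega)) (htne _ (by omega)), abs_div, abs_mul,
      div_le_iff₀ (mul_pos p2 p1)]
    have e : (y (m + 2) j : ℝ) * t (m + 1) - t (m + 2) * y (m + 1) j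
        = (y (m + 1) 0 * y (m + 2) j - y (m + 1) j * y (m + 2) 0)
          + (y (m + 1) 2 * y (m + 2) j - y (m + 1) j * y (m + 2) 2) := by
      simp only [ht]; ring
    have h3 : |(y (m + 2) j : ℝ) * t (m + 1) - t (m + 2) * y (m + 1) j|
        ≤ 2 * Real.exp (a m + K) := by
      rw [e]
      refine (abs_add_le _ _).trans ?_
      linarith [hminor m 0 j, hminor m 2 j]
    refine h3.trans ?_
    have h4 : Real.exp (a m + K) ≤ Real.exp (-2 * a (m + 1) + 5 * K)
        * (Real.exp (a (m + 2) - K) * Real.exp (a (m + 1) - K)) := by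
      rw [← Real.exp_add, ← Real.exp_add]
      apply Real.exp_le_exp.2
      linarith [(abs_le.1 (hadd m)).1]
    have h5 : Real.exp (a (m + 2) - K) * Real.exp (a (m + 1) - K)
        ≤ (2 * |t (m + 2)|) * (2 * |t (m + 1)|) := by gcongr
    calc 2 * Real.exp (a m + K) ≤ 2 * (Real.exp (-2 * a (m + 1) + 5 * K)
          * ((2 * |t (m + 2)|) * (2 * |t (m + 1)|))) := by
          gcongr
          exact h4.trans (by gcongr)
      _ = _ := by ring
  have hhalf : ∀ k, d (k + 1) ≤ d k / 2 := by
    intro k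
    simp only [hd, show k + 1 + k₁ = k + k₁ + 1 by ring]
    have h1 := hk₀ (k + k₁) (by omega)
    have h2 := (abs_le.1 (hgrow (k + k₁))).1
    have hg := goldenRatio_bounds
    have h3 : a (k + k₁) + 1 ≤ a (k + k₁ + 1) := by nlinarith
    have h4 : Real.exp (-2 * a (k + k₁ + 1) + 5 * K)
        ≤ Real.exp (-2 * a (k + k₁) + 5 * K) / 2 := by
      rw [le_div_iff₀ two_pos]
      calc _ ≤ Real.exp (-2 * a (k + k₁ + 1) + 5 * K) * Real.exp 2 := by gcongr
        _ = Real.exp (-2 * a (k + k₁ + 1) + 5 * K + 2) := (Real.exp_add _ _).symm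
        _ ≤ _ := Real.exp_le_exp.2 (by linarith)
    linarith
  have hdlim : Tendsto d atTop (nhds 0) := by
    have h1 : Tendsto (fun k => -2 * a (k + k₁) + 5 * K) atTop atBot := by
      refine tendsto_atBot_add_const_right _ _ ?_
      exact ((tendsto_add_atTop_iff_nat k₁).2 hlim).const_mul_atTop_of_neg (by norm_num)
    have h2 := (Real.tendsto_exp_atBot.comp h1).const_mul 8
    rwa [mul_zero] at h2
  have hu : ∀ j, ∃ u : ℝ, ∀ k, |(y (k + k₁) j : ℝ) / t (k + k₁) - u| ≤ 2 * d k := fun j =>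
    exists_abs_sub_le_of_halving (hstep j) hhalf
  choose u hu using hu
  have hulim : ∀ j, Tendsto (fun k => (y (k + k₁) j : ℝ) / t (k + k₁)) atTop (nhds (u j)) := by
    intro j
    rw [tendsto_iff_dist_tendsto_zero]
    refine squeeze_zero (fun _ => dist_nonneg) (fun k => ?_)
      (by simpa using hdlim.const_mul 2 : Tendsto (fun k => 2 * d k) atTop (nhds 0))
    exact hu j k
  have hsum : u 0 + u 2 = 1 := by
    refine tendsto_nhds_unique ((hulim 0).add (hulim 2)) ?_
    refine tendsto_const_nhds.congr fun k => ?_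
    rw [← add_div, div_self (htne _ (by omega))]
  -- The determinants are bounded while the squared traces tend to infinity.
  have hprod : u 0 * u 2 - u 1 * u 1 = 0 := by
    refine tendsto_nhds_unique (((hulim 0).mul (hulim 2)).sub ((hulim 1).mul (hulim 1))) ?_
    refine squeeze_zero_norm (fun k => ?_) hdlim
    have hne := htne (k + k₁) (by omega)
    have h1 := htlow (k + k₁) (by omega)
    have h2 := hdet (k + k₁)
    have e : (y (k + k₁) 0 : ℝ) / t (k + k₁) * (y (k + k₁) 2 / t (k + k₁))
        - y (k + k₁) 1 / t (k + k₁) * (y (k + k₁) 1 / t (k + k₁))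
        = ((symMat (y (k + k₁))).det : ℝ) / (t (k + k₁) * t (k + k₁)) := by
      rw [det_symMat]
      push_cast
      field_simp
    have hp := htpos (k + k₁) (by omega)
    rw [e, Real.norm_eq_abs, abs_div, abs_mul, div_le_iff₀ (mul_pos hp hp)]
    refine h2.trans ?_
    have h3 : Real.exp (a (k + k₁) - K) * Real.exp (a (k + k₁) - K)
        ≤ (2 * |t (k + k₁)|) * (2 * |t (k + k₁)|) := by gcongr
    have h4 : Real.exp K ≤ Real.exp (-2 * a (k + k₁) + 5 * K)
        * (Real.exp (a (k + k₁) - K) * Real.exp (a (k + k₁) - K)) := by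
      rw [← Real.exp_add, ← Real.exp_add]
      exact Real.exp_le_exp.2 (by linarith)
    have h5 := h4.trans (mul_le_mul_of_nonneg_left h3 (Real.exp_pos _).le)
    simp only [hd]
    have := mul_pos (Real.exp_pos (-2 * a (k + k₁) + 5 * K)) (mul_pos hp hp)
    linarith
  set C := Real.log 64 + 6 * K with hC
  have hy : ∀ j, ∀ k ≥ k₁, |(y k j : ℝ) - t k * u j| ≤ Real.exp (-a k + C) := by
    intro j k hk
    obtain ⟨n, rfl⟩ := Nat.exists_eq_add_of_le' hk
    have hne := htne (n + k₁) (by omega)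
    have h1 : |t (n + k₁)| ≤ 2 * Real.exp (a (n + k₁) + K) := by
      obtain ⟨h0, -, h2⟩ := abs_le_norm_symMat (y (n + k₁))
      refine (abs_add_le _ _).trans ?_
      linarith [hup (n + k₁)]
    have e : (y (n + k₁) j : ℝ) - t (n + k₁) * u j
        = t (n + k₁) * (y (n + k₁) j / t (n + k₁) - u j) := by field_simp
    rw [e, abs_mul]
    calc |t (n + k₁)| * |(y (n + k₁) j : ℝ) / t (n + k₁) - u j|
        ≤ 2 * Real.exp (a (n + k₁) + K) * (2 * d n) := by gcongr; exact hu j n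
      _ = 32 * (Real.exp (a (n + k₁) + K) * Real.exp (-2 * a (n + k₁) + 5 * K)) := by
          simp only [hd]; ring
      _ ≤ 64 * (Real.exp (a (n + k₁) + K) * Real.exp (-2 * a (n + k₁) + 5 * K)) := by
          gcongr; norm_num
      _ = _ := by
          rw [← Real.exp_add, hC, show -a (n + k₁) + (Real.log 64 + 6 * K)
            = Real.log 64 + (a (n + k₁) + K + (-2 * a (n + k₁) + 5 * K)) by ring,
            Real.exp_add (Real.log 64), Real.exp_log (by norm_num)]
  -- Otherwise u₁ = 0 as well, and the integers y₀, y₁ tend to 0, hence eventually vanish together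
  -- with the determinant.
  have hu0 : u 0 ≠ 0 := by
    intro h0
    have h1 : u 1 = 0 := by
      rw [h0, zero_mul, zero_sub, neg_eq_zero] at hprod
      exact mul_self_eq_zero.1 hprod
    obtain ⟨k, hk⟩ := eventually_atTop.1 ((hlim.eventually_gt_atTop C).and
      (eventually_ge_atTop k₁))
    obtain ⟨hk2, hk3⟩ := hk k le_rfl
    have small : ∀ j, u j = 0 → y k j = 0 := by
      intro j hj
      have h2 := hy j k hk3
      rw [hj, mul_zero, sub_zero] at h2
      have h3 : |(y k j : ℝ)| < 1 := h2.trans_lt (Real.exp_lt_one_iff.2 (by linarith))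
      exact Int.abs_lt_one_iff.1 (by exact_mod_cast h3)
    apply hdet0 k
    rw [det_symMat, small 0 h0, small 1 h1]
    simp
  -- On the conic, u is proportional to (1, ξ, ξ²) for this ξ.
  refine ⟨u 1 / u 0, exists_forall_le_exp_add (K := C + Real.log (1 + |u 1 / u 0|)) ?_⟩
  filter_upwards [eventually_ge_atTop k₁] with k hk
  have key : ∀ i j, u 1 / u 0 * u i = u j → |u 1 / u 0 * y k i - y k j|
      ≤ Real.exp (-a k + (C + Real.log (1 + |u 1 / u 0|))) := by
    intro i j hij
    have e : u 1 / u 0 * y k i - y k j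
        = u 1 / u 0 * (y k i - t k * u i) - (y k j - t k * u j) := by
      rw [← hij]; ring
    rw [← add_assoc, Real.exp_add _ (Real.log _), Real.exp_log (by positivity), e]
    refine (abs_sub _ _).trans ?_
    rw [abs_mul]
    have := mul_le_mul_of_nonneg_left (hy i k hk) (abs_nonneg (u 1 / u 0))
    linarith [hy j k hk]
  apply norm_errVec_le
  · exact key 0 1 (by field_simp)
  · refine key 1 2 ?_
    rw [div_mul_eq_mul_div, div_eq_iff hu0]
    linarith

namespace IntMat2

/-- The standard skew-symmetric matrix. -/
def skew : IntMat2 := !![0, 1; -1, 0]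

theorem transpose_mul_skew_mul (A : IntMat2) : Aᵀ * (skew * A) = A.det • skew := by
  ext i j
  fin_cases i <;> fin_cases j <;>
    simp [skew, Matrix.mul_apply, Matrix.vecMul, dotProduct, Matrix.det_fin_two] <;> ring

theorem norm_real_skew_le : ‖real skew‖ ≤ 1 := by
  rw [Matrix.norm_le_iff zero_le_one]
  intro i j
  fin_cases i <;> fin_cases j <;> simp [real_apply, skew]

theorem norm_real_smul_le (k : ℤ) (A : IntMat2) : ‖real (k • A)‖ ≤ |(k : ℝ)| * ‖real A‖ := by
  rw [Matrix.norm_le_iff (by positivity)]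
  intro i j
  rw [real_smul, Matrix.smul_apply, norm_smul, Real.norm_eq_abs]
  gcongr
  exact Matrix.norm_entry_le_entrywise_sup_norm _

theorem norm_real_le_smul (A : IntMat2) {k : ℤ} (hk : k ≠ 0) : ‖real A‖ ≤ ‖real (k • A)‖ := by
  have h := norm_mul_real_le_smul (1 : Matrix (Fin 2) (Fin 2) ℝ) A hk
  rwa [Matrix.one_mul, Matrix.one_mul] at h

end IntMat2

theorem PrimMat.norm_mul_le (A B : PrimMat) :
    ‖(A * B).toReal‖ ≤ 2 * ‖B.toReal‖ * ‖A.toReal‖ := by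
  have hc := content_ne_zero (det_mul_ne_zero A.det_ne_zero B.det_ne_zero)
  refine (norm_real_le_smul _ hc).trans ?_
  rw [PrimMat.content_smul_toMat_mul]
  exact norm_real_mul_le _ _

/-- The diagonal entries of x J y are minors and its off-diagonal entries add up to the third one,
hence the factor 2. -/
theorem abs_minor_le (x y : Fin 3 → ℤ) (i j : Fin 3) :
    |(x i * y j - x j * y i : ℝ)| ≤ 2 * ‖real (symMat x * (skew * symMat y))‖ := by
  set Z := real (symMat x * (skew * symMat y)) with hZ
  have n00 := abs_le.1 (Matrix.norm_entry_le_entrywise_sup_norm Z (i := 0) (j := 0))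
  have n01 := abs_le.1 (Matrix.norm_entry_le_entrywise_sup_norm Z (i := 0) (j := 1))
  have n10 := abs_le.1 (Matrix.norm_entry_le_entrywise_sup_norm Z (i := 1) (j := 0))
  have n11 := abs_le.1 (Matrix.norm_entry_le_entrywise_sup_norm Z (i := 1) (j := 1))
  have e00 : Z 0 0 = x 0 * y 1 - x 1 * y 0 := by
    simp [hZ, real_apply, symMat, skew]; ring
  have e01 : Z 0 1 = x 0 * y 2 - x 1 * y 1 := by
    simp [hZ, real_apply, symMat, skew]; ring
  have e10 : Z 1 0 = x 1 * y 1 - x 2 * y 0 := by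
    simp [hZ, real_apply, symMat, skew]; ring
  have e11 : Z 1 1 = x 1 * y 2 - x 2 * y 1 := by
    simp [hZ, real_apply, symMat, skew]; ring
  have hn := norm_nonneg Z
  rw [e00] at n00
  rw [e01] at n01
  rw [e10] at n10
  rw [e11] at n11
  rw [abs_le]
  fin_cases i <;> fin_cases j <;> dsimp only [Fin.zero_eta, Fin.mk_one, Fin.reduceFinMk] <;>
    constructor <;> linarith

namespace SymmetricPoints

variable {W : ℕ → PrimMat} {N : IntMat2} {x : ℕ → Fin 3 → ℤ}

/-- Write x_{i+1} as its own transpose and x_{i+2} through W_{i+1} W_i: the factor ᵗW_{i+1} J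
W_{i+1} collapses to det(W_{i+1}) J, and only W_i contributes an unbounded norm. -/
theorem norm_symMat_mul_skew_le (h : SymmetricPoints W N x) (hF : IsFibonacciSeq W) {i : ℕ}
    (hi : 1 ≤ i) :
    ‖real (symMat (x (i + 1)) * (skew * symMat (x (i + 2))))‖
      ≤ 8 * ‖real N‖ ^ 2 * |((W (i + 1)).toMat.det : ℝ)| * ‖(W i).toReal‖ := by
  have hc := content_ne_zero (det_mul_ne_zero (W (i + 1)).det_ne_zero (W i).det_ne_zero)
  have hmul := PrimMat.content_smul_toMat_mul (W (i + 1)) (W i)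
  rw [← hF i hi] at hmul
  set c := content ((W (i + 1)).toMat * (W i).toMat)
  have e : c • (symMat (x (i + 1)) * (skew * symMat (x (i + 2))))
      = (W (i + 1)).toMat.det • ((alternate N (i + 1))ᵀ *
        (skew * ((W i).toMat * alternate N (i + 2)))) := by
    rw [← symMat_transpose (x (i + 1)), h.eq (i + 1) (by omega), h.eq (i + 2) (by omega),
      Matrix.transpose_mul]
    calc _ = (alternate N (i + 1))ᵀ * ((W (i + 1)).toMatᵀ *
          (skew * ((c • (W (i + 2)).toMat) * alternate N (i + 2)))) := by
          simp only [Matrix.mul_assoc, Matrix.mul_smul, Matrix.smul_mul]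
      _ = (alternate N (i + 1))ᵀ * (((W (i + 1)).toMatᵀ * (skew * (W (i + 1)).toMat)) *
          ((W i).toMat * alternate N (i + 2))) := by
          rw [hmul]
          simp only [Matrix.mul_assoc]
      _ = _ := by
          rw [transpose_mul_skew_mul]
          simp only [Matrix.mul_smul, Matrix.smul_mul]
  refine (norm_real_le_smul _ hc).trans ?_
  rw [e]
  refine (norm_real_smul_le _ _).trans ?_
  have b1 := norm_real_mul_le (alternate N (i + 1))ᵀ (skew * ((W i).toMat * alternate N (i + 2)))
  have b2 := norm_real_mul_le skew ((W i).toMat * alternate N (i + 2))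
  have b3 := norm_real_mul_le (W i).toMat (alternate N (i + 2))
  rw [real_transpose, Matrix.norm_transpose, norm_alternate] at b1
  rw [norm_alternate] at b3
  have b4 : 2 * ‖real ((W i).toMat * alternate N (i + 2))‖ * ‖real skew‖
      ≤ 2 * (2 * ‖real N‖ * ‖(W i).toReal‖) * 1 := by
    gcongr
    · exact b3
    · exact norm_real_skew_le
  have b5 := b2.trans b4
  calc _ ≤ |((W (i + 1)).toMat.det : ℝ)| *
        (2 * (2 * (2 * ‖real N‖ * ‖(W i).toReal‖) * 1) * ‖real N‖) := by
        gcongr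
        exact b1.trans (by gcongr)
    _ = _ := by ring

/-- An unbounded admissible Fibonacci sequence of rapid growth and bounded determinant comes from
an extremal number. -/
theorem exists_extremal (h : SymmetricPoints W N x) (hF : IsFibonacciSeq W)
    (hU : IsUnboundedSeq W)
    (hG : SeqLL (fun i => ‖(W (i + 1)).toReal‖ * ‖(W i).toReal‖) (fun i => ‖(W (i + 2)).toReal‖))
    (hD : SeqLL (fun i => |(W i).toReal.det|) (fun _ => 1)) :
    ∃ ξ : ℝ, IsExtremal ξ ∧ SatisfiesEstimates ξ W := by
  have hpos : ∀ i, 0 < ‖(W i).toReal‖ := fun i => one_pos.trans_le (W i).one_le_norm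
  have hN1 := one_le_norm_real h.det_ne
  have hNpos : 0 < ‖real N‖ := one_pos.trans_le hN1
  obtain ⟨c, hc, hG⟩ := hG
  obtain ⟨D, hDpos, hD⟩ := hD
  simp only [mul_one, PrimMat.toReal_eq, det_real] at hD
  set a : ℕ → ℝ := fun k => Real.log ‖(W (k + 1)).toReal‖ with ha
  have hexp : ∀ k, Real.exp (a k) = ‖(W (k + 1)).toReal‖ := fun k => Real.exp_log (hpos _)
  -- The lower bound is the growth hypothesis; the upper one holds because reduction can only
  -- decrease the norm of a product.
  have hadd : ∀ k, |a (k + 2) - a (k + 1) - a k| ≤ max (Real.log c) (Real.log 2) := by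
    intro k
    have h1 := Real.log_le_log (mul_pos (hpos _) (hpos _)) (hG (k + 1) (by omega))
    rw [Real.log_mul (hpos _).ne' (hpos _).ne', Real.log_mul hc.ne' (hpos _).ne'] at h1
    have h2 := PrimMat.norm_mul_le (W (k + 1 + 1)) (W (k + 1))
    rw [← hF (k + 1) (by omega)] at h2
    have h3 := Real.log_le_log (hpos _) h2
    rw [Real.log_mul (by positivity [hpos (k + 1)]) (hpos _).ne',
      Real.log_mul two_ne_zero (hpos _).ne'] at h3
    have h4 : a (k + 2) = Real.log ‖(W (k + 1 + 2)).toReal‖ := rfl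
    have h5 : a (k + 1) = Real.log ‖(W (k + 1 + 1)).toReal‖ := rfl
    have h6 : a k = Real.log ‖(W (k + 1)).toReal‖ := rfl
    rw [abs_le, h4, h5, h6]
    constructor
    · linarith [le_max_left (Real.log c) (Real.log 2)]
    · linarith [le_max_right (Real.log c) (Real.log 2)]
  obtain ⟨K₀, hK₀⟩ := exists_growth_of_additive hadd
  have hlim : Tendsto a atTop atTop := by
    refine tendsto_atTop_of_growth ((abs_nonneg _).trans (hK₀ 0)) hK₀ fun B => ?_
    obtain ⟨i, hi, hB⟩ := hU (Real.exp B)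
    refine ⟨i - 1, ?_⟩
    simp only [ha]
    rw [Nat.sub_add_cancel hi]
    exact (Real.lt_log_iff_exp_lt (hpos i)).2 hB
  set M := max (max (16 * ‖real N‖ ^ 2 * D) (2 * ‖real N‖)) (D * |(N.det : ℝ)|)
  have hM1 : 16 * ‖real N‖ ^ 2 * D ≤ M := (le_max_left _ _).trans (le_max_left _ _)
  have hM2 : 2 * ‖real N‖ ≤ M := (le_max_right _ _).trans (le_max_left _ _)
  have hM3 : D * |(N.det : ℝ)| ≤ M := le_max_right _ _
  have hMpos : 0 < M := by linarith
  set K := max (max (max (Real.log c) (Real.log 2)) K₀) (Real.log M)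
  have hKM : M ≤ Real.exp K := by
    rw [← Real.log_le_iff_le_exp hMpos]
    exact le_max_right _ _
  have hadd' : ∀ k, |a (k + 2) - a (k + 1) - a k| ≤ K := fun k =>
    (hadd k).trans ((le_max_left _ _).trans (le_max_left _ _))
  have hgrow : ∀ k, |a (k + 1) - Real.goldenRatio * a k| ≤ K := fun k =>
    (hK₀ k).trans ((le_max_right _ _).trans (le_max_left _ _))
  have hup : ∀ k, ‖real (symMat (x (k + 1)))‖ ≤ Real.exp (a k + K) := by
    intro k
    rw [Real.exp_add, hexp, mul_comm]
    exact (h.norm_symMat_le (by omega)).trans (by gcongr; exact hM2.trans hKM)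
  have hlow : ∀ k, Real.exp (a k - K) ≤ ‖real (symMat (x (k + 1)))‖ := by
    intro k
    rw [Real.exp_sub, hexp, div_le_iff₀ (Real.exp_pos _), mul_comm]
    exact (h.norm_le_symMat (by omega)).trans (by gcongr; exact hM2.trans hKM)
  have hdet : ∀ k, |((symMat (x (k + 1))).det : ℝ)| ≤ Real.exp K := by
    intro k
    rw [h.det_eq (by omega), Int.cast_mul, abs_mul]
    exact (mul_le_mul_of_nonneg_right (hD _ (by omega)) (abs_nonneg _)).trans (hM3.trans hKM)
  obtain ⟨ξ, K', hξ⟩ := exists_errVec_le hlim hgrow hadd' hup hlow hdet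
    (fun k => h.det_symMat_ne (by omega)) (fun k i j => by
      refine (abs_minor_le _ _ i j).trans ?_
      rw [Real.exp_add, hexp, mul_comm (‖_‖)]
      have h1 := h.norm_symMat_mul_skew_le hF (i := k + 1) (by omega)
      have h2 := hD (k + 1 + 1) (by omega)
      calc _ ≤ 2 * (8 * ‖real N‖ ^ 2 * |((W (k + 1 + 1)).toMat.det : ℝ)|
            * ‖(W (k + 1)).toReal‖) := by gcongr
        _ ≤ 2 * (8 * ‖real N‖ ^ 2 * D * ‖(W (k + 1)).toReal‖) := by gcongr
        _ = 16 * ‖real N‖ ^ 2 * D * ‖(W (k + 1)).toReal‖ := by ring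
        _ ≤ _ := by gcongr; exact hM1.trans hKM)
  set L := max (max K K') (K + Real.log ((1 + |ξ|) ^ 2))
  have hL1 : K ≤ L := (le_max_left _ _).trans (le_max_left _ _)
  have hL2 : K' ≤ L := (le_max_right _ _).trans (le_max_left _ _)
  have hL3 : K + Real.log ((1 + |ξ|) ^ 2) ≤ L := le_max_right _ _
  have hA : ApproxSeq ξ (fun k => x (k + 1)) a L :=
    { growth := fun k => (hgrow k).trans hL1
      tendsto := hlim
      a_nonneg := fun k => Real.log_nonneg (W (k + 1)).one_le_norm
      abs_zero_le := fun k => (abs_le_norm_symMat _).1.trans ((hup k).trans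
        (Real.exp_le_exp.2 (by linarith)))
      err_le := fun k => (hξ k).trans (Real.exp_le_exp.2 (by linarith))
      le_size := fun k => by
        have h1 := (hlow k).trans (_root_.norm_symMat_le ξ (x (k + 1)))
        have h2 : Real.exp (a k - L) ≤ Real.exp ((a k - K) - Real.log ((1 + |ξ|) ^ 2)) :=
          Real.exp_le_exp.2 (by linarith)
        refine h2.trans ?_
        rw [Real.exp_sub, Real.exp_log (by positivity), div_le_iff₀ (by positivity), mul_comm]
        exact h1
      triple_ne := fun k => h.triple_ne hF (by omega) }
  exact ⟨ξ, hA.isExtremal, (h.satisfiesEstimates hA).2⟩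

end SymmetricPoints

/-! ### From good approximations to a Fibonacci sequence -/

/-- The point whose symmetric matrix is `x adj(y) x`. -/
def bracket (x y : Fin 3 → ℤ) : Fin 3 → ℤ :=
  ![x 0 ^ 2 * y 2 - 2 * x 0 * x 1 * y 1 + x 1 ^ 2 * y 0,
    x 0 * x 1 * y 2 - x 0 * x 2 * y 1 - x 1 ^ 2 * y 1 + x 1 * x 2 * y 0,
    x 1 ^ 2 * y 2 - 2 * x 1 * x 2 * y 1 + x 2 ^ 2 * y 0]

theorem symMat_bracket (x y : Fin 3 → ℤ) :
    symMat (bracket x y) = symMat x * ((symMat y).adjugate * symMat x) := by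
  ext i j
  fin_cases i <;> fin_cases j <;>
    simp [symMat, bracket, Matrix.adjugate_fin_two, Matrix.mul_apply]
    <;> ring

/-- Written through the errors, all error-free terms cancel, so the bracket is much smaller than its
cubic shape suggests. -/
theorem abs_bracket_zero_le (ξ : ℝ) (x y : Fin 3 → ℤ) :
    |(bracket x y 0 : ℝ)| ≤ (1 + |ξ|) * (|(x 0 : ℝ)| ^ 2 * ‖errVec ξ y‖)
      + 2 * (|(x 0 : ℝ)| * ‖errVec ξ x‖ * ‖errVec ξ y‖) + |(y 0 : ℝ)| * ‖errVec ξ x‖ ^ 2 := by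
  have h1 := abs_errVec_fst_le ξ x
  have k1 := abs_errVec_fst_le ξ y
  have k2 := abs_errVec_snd_le ξ y
  have e : (bracket x y 0 : ℝ) = (x 0 : ℝ) ^ 2 * (ξ * (ξ * y 0 - y 1) - (ξ * y 1 - y 2))
      - 2 * (x 0 * (ξ * x 0 - x 1) * (ξ * y 0 - y 1)) + y 0 * (ξ * x 0 - x 1) ^ 2 := by
    simp [bracket]; ring
  rw [e]
  refine (abs_add_le _ _).trans (add_le_add ((abs_sub _ _).trans (add_le_add ?_ ?_)) ?_)
  · rw [abs_mul, abs_pow]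
    have : |ξ * (ξ * y 0 - y 1) - (ξ * y 1 - y 2)| ≤ |ξ| * ‖errVec ξ y‖ + ‖errVec ξ y‖ := by
      refine (abs_sub _ _).trans ?_
      rw [abs_mul]
      gcongr
    calc _ ≤ |(x 0 : ℝ)| ^ 2 * (|ξ| * ‖errVec ξ y‖ + ‖errVec ξ y‖) := by gcongr
      _ = _ := by ring
  · rw [abs_mul, abs_mul, abs_mul, abs_two]
    gcongr
  · rw [abs_mul, abs_pow]
    gcongr

/-- Here a second cancellation leaves only terms with at least two error factors. -/
theorem norm_errVec_bracket_le (ξ : ℝ) (x y : Fin 3 → ℤ) :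
    ‖errVec ξ (bracket x y)‖ ≤ 3 * (1 + |ξ|) * (‖errVec ξ x‖ * (|(y 0 : ℝ)| * ‖errVec ξ x‖
      + |(x 0 : ℝ)| * ‖errVec ξ y‖ + ‖errVec ξ x‖ * ‖errVec ξ y‖)) := by
  have h1 := abs_errVec_fst_le ξ x
  have h2 := abs_errVec_snd_le ξ x
  have k1 := abs_errVec_fst_le ξ y
  have k2 := abs_errVec_snd_le ξ y
  have hx := (abs_coord_bounds ξ x).1
  have hy := (abs_coord_bounds ξ y).1
  set E := ‖errVec ξ x‖
  set F := ‖errVec ξ y‖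
  have hE : 0 ≤ E := norm_nonneg _
  have hF : 0 ≤ F := norm_nonneg _
  have hX := abs_nonneg (x 0 : ℝ)
  have hY := abs_nonneg (y 0 : ℝ)
  have hξ := abs_nonneg ξ
  have aux : ∀ {p q r s t u v w : ℝ}, |p| ≤ E → |q| ≤ E → |r| ≤ F → |s| ≤ F →
      |p * (y 1 * t - r * u) + q * (-(y 0 * v) + w * s)| ≤
        E * (|(y 1 : ℝ)| * |t| + F * |u| + |(y 0 : ℝ)| * |v| + |w| * F) := by
    intro p q r s t u v w hp hq hr hs
    have e1 : |y 1 * t - r * u| ≤ |(y 1 : ℝ)| * |t| + F * |u| := by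
      refine (abs_sub _ _).trans ?_
      rw [abs_mul, abs_mul]
      gcongr
    have e2 : |-(y 0 * v) + w * s| ≤ |(y 0 : ℝ)| * |v| + |w| * F := by
      refine (abs_add_le _ _).trans ?_
      rw [abs_neg, abs_mul, abs_mul]
      gcongr
    refine (abs_add_le _ _).trans ?_
    rw [abs_mul, abs_mul]
    calc _ ≤ E * (|(y 1 : ℝ)| * |t| + F * |u|) + E * (|(y 0 : ℝ)| * |v| + |w| * F) := by gcongr
      _ = _ := by ring
  have c1 : ξ * bracket x y 0 - bracket x y 1
      = (ξ * x 0 - x 1) * (y 1 * (ξ * x 0 - x 1) - (ξ * y 1 - y 2) * x 0)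
        + (ξ * x 1 - x 2) * (-(y 0 * (ξ * x 0 - x 1)) + x 0 * (ξ * y 0 - y 1)) := by
    simp [bracket]; ring
  have c2 : ξ * bracket x y 1 - bracket x y 2
      = (ξ * x 0 - x 1) * (y 1 * (ξ * x 1 - x 2) - (ξ * y 1 - y 2) * x 1)
        + (ξ * x 1 - x 2) * (-(y 0 * (ξ * x 1 - x 2)) + x 1 * (ξ * y 0 - y 1)) := by
    simp [bracket]; ring
  have fin : ∀ {u e : ℝ}, |u| ≤ (1 + |ξ|) * |(x 0 : ℝ)| + E → |e| ≤ E →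
      E * (|(y 1 : ℝ)| * |e| + F * |u| + |(y 0 : ℝ)| * |e| + |u| * F)
        ≤ 3 * (1 + |ξ|) * (E * (|(y 0 : ℝ)| * E + |(x 0 : ℝ)| * F + E * F)) := by
    intro u e hu he
    calc _ ≤ E * ((|ξ| * |(y 0 : ℝ)| + F) * E + F * ((1 + |ξ|) * |(x 0 : ℝ)| + E)
          + |(y 0 : ℝ)| * E + ((1 + |ξ|) * |(x 0 : ℝ)| + E) * F) := by gcongr
      _ ≤ E * (3 * (1 + |ξ|) * (|(y 0 : ℝ)| * E + |(x 0 : ℝ)| * F + E * F)) := by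
          gcongr
          nlinarith [mul_nonneg hY hE, mul_nonneg hX hF, mul_nonneg hE hF,
            mul_nonneg hξ (mul_nonneg hY hE), mul_nonneg hξ (mul_nonneg hX hF),
            mul_nonneg hξ (mul_nonneg hE hF)]
      _ = _ := by ring
  apply norm_errVec_le
  · rw [c1]
    exact (aux h1 h2 k2 k1).trans (fin (by nlinarith [mul_nonneg hξ hX]) h1)
  · rw [c2]
    exact (aux h1 h2 k2 k1).trans (fin (by nlinarith) h2)

namespace ApproxSeq

variable {ξ : ℝ} {y : ℕ → Fin 3 → ℤ} {a : ℕ → ℝ} {K : ℝ}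

/-- The content is at most the absolute value of the determinant, which is bounded by size times
error. -/
theorem content_le (h : ApproxSeq ξ y a K) {k : ℕ} (hd : (symMat (y k)).det ≠ 0) :
    (content (symMat (y k)) : ℝ) ≤ (1 + |ξ|) * (2 * Real.exp (2 * K)) := by
  have h0 := h.a_nonneg k
  have h1 : (content (symMat (y k)) : ℝ) ≤ |((symMat (y k)).det : ℝ)| := by
    exact_mod_cast content_le_abs_det hd
  refine h1.trans ((abs_det_symMat_le ξ (y k)).trans ?_)
  have h2 : Real.exp (-a k + K) ≤ Real.exp (a k + K) := Real.exp_le_exp.2 (by linarith)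
  have h3 : |(y k 0 : ℝ)| + ‖errVec ξ (y k)‖ ≤ 2 * Real.exp (a k + K) := by
    linarith [h.abs_zero_le k, h.err_le k]
  calc _ ≤ (1 + |ξ|) * (2 * Real.exp (a k + K)) * Real.exp (-a k + K) := by
        gcongr
        exact h.err_le k
    _ = (1 + |ξ|) * (2 * (Real.exp (a k + K) * Real.exp (-a k + K))) := by ring
    _ = _ := by rw [← Real.exp_add]; ring_nf

theorem of_proportional (h : ApproxSeq ξ y a K) {x : ℕ → Fin 3 → ℤ} {M : ℝ}
    (hd : ∀ k, (symMat (y k)).det ≠ 0) (hM : ∀ k, (content (symMat (x k)) : ℝ) ≤ M)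
    (hp : ∀ k, Proportional (symMat (x k)) (symMat (y k)))
    (ht : ∀ k, triple (x k) (x (k + 1)) (x (k + 2)) ≠ 0) : ∃ K', ApproxSeq ξ x a K' := by
  have hdx : ∀ k, (symMat (x k)).det ≠ 0 := fun k => (hp k).symm.det_ne_zero (hd k)
  have hMpos : 0 < M := lt_of_lt_of_le (by exact_mod_cast content_pos (hdx 0)) (hM 0)
  set M' := (1 + |ξ|) * (2 * Real.exp (2 * K))
  have hM'pos : 0 < M' := by positivity
  set L := max 0 (max (Real.log M) (Real.log M'))
  have hL0 : 0 ≤ L := le_max_left _ _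
  have hL1 : M ≤ Real.exp L := (Real.log_le_iff_le_exp hMpos).1
    ((le_max_left _ _).trans (le_max_right _ _))
  have hL2 : M' ≤ Real.exp L := (Real.log_le_iff_le_exp hM'pos).1
    ((le_max_right _ _).trans (le_max_right _ _))
  refine ⟨K + L, fun k => (h.growth k).trans (by linarith), h.tendsto, h.a_nonneg, ?_, ?_, ?_, ht⟩
  · intro k
    rw [← add_assoc, Real.exp_add _ L, mul_comm]
    refine (size_le_of_proportional ξ (hd k) (hM k) (hp k)).1.trans ?_
    gcongr
    exact h.abs_zero_le k
  · intro k
    rw [← add_assoc, Real.exp_add _ L, mul_comm]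
    refine (size_le_of_proportional ξ (hd k) (hM k) (hp k)).2.trans ?_
    gcongr
    exact h.err_le k
  · intro k
    obtain ⟨h1, h2⟩ := size_le_of_proportional ξ (hdx k) (h.content_le (hd k)) (hp k).symm
    rw [← sub_sub, Real.exp_sub _ L, div_le_iff₀ (Real.exp_pos _)]
    refine (h.le_size k).trans ?_
    calc _ ≤ M' * |(x k 0 : ℝ)| + M' * ‖errVec ξ (x k)‖ := add_le_add h1 h2
      _ = (|(x k 0 : ℝ)| + ‖errVec ξ (x k)‖) * M' := by ring
      _ ≤ _ := by gcongr

/-- The exponent 2a_{k+2} − a_{k+3} equals a_k up to a bounded amount, by two applications of the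
additive recurrence. -/
theorem bracket_bounds (h : ApproxSeq ξ y a K) (k : ℕ) :
    |(bracket (y (k + 2)) (y (k + 3)) 0 : ℝ)|
      ≤ Real.exp (a k + (7 * K + Real.log (9 * (1 + |ξ|)))) ∧
    ‖errVec ξ (bracket (y (k + 2)) (y (k + 3)))‖
      ≤ Real.exp (-a k + (7 * K + Real.log (9 * (1 + |ξ|)))) := by
  have hK := h.nonneg
  have hξ := abs_nonneg ξ
  have g1 := abs_le.1 (h.growth_two k)
  have g2 := abs_le.1 (h.growth_two (k + 1))
  rw [show k + 1 + 2 = k + 3 by ring, show k + 1 + 1 = k + 2 by ring] at g2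
  have n0 := h.a_nonneg k
  have n1 := h.a_nonneg (k + 1)
  have n2 := h.a_nonneg (k + 2)
  have n3 := h.a_nonneg (k + 3)
  have hX := h.abs_zero_le (k + 2)
  have hE := h.err_le (k + 2)
  have hY := h.abs_zero_le (k + 3)
  have hF := h.err_le (k + 3)
  have prod : ∀ {p q r u v w B : ℝ}, 0 ≤ q → 0 ≤ r → p ≤ Real.exp u →
      q ≤ Real.exp v → r ≤ Real.exp w → u + v + w ≤ B → p * q * r ≤ Real.exp B := by
    intro p q r u v w B hq hr h1 h2 h3 h4
    calc p * q * r ≤ Real.exp u * Real.exp v * Real.exp w := by gcongr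
      _ = Real.exp (u + v + w) := by rw [Real.exp_add, Real.exp_add]
      _ ≤ _ := Real.exp_le_exp.2 h4
  have nE := norm_nonneg (errVec ξ (y (k + 2)))
  have nF := norm_nonneg (errVec ξ (y (k + 3)))
  have nX := abs_nonneg (y (k + 2) 0 : ℝ)
  have nY := abs_nonneg (y (k + 3) 0 : ℝ)
  constructor
  · have b1 := prod (B := a k + 7 * K) nX nF hX hX hF (by linarith)
    have b2 := prod (B := a k + 7 * K) nE nF hX hE hF (by linarith)
    have b3 := prod (B := a k + 7 * K) nE nE hY hE hE (by linarith)
    rw [← add_assoc, Real.exp_add _ (Real.log _), Real.exp_log (by positivity)]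
    refine (abs_bracket_zero_le ξ (y (k + 2)) (y (k + 3))).trans ?_
    have pe := Real.exp_pos (a k + 7 * K)
    have b1' := mul_le_mul_of_nonneg_left b1 (by linarith : 0 ≤ 1 + |ξ|)
    have pe' := mul_nonneg hξ pe.le
    linarith
  · have b1 := prod (B := -a k + 7 * K) nY nE hE hY hE (by linarith)
    have b2 := prod (B := -a k + 7 * K) nX nF hE hX hF (by linarith)
    have b3 := prod (B := -a k + 7 * K) nE nF hE hE hF (by linarith)
    rw [← add_assoc, Real.exp_add _ (Real.log _), Real.exp_log (by positivity)]
    refine (norm_errVec_bracket_le ξ (y (k + 2)) (y (k + 3))).trans ?_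
    calc _ ≤ 3 * (1 + |ξ|) * (3 * Real.exp (-a k + 7 * K)) := by
          refine mul_le_mul_of_nonneg_left ?_ (by positivity)
          linarith
      _ = _ := by ring

/-- The bracket is non-zero and approximates ξ as well as y_k does, with exponent exactly a k; the
proportionality criterion then singles out y_k among the terms. -/
theorem eventually_bracket_proportional (h : ApproxSeq ξ y a K)
    (hd : ∀ k, (symMat (y k)).det ≠ 0) :
    ∀ᶠ k in atTop, Proportional
      (symMat (y (k + 2)) * ((symMat (y (k + 3))).adjugate * symMat (y (k + 2))))
      (symMat (y k)) := by
  have hK := h.nonneg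
  have hlog : 0 ≤ Real.log (9 * (1 + |ξ|)) := Real.log_nonneg (by linarith [abs_nonneg ξ])
  obtain ⟨T, k₀, hT0, hT⟩ := h.exists_proportional
    (K' := 7 * K + Real.log (9 * (1 + |ξ|))) (by positivity)
  obtain ⟨m, hm⟩ := eventually_atTop.1
    ((h.eventually_add_le_succ T).and (eventually_ge_atTop k₀))
  refine eventually_atTop.2 ⟨m + 1, fun n hn => ?_⟩
  obtain ⟨k, rfl⟩ := Nat.exists_eq_add_of_le' (show 1 ≤ n by omega)
  obtain ⟨hz0, hz1⟩ := h.bracket_bounds (k + 1)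
  obtain ⟨hk, hk'⟩ := hm k (by omega)
  rw [← symMat_bracket]
  set z := bracket (y (k + 1 + 2)) (y (k + 1 + 3)) with hz
  have heq := hT k hk' z (a (k + 1)) hz0 hz1 hk (by linarith)
  refine ⟨_, _, h.triple_ne k, ?_, by rw [← symMat_smul, heq, symMat_smul]⟩
  intro h0
  rw [h0, zero_smul] at heq
  rcases smul_eq_zero.1 heq with h1 | h1
  · exact h.triple_ne k h1
  · have h2 : (symMat z).det = 0 := by rw [h1]; simp [det_symMat]
    rw [hz, symMat_bracket, Matrix.det_mul, Matrix.det_mul, Matrix.det_adjugate] at h2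
    exact mul_ne_zero (hd _) (mul_ne_zero (pow_ne_zero _ (hd _)) (hd _)) h2

end ApproxSeq

namespace IntMat2

theorem adjugate_adjugate_two (A : IntMat2) : A.adjugate.adjugate = A := by
  ext i j
  fin_cases i <;> fin_cases j <;> simp [Matrix.adjugate_fin_two]

/-- Multiplying A N by adj N gives det N times the primitive A, so the content of A N divides det N.
-/
theorem content_mul_le {A N : IntMat2} (hA : content A = 1) (hA' : A.det ≠ 0) (hN : N.det ≠ 0) :
    content (A * N) ≤ |N.det| := by
  have h1 : content (A * N) • (red (A * N) * N.adjugate) = N.det • A := by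
    rw [← Matrix.smul_mul, content_smul_red, Matrix.mul_assoc, Matrix.mul_adjugate,
      Matrix.mul_smul, Matrix.mul_one]
  have h2 := congrArg content h1
  have hd := det_mul_ne_zero hA' hN
  rw [content_smul, content_smul, hA, mul_one, abs_of_nonneg (content_nonneg _)] at h2
  rw [← h2]
  refine le_mul_of_one_le_right (content_nonneg _) (content_pos ?_)
  rw [Matrix.det_mul, Matrix.det_adjugate]
  exact mul_ne_zero (det_red_ne_zero hd) (pow_ne_zero _ hN)

theorem isSymm_of_proportional {A S : IntMat2} (h : Proportional A S) (hS : Sᵀ = S) :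
    A.IsSymm := by
  obtain ⟨p, q, hp, -, h⟩ := h
  refine smul_right_injective _ hp (?_ : p • Aᵀ = p • A)
  rw [← Matrix.transpose_smul, h, Matrix.transpose_smul, hS]

theorem exists_smul_skew {N : IntMat2} (h : Nᵀ = -N) : N = N 0 1 • skew := by
  have h00 := congrFun (congrFun h 0) 0
  have h01 := congrFun (congrFun h 0) 1
  have h11 := congrFun (congrFun h 1) 1
  simp only [Matrix.transpose_apply, Matrix.neg_apply] at h00 h01 h11
  ext i j
  fin_cases i <;> fin_cases j <;> simp [skew] <;> omega

end IntMat2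

/-- The Fibonacci sequence with prescribed first two terms, indexed from `0`. -/
def fibSeq {M : Type*} [Monoid M] (u v : M) : ℕ → M
  | 0 => u
  | 1 => v
  | n + 2 => fibSeq u v (n + 1) * fibSeq u v n

namespace ApproxSeq

variable {ξ : ℝ} {y : ℕ → Fin 3 → ℤ} {a : ℕ → ℝ} {K : ℝ}

/-- Proportional terms have comparable sizes, whereas the gaps of a tend to infinity. -/
theorem not_forall_proportional (h : ApproxSeq ξ y a K) (hd : ∀ k, (symMat (y k)).det ≠ 0) :
    ¬ ∀ k, Proportional (symMat (y (k + 3))) (symMat (y k)) := by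
  intro hp
  set M := (1 + |ξ|) * (2 * Real.exp (2 * K))
  set C := |Real.log (2 * M) + K + K|
  obtain ⟨k, hk⟩ := eventually_atTop.1 (h.eventually_add_le_succ (C + 1))
  have h1 := h.le_add_of_proportional h (by positivity) (h.content_le (hd (k + 3))) (hd k) (hp k)
    (h.a_nonneg k)
  have h2 := hk k le_rfl
  have h3 := hk (k + 1) (by omega)
  have h4 := hk (k + 2) (by omega)
  have h5 := le_abs_self (Real.log (2 * M) + K + K)
  have h6 : 0 ≤ C := abs_nonneg _
  linarith

/-- A sequence of approximations to `ξ` satisfying the recurrence of symmetric points comes from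
an admissible Fibonacci sequence of primitive matrices. -/
theorem exists_associated_of_bracket (h : ApproxSeq ξ y a K) (hd : ∀ k, (symMat (y k)).det ≠ 0)
    (hrel : ∀ k, Proportional
      (symMat (y (k + 2)) * ((symMat (y (k + 3))).adjugate * symMat (y (k + 2))))
      (symMat (y k))) : ∃ W, IsAssociated ξ W := by
  set S : ℕ → IntMat2 := fun k => symMat (y k)
  have hST : ∀ k, (S k)ᵀ = S k := fun k => symMat_transpose _
  have hSd : ∀ k, (S k).det ≠ 0 := hd
  -- This is N_{k+1}, up to scalars, as solved from the expected recurrence S_{k+2} ∝ S_{k+1}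
  -- adj(N_{k+1}) S_k.
  set R : ℕ → IntMat2 := fun k => S k * ((S (k + 2)).adjugate * S (k + 1)) with hR
  have hRd : ∀ k, (R k).det ≠ 0 := fun k => by
    simp only [hR, Matrix.det_mul, Matrix.det_adjugate]
    exact mul_ne_zero (hSd _) (mul_ne_zero (pow_ne_zero _ (hSd _)) (hSd _))
  -- The bracket relation rewrites adj(S_{k+2}) S_k as adj(S_{k+3}) S_{k+2} up to scalars: advancing
  -- the index transposes R.
  have hRsucc : ∀ k, Proportional (R k)ᵀ (R (k + 1)) := by
    intro k
    have e : (R k)ᵀ = S (k + 1) * ((S (k + 2)).adjugate * S k) := by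
      simp only [hR]
      rw [Matrix.transpose_mul, Matrix.transpose_mul, Matrix.adjugate_transpose, hST, hST, hST,
        Matrix.mul_assoc]
    rw [e]
    refine (Proportional.refl _).mul (Proportional.cancel_left (hSd (k + 2)) ?_)
    exact (Proportional.mul_adjugate_cancel (hSd (k + 2)) _).trans (hrel k).symm
  -- R 1 and not R 0, since R k has to match `alternate N (k + 1)` and N itself sits at even
  -- indices.
  set P : PrimMat := PrimMat.ofRed (R 1) (hRd 1)
  set N := P.toMat
  have hNd : N.det ≠ 0 := P.det_ne_zero
  have hNR1 : Proportional N (R 1) := red_proportional (hRd 1)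
  have halt : ∀ k, Proportional (alternate N (k + 1)) (R k) := by
    intro k
    induction k with
    | zero =>
      have h1 := (hNR1.trans (hRsucc 0).symm).transpose
      rw [Matrix.transpose_transpose] at h1
      simpa [alternate] using h1
    | succ k ih =>
      rw [alternate_succ]
      exact ih.transpose.trans (hRsucc k)
  have haltd : ∀ k, (alternate N k).det ≠ 0 := fun k => by rw [det_alternate]; exact hNd
  have hSrec : ∀ k, Proportional (S (k + 3))
      (S (k + 2) * ((alternate N (k + 2)).adjugate * S (k + 1))) := by
    intro k
    have h1 := (halt (k + 1)).adjugate
    simp only [hR, Matrix.adjugate_mul_distrib, adjugate_adjugate_two] at h1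
    refine (Proportional.trans ((Proportional.refl _).mul (h1.mul (.refl _))) ?_).symm
    refine Proportional.trans ((Proportional.refl _).mul
      (Proportional.mul_adjugate_mul_cancel (hSd (k + 1)) _)) ?_
    exact Proportional.mul_adjugate_cancel (hSd (k + 2)) _
  set V : ℕ → IntMat2 := fun k => S (k + 1) * (alternate N (k + 1)).adjugate with hV
  have hVd : ∀ k, (V k).det ≠ 0 := fun k => by
    simp only [hV, Matrix.det_mul, Matrix.det_adjugate]
    exact mul_ne_zero (hSd _) (pow_ne_zero _ (haltd _))
  have hVrec : ∀ k, Proportional (V (k + 2)) (V (k + 1) * V k) := by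
    intro k
    simp only [hV]
    rw [show k + 2 + 1 = k + 1 + 2 by ring, alternate_add_two, ← Matrix.mul_assoc,
      Matrix.mul_assoc (S (k + 1 + 1))]
    exact (hSrec k).mul (.refl _)
  set U := fibSeq (PrimMat.ofRed (V 0) (hVd 0)) (PrimMat.ofRed (V 1) (hVd 1))
  have hUV : ∀ k, Proportional (U k).toMat (V k) ∧ Proportional (U (k + 1)).toMat (V (k + 1)) := by
    intro k
    induction k with
    | zero => exact ⟨red_proportional (hVd 0), red_proportional (hVd 1)⟩
    | succ k ih =>
      refine ⟨ih.2, ?_⟩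
      have : U (k + 1 + 1) = U (k + 1) * U k := rfl
      rw [this]
      exact (PrimMat.mul_proportional _ _).trans ((ih.2.mul ih.1).trans (hVrec k).symm)
  set W : ℕ → PrimMat := fun i => U (i - 1)
  have hF : IsFibonacciSeq W := by
    intro i hi
    obtain ⟨k, rfl⟩ := Nat.exists_eq_add_of_le' hi
    rfl
  have hWS : ∀ k, Proportional ((W (k + 1)).toMat * alternate N (k + 1)) (S (k + 1)) := by
    intro k
    refine ((hUV k).1.mul (.refl _)).trans ?_
    exact Proportional.mul_adjugate_mul_cancel (haltd _) _
  have hsymm : ∀ i, 1 ≤ i → ((W i).toMat * alternate N i).IsSymm := by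
    intro i hi
    obtain ⟨k, rfl⟩ := Nat.exists_eq_add_of_le' hi
    exact isSymm_of_proportional (hWS k) (hST _)
  -- A symmetric N would make three consecutive points dependent.
  have hns : Nᵀ ≠ N := by
    intro hcon
    obtain ⟨p, q, hp, hq, hpq⟩ := hSrec 0
    have h1 := triple_eq_of_smul_symMat hpq
    have h2 : alternate N (0 + 2) = N := by simp [alternate]
    have h3 : N 0 1 = N 1 0 := congrFun (congrFun hcon 1) 0
    rw [h2, h3, sub_self, mul_zero, mul_zero] at h1
    exact mul_ne_zero hp (h.triple_ne 1) h1
  -- A skew N is a multiple of J; using the recurrence twice and S J S = det(S) J then gives S_{k+4}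
  -- ∝ S_{k+1}, a period of three that growth forbids.
  have hnskew : Nᵀ ≠ -N := by
    intro hcon
    have hsk := exists_smul_skew hcon
    have hsk0 : N 0 1 ≠ 0 := by
      intro h0
      rw [h0, zero_smul] at hsk
      exact P.toMat_ne_zero hsk
    have hNs : ∀ i, Proportional (alternate N i).adjugate skew := by
      have h1 : Proportional N skew := by
        rw [hsk]
        exact Proportional.smul_left hsk0 _
      have hadj : skew.adjugate = -skew := by
        ext i j
        fin_cases i <;> fin_cases j <;> simp [skew, Matrix.adjugate_fin_two]
      have h2 : Proportional N.adjugate skew := by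
        refine h1.adjugate.trans ?_
        rw [hadj]
        exact ⟨-1, 1, by norm_num, one_ne_zero, by simp⟩
      intro i
      unfold alternate
      split_ifs
      · rw [hcon]
        refine Proportional.trans (Proportional.adjugate ?_) h2
        exact ⟨-1, 1, by norm_num, one_ne_zero, by simp⟩
      · exact h2
    have hrec' : ∀ k, Proportional (S (k + 3)) (S (k + 2) * (skew * S (k + 1))) := fun k =>
      (hSrec k).trans ((Proportional.refl _).mul ((hNs _).mul (.refl _)))
    have hskT : skewᵀ = -skew := by
      ext i j
      fin_cases i <;> fin_cases j <;> simp [skew]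
    have hrec'' : ∀ k, Proportional (S (k + 3)) (S (k + 1) * (skew * S (k + 2))) := by
      intro k
      have h1 := (hrec' k).transpose
      rw [hST, Matrix.transpose_mul, Matrix.transpose_mul, hST, hST, hskT] at h1
      refine h1.trans ⟨-1, 1, by norm_num, one_ne_zero, ?_⟩
      simp [Matrix.mul_assoc]
    have hss : skew * skew = -1 := by
      ext i j
      fin_cases i <;> fin_cases j <;> simp [skew]
    have hper : ∀ k, Proportional (S (k + 1 + 3)) (S (k + 1)) := by
      intro k
      refine (hrec' (k + 1)).trans (((hrec'' k).mul (.refl _)).trans ?_)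
      have e : S (k + 1) * (skew * S (k + 2)) * (skew * S (k + 1 + 1))
          = -(S (k + 2)).det • S (k + 1) := by
        have h1 := transpose_mul_skew_mul (S (k + 2))
        rw [hST] at h1
        rw [show k + 1 + 1 = k + 2 by ring, Matrix.mul_assoc, Matrix.mul_assoc, h1,
          Matrix.mul_smul, hss, Matrix.mul_smul]
        simp
      rw [e]
      exact Proportional.smul_left (neg_ne_zero.2 (hSd _)) _
    exact (h.shift 1).not_forall_proportional (fun k => hd _) fun k => by
      have := hper k
      rwa [show k + 1 + 3 = k + 3 + 1 by ring] at this
  have hA : IsAdmissible W := ⟨P, hns, hnskew, hsymm⟩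
  have hxex : ∀ i, ∃ x, 1 ≤ i → symMat x = (W i).toMat * alternate N i := by
    intro i
    by_cases hi : 1 ≤ i
    · obtain ⟨x, hx⟩ := exists_symMat_eq (hsymm i hi)
      exact ⟨x, fun _ => hx⟩
    · exact ⟨0, fun h => absurd h hi⟩
  choose x hx using hxex
  have hpts : SymmetricPoints W N x := ⟨hNd, hns, hx⟩
  obtain ⟨K', hK'⟩ := (h.shift 1).of_proportional (x := fun k => x (k + 1)) (M := |(N.det : ℝ)|)
    (fun k => hd _) (fun k => by
      have := content_mul_le (W (k + 1)).content_eq_one (W (k + 1)).det_ne_zero (haltd (k + 1))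
      rw [det_alternate, ← hx _ (by omega)] at this
      exact_mod_cast this) (fun k => by
      rw [hx _ (by omega)]
      exact hWS k) (fun k => hpts.triple_ne hF (by omega))
  obtain ⟨h1, h2⟩ := hpts.satisfiesEstimates hK'
  exact ⟨W, hF, hA, h1, h2⟩

theorem exists_associated (h : ApproxSeq ξ y a K) (hd : ∀ k, (symMat (y k)).det ≠ 0) :
    ∃ W, IsAssociated ξ W := by
  obtain ⟨m, hm⟩ := eventually_atTop.1 (h.eventually_bracket_proportional hd)
  refine (h.shift m).exists_associated_of_bracket (fun k => hd _) fun k => ?_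
  have := hm (k + m) (by omega)
  rwa [show k + m + 2 = k + 2 + m by ring, show k + m + 3 = k + 3 + m by ring] at this

end ApproxSeq

/-! ### Minimal points of an extremal number -/

theorem goldenRatio_one_div : 1 / Real.goldenRatio = Real.goldenRatio - 1 := by
  rw [div_eq_iff Real.goldenRatio_ne_zero]
  linarith [Real.goldenRatio_sq]

theorem IsExtremal.exists_solution {ξ : ℝ} (h : IsExtremal ξ) :
    ∃ c : ℝ, ∀ X : ℝ, 1 ≤ X → ∃ z : Fin 3 → ℤ, z ≠ 0 ∧ |(z 0 : ℝ)| ≤ X ∧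
      ‖errVec ξ z‖ ≤ Real.exp (c - (Real.goldenRatio - 1) * Real.log X) := by
  obtain ⟨-, c, hc, h⟩ := h
  refine ⟨Real.log ((1 + |ξ|) * c), fun X hX => ?_⟩
  have hXpos : 0 < X := by linarith
  obtain ⟨x₀, x₁, x₂, hne, h0, h1, h2⟩ := h X hX
  have e : Real.exp (Real.log ((1 + |ξ|) * c) - (Real.goldenRatio - 1) * Real.log X)
      = (1 + |ξ|) * (c * X ^ (-(1 / Real.goldenRatio))) := by
    rw [sub_eq_add_neg, Real.exp_add, Real.exp_log (by positivity), Real.rpow_def_of_pos hXpos,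
      goldenRatio_one_div, mul_assoc]
    ring_nf
  have hnn : 0 ≤ c * X ^ (-(1 / Real.goldenRatio)) := by positivity
  refine ⟨![x₀, x₁, x₂], ?_, h0, ?_⟩
  · intro hz
    apply hne
    have k0 := congrFun hz 0
    have k1 := congrFun hz 1
    have k2 := congrFun hz 2
    simp at k0 k1 k2
    simp [k0, k1, k2]
  · rw [e]
    apply norm_errVec_le
    · simp only [Matrix.cons_val_zero, Matrix.cons_val_one]
      rw [mul_comm ξ]
      refine h1.trans (le_mul_of_one_le_left hnn ?_)
      linarith [abs_nonneg ξ]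
    · simp only [Matrix.cons_val_one, Matrix.cons_val]
      have e2 : ξ * x₁ - x₂ = (x₀ * ξ ^ 2 - x₂) - ξ * (x₀ * ξ - x₁) := by ring
      rw [e2, add_mul, one_mul]
      refine (abs_sub _ _).trans ?_
      rw [abs_mul]
      gcongr

theorem norm_errVec_pos {ξ : ℝ}
    (hirr : ∀ a b c : ℤ, (a : ℝ) * ξ ^ 2 + (b : ℝ) * ξ + (c : ℝ) = 0 → a = 0 ∧ b = 0 ∧ c = 0)
    {z : Fin 3 → ℤ} (hz : z ≠ 0) : 0 < ‖errVec ξ z‖ := by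
  rw [norm_pos_iff]
  intro h0
  have h1 : ξ * z 0 - z 1 = 0 := congrArg Prod.fst h0
  have h2 : ξ * z 1 - z 2 = 0 := congrArg Prod.snd h0
  obtain ⟨-, k0, k1⟩ := hirr 0 (z 0) (-z 1) (by push_cast; linarith)
  obtain ⟨-, -, k2⟩ := hirr 0 (z 1) (-z 2) (by push_cast; linarith)
  apply hz
  ext i
  fin_cases i
  · exact k0
  · exact neg_eq_zero.1 k1
  · exact neg_eq_zero.1 k2

/-- Among the non-zero points with a smaller error than `x`, the point `y` has the smallest first
coordinate and, for this first coordinate, the smallest error. -/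
structure IsNext (ξ : ℝ) (x y : Fin 3 → ℤ) : Prop where
  ne_zero : y ≠ 0
  err_lt : ‖errVec ξ y‖ < ‖errVec ξ x‖
  abs_le : ∀ z, z ≠ 0 → ‖errVec ξ z‖ < ‖errVec ξ x‖ → |y 0| ≤ |z 0|
  err_le : ∀ z, z ≠ 0 → ‖errVec ξ z‖ < ‖errVec ξ x‖ → |z 0| = |y 0| →
    ‖errVec ξ y‖ ≤ ‖errVec ξ z‖

theorem finite_setOf_errVec_le (ξ : ℝ) (n : ℤ) (E : ℝ) :
    {z : Fin 3 → ℤ | |z 0| ≤ n ∧ ‖errVec ξ z‖ ≤ E}.Finite := by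
  set B₁ := |ξ| * n + E with hB₁
  set B₂ := |ξ| * B₁ + E with hB₂
  set M := max n (max ⌈B₁⌉ ⌈B₂⌉)
  refine (Set.finite_Icc (fun _ => -M : Fin 3 → ℤ) (fun _ => M)).subset ?_
  rintro z ⟨h0, hE⟩
  obtain ⟨h1, h2⟩ := abs_coord_bounds ξ z
  have k0 : |(z 0 : ℝ)| ≤ n := by exact_mod_cast h0
  have k1 : |(z 1 : ℝ)| ≤ B₁ := h1.trans (by rw [hB₁]; gcongr)
  have k2 : |(z 2 : ℝ)| ≤ B₂ := h2.trans (by rw [hB₂]; gcongr)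
  have m0 : |z 0| ≤ M := h0.trans (le_max_left _ _)
  have m1 : |z 1| ≤ M := by
    have : |z 1| ≤ ⌈B₁⌉ := by exact_mod_cast k1.trans (Int.le_ceil B₁)
    exact this.trans ((le_max_left _ _).trans (le_max_right _ _))
  have m2 : |z 2| ≤ M := by
    have : |z 2| ≤ ⌈B₂⌉ := by exact_mod_cast k2.trans (Int.le_ceil B₂)
    exact this.trans ((le_max_right _ _).trans (le_max_right _ _))
  have : ∀ i, |z i| ≤ M := by
    intro i
    fin_cases i
    exacts [m0, m1, m2]
  exact ⟨fun i => (abs_le.1 (this i)).1, fun i => (abs_le.1 (this i)).2⟩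

/-- Minimise the first coordinate, a natural number in absolute value, then the error over the
finite set of points reaching that minimum. -/
theorem exists_isNext {ξ : ℝ} {x : Fin 3 → ℤ}
    (h : ∃ z, z ≠ 0 ∧ ‖errVec ξ z‖ < ‖errVec ξ x‖) : ∃ y, IsNext ξ x y := by
  classical
  have hex : ∃ n : ℕ, ∃ z, (z ≠ 0 ∧ ‖errVec ξ z‖ < ‖errVec ξ x‖) ∧ (z 0).natAbs = n := by
    obtain ⟨z, hz⟩ := h
    exact ⟨_, z, hz, rfl⟩
  obtain ⟨w, hw, hwn⟩ := Nat.find_spec hex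
  set n := Nat.find hex
  set A := {z : Fin 3 → ℤ | (z ≠ 0 ∧ ‖errVec ξ z‖ < ‖errVec ξ x‖) ∧ (z 0).natAbs = n}
  have hfin : A.Finite := by
    refine (finite_setOf_errVec_le ξ n ‖errVec ξ x‖).subset ?_
    rintro z ⟨⟨-, h1⟩, h2⟩
    exact ⟨by rw [Int.abs_eq_natAbs, h2], h1.le⟩
  obtain ⟨y, ⟨⟨hy0, hy1⟩, hy2⟩, hmin⟩ := Set.exists_min_image A (fun z => ‖errVec ξ z‖) hfin
    ⟨w, hw, hwn⟩
  refine ⟨y, hy0, hy1, fun z hz hz' => ?_, fun z hz hz' hzy => hmin z ⟨⟨hz, hz'⟩, ?_⟩⟩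
  · rw [Int.abs_eq_natAbs, Int.abs_eq_natAbs, hy2]
    exact_mod_cast Nat.find_min' hex ⟨z, ⟨hz, hz'⟩, rfl⟩
  · rw [Int.abs_eq_natAbs, Int.abs_eq_natAbs] at hzy
    rw [← hy2]
    exact_mod_cast hzy

/-- z also beats the error of x, so its first coordinate is at least that of y; equality would
contradict the choice of y as having least error. -/
theorem IsNext.abs_lt {ξ : ℝ} {x y z : Fin 3 → ℤ} (h : IsNext ξ x y) (h' : IsNext ξ y z) :
    |y 0| < |z 0| := by
  have hlt := h'.err_lt.trans h.err_lt
  refine lt_of_le_of_ne (h.abs_le z h'.ne_zero hlt) fun heq => ?_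
  exact absurd (h.err_le z h'.ne_zero hlt heq.symm) (not_le.2 h'.err_lt)

/-- A sequence of minimal points of `ξ`, with the estimate coming from extremality. -/
structure MinimalSeq (ξ : ℝ) (p : ℕ → Fin 3 → ℤ) (c : ℝ) : Prop where
  irr : ∀ A B C : ℤ, (A : ℝ) * ξ ^ 2 + (B : ℝ) * ξ + (C : ℝ) = 0 → A = 0 ∧ B = 0 ∧ C = 0
  ne_zero : ∀ l, p l ≠ 0
  next : ∀ l, IsNext ξ (p l) (p (l + 1))
  one_le : ∀ l, 1 ≤ |p l 0|
  abs_lt : ∀ l, |p l 0| < |p (l + 1) 0|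
  log_err_le : ∀ l, Real.log ‖errVec ξ (p l)‖
    ≤ c - (Real.goldenRatio - 1) * Real.log |(p (l + 1) 0 : ℝ)|

theorem IsExtremal.exists_minimalSeq {ξ : ℝ} (h : IsExtremal ξ) : ∃ p c, MinimalSeq ξ p c := by
  have hirr := h.1
  obtain ⟨c, hc⟩ := h.exists_solution
  have hg := goldenRatio_bounds
  have hex : ∀ x : {x : Fin 3 → ℤ // x ≠ 0}, ∃ y : {x : Fin 3 → ℤ // x ≠ 0},
      IsNext ξ x.1 y.1 := by
    rintro ⟨x, hx⟩
    have hpos := norm_errVec_pos hirr hx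
    obtain ⟨y, hy⟩ : ∃ y, IsNext ξ x y := by
      apply exists_isNext
      set t := max 0 (2 * (c - Real.log ‖errVec ξ x‖) + 1)
      have ht0 : 0 ≤ t := le_max_left _ _
      have ht1 : 2 * (c - Real.log ‖errVec ξ x‖) + 1 ≤ t := le_max_right _ _
      obtain ⟨z, hz, -, hz'⟩ := hc (Real.exp t) (Real.one_le_exp ht0)
      refine ⟨z, hz, hz'.trans_lt ?_⟩
      rw [Real.log_exp, ← Real.lt_log_iff_exp_lt hpos]
      nlinarith
    exact ⟨⟨y, hy.ne_zero⟩, hy⟩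
  choose f hf using hex
  set q : ℕ → {x : Fin 3 → ℤ // x ≠ 0} :=
    fun l => f^[l] ⟨![1, 0, 0], fun h => one_ne_zero (congrFun h 0)⟩ with hq
  have hnext : ∀ l, IsNext ξ (q l).1 (q (l + 1)).1 := by
    intro l
    simp only [hq, Function.iterate_succ_apply']
    exact hf _
  have hlt : ∀ l, |(q (l + 1)).1 0| < |(q (l + 2)).1 0| := fun l => (hnext l).abs_lt (hnext _)
  have hone : ∀ l, 1 ≤ |(q (l + 2)).1 0| := fun l => by
    have h1 := hlt l
    have h2 := abs_nonneg ((q (l + 1)).1 0)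
    omega
  -- Two terms are dropped so that all first coordinates are non-zero; the added 1 pays for halving
  -- X below.
  refine ⟨fun l => (q (l + 2)).1, c + 1, hirr, fun l => (q (l + 2)).2, fun l => hnext (l + 2),
    hone, fun l => hlt (l + 1), fun l => ?_⟩
  have h2 : (2 : ℝ) ≤ |((q (l + 1 + 2)).1 0 : ℝ)| := by
    have h1 := hone l
    have h3 := hlt (l + 1)
    have h4 : 2 ≤ |(q (l + 1 + 2)).1 0| := by
      rw [show l + 1 + 2 = l + 3 by ring] at *
      rw [show l + 1 + 1 = l + 2 by ring] at h3
      omega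
    exact_mod_cast h4
  -- With X half the next first coordinate, the solution z cannot have a smaller error than the
  -- current point, by minimality.
  obtain ⟨z, hz, hz0, hz1⟩ := hc (|((q (l + 1 + 2)).1 0 : ℝ)| / 2) (by linarith)
  have hle : ‖errVec ξ (q (l + 2)).1‖ ≤ ‖errVec ξ z‖ := by
    by_contra! hcon
    have h3 := (hnext (l + 2)).abs_le z hz hcon
    have h4 : |((q (l + 1 + 2)).1 0 : ℝ)| ≤ |(z 0 : ℝ)| := by exact_mod_cast h3
    linarith
  have hpos := norm_errVec_pos hirr (q (l + 2)).2
  rw [Real.log_le_iff_le_exp hpos]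
  refine hle.trans (hz1.trans (Real.exp_le_exp.2 ?_))
  rw [Real.log_div (by linarith) two_ne_zero]
  have := Real.log_two_lt_d9
  have := Real.log_pos one_lt_two
  nlinarith

/-! ### Planes spanned by consecutive minimal points -/

/-- The norm of the vector of minors of two points. -/
def wedgeNorm (ξ : ℝ) (x y : Fin 3 → ℤ) : ℝ :=
  ‖(x 0 : ℝ) • errVec ξ y - (y 0 : ℝ) • errVec ξ x‖

theorem wedgeNorm_combo (ξ : ℝ) (x y : Fin 3 → ℤ) (a b : ℤ) :
    wedgeNorm ξ x (a • x + b • y) = |(b : ℝ)| * wedgeNorm ξ x y := by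
  unfold wedgeNorm
  rw [← Real.norm_eq_abs, ← norm_smul]
  congr 1
  simp only [map_add, map_zsmul, Pi.add_apply, Pi.smul_apply, smul_eq_mul, Int.cast_add,
    Int.cast_mul, ← Int.cast_smul_eq_zsmul ℝ]
  module

theorem wedgeNorm_comm (ξ : ℝ) (x y : Fin 3 → ℤ) : wedgeNorm ξ x y = wedgeNorm ξ y x :=
  norm_sub_rev _ _

theorem sub_le_wedgeNorm (ξ : ℝ) (x y : Fin 3 → ℤ) :
    |(x 0 : ℝ)| * ‖errVec ξ y‖ - |(y 0 : ℝ)| * ‖errVec ξ x‖ ≤ wedgeNorm ξ x y := by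
  have := norm_sub_norm_le ((x 0 : ℝ) • errVec ξ y) ((y 0 : ℝ) • errVec ξ x)
  rwa [norm_smul, norm_smul, Real.norm_eq_abs, Real.norm_eq_abs] at this

theorem wedgeNorm_le (ξ : ℝ) (x y : Fin 3 → ℤ) :
    wedgeNorm ξ x y ≤ |(x 0 : ℝ)| * ‖errVec ξ y‖ + |(y 0 : ℝ)| * ‖errVec ξ x‖ := by
  have := norm_sub_le ((x 0 : ℝ) • errVec ξ y) ((y 0 : ℝ) • errVec ξ x)
  rwa [norm_smul, norm_smul, Real.norm_eq_abs, Real.norm_eq_abs] at this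

theorem wedgeNorm_eq_zero {ξ : ℝ} {x y : Fin 3 → ℤ} (h1 : x 0 * y 1 = x 1 * y 0)
    (h2 : x 0 * y 2 = x 2 * y 0) : wedgeNorm ξ x y = 0 := by
  have h1' : (x 0 : ℝ) * y 1 = x 1 * y 0 := by exact_mod_cast h1
  have h2' : (x 0 : ℝ) * y 2 = x 2 * y 0 := by exact_mod_cast h2
  unfold wedgeNorm
  rw [norm_eq_zero]
  ext
  · simp only [Prod.fst_sub, Prod.smul_fst, errVec_fst, smul_eq_mul, Prod.fst_zero]
    linear_combination -h1'
  · simp only [Prod.snd_sub, Prod.smul_snd, errVec_snd, smul_eq_mul, Prod.snd_zero]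
    linear_combination ξ * h1' - h2'

namespace IsNext

variable {ξ : ℝ} {x y : Fin 3 → ℤ}

/-- Let X, Y be the first coordinates, E the error of x and w the wedge norm. One of y ± x has first
coordinate Y − X, hence error at least E, which gives (2X − Y)E ≤ w. Directly (Y − X)E ≤ w; adding
twice this gives YE ≤ 3w. -/
theorem mul_le_wedgeNorm (h : IsNext ξ x y) (hx : 1 ≤ |x 0|) (hxy : |x 0| < |y 0|) :
    |(y 0 : ℝ)| * ‖errVec ξ x‖ ≤ 3 * wedgeNorm ξ x y := by
  obtain ⟨s, hs⟩ : ∃ s : ℤ, |y 0 + s * x 0| = |y 0| - |x 0| ∧ (s = 1 ∨ s = -1) := by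
    rcases le_total 0 (x 0) with h1 | h1 <;> rcases le_total 0 (y 0) with h2 | h2
    · exact ⟨-1, by rw [abs_of_nonneg h1, abs_of_nonneg h2] at *
                    rw [abs_of_nonneg] <;> omega, Or.inr rfl⟩
    · exact ⟨1, by rw [abs_of_nonneg h1, abs_of_nonpos h2] at *
                   rw [abs_of_nonpos] <;> omega, Or.inl rfl⟩
    · exact ⟨1, by rw [abs_of_nonpos h1, abs_of_nonneg h2] at *
                   rw [abs_of_nonneg] <;> omega, Or.inl rfl⟩
    · exact ⟨-1, by rw [abs_of_nonpos h1, abs_of_nonpos h2] at *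
                    rw [abs_of_nonpos] <;> omega, Or.inr rfl⟩
  set z := s • x + (1 : ℤ) • y with hz
  have hz0 : z 0 = y 0 + s * x 0 := by simp [hz]; ring
  have hzabs : |z 0| = |y 0| - |x 0| := by rw [hz0]; exact hs.1
  have hzne : z ≠ 0 := by
    intro h0
    rw [h0] at hzabs
    simp at hzabs
    omega
  have hzerr : ‖errVec ξ x‖ ≤ ‖errVec ξ z‖ := by
    by_contra! hcon
    have := h.abs_le z hzne hcon
    omega
  have hzabs' : |(z 0 : ℝ)| = |(y 0 : ℝ)| - |(x 0 : ℝ)| := by exact_mod_cast hzabs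
  have h1 := sub_le_wedgeNorm ξ x z
  rw [hz, wedgeNorm_combo, ← hz, Int.cast_one, abs_one, one_mul, hzabs'] at h1
  have h2 := sub_le_wedgeNorm ξ y x
  rw [wedgeNorm_comm] at h2
  have h3 := mul_le_mul_of_nonneg_left hzerr (abs_nonneg (x 0 : ℝ))
  have h4 := mul_le_mul_of_nonneg_left h.err_lt.le (abs_nonneg (x 0 : ℝ))
  linarith

theorem wedgeNorm_le (h : IsNext ξ x y) (hxy : |x 0| < |y 0|) :
    wedgeNorm ξ x y ≤ 2 * (|(y 0 : ℝ)| * ‖errVec ξ x‖) := by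
  refine (_root_.wedgeNorm_le ξ x y).trans ?_
  have h1 : |(x 0 : ℝ)| ≤ |(y 0 : ℝ)| := by exact_mod_cast hxy.le
  have h2 : |(x 0 : ℝ)| * ‖errVec ξ y‖ ≤ |(y 0 : ℝ)| * ‖errVec ξ x‖ := by
    gcongr
    exact h.err_lt.le
  linarith

/-- Two consecutive minimal points form a basis of the lattice of integer points of their span. -/
theorem exists_combo (h : IsNext ξ x y) (hxy : |x 0| < |y 0|) (hw : wedgeNorm ξ x y ≠ 0)
    {z : Fin 3 → ℤ} (hz : triple x y z = 0) : ∃ a b : ℤ, z = a • x + b • y := by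
  obtain ⟨s, t, hst⟩ : ∃ s t : ℝ, ∀ i, (z i : ℝ) = s * x i + t * y i := by
    have hz' : (x 0 : ℝ) * (y 1 * z 2 - y 2 * z 1) - x 1 * (y 0 * z 2 - y 2 * z 0)
        + x 2 * (y 0 * z 1 - y 1 * z 0) = 0 := by
      unfold triple at hz
      exact_mod_cast hz
    by_cases h1 : (x 0 : ℝ) * y 1 - x 1 * y 0 = 0
    · by_cases h2 : (x 0 : ℝ) * y 2 - x 2 * y 0 = 0
      · exact absurd (wedgeNorm_eq_zero (by exact_mod_cast sub_eq_zero.1 h1)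
          (by exact_mod_cast sub_eq_zero.1 h2)) hw
      · refine ⟨(z 0 * y 2 - z 2 * y 0) / (x 0 * y 2 - x 2 * y 0),
          (x 0 * z 2 - x 2 * z 0) / (x 0 * y 2 - x 2 * y 0), fun i => ?_⟩
        rw [div_mul_eq_mul_div, div_mul_eq_mul_div, ← add_div, eq_div_iff h2]
        fin_cases i <;> simp only [Fin.zero_eta, Fin.mk_one, Fin.reduceFinMk]
        · ring
        · linear_combination -hz'
        · ring
    · refine ⟨(z 0 * y 1 - z 1 * y 0) / (x 0 * y 1 - x 1 * y 0),
        (x 0 * z 1 - x 1 * z 0) / (x 0 * y 1 - x 1 * y 0), fun i => ?_⟩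
      rw [div_mul_eq_mul_div, div_mul_eq_mul_div, ← add_div, eq_div_iff h1]
      fin_cases i <;> simp only [Fin.zero_eta, Fin.mk_one, Fin.reduceFinMk]
      · ring
      · ring
      · linear_combination hz'
  -- The remainder after rounding has first coordinate smaller than that of y and error smaller than
  -- that of x, so minimality makes it zero.
  refine ⟨round s, round t, ?_⟩
  set w := z - (round s • x + round t • y) with hwdef
  have hwi : ∀ i, (w i : ℝ) = (s - round s) * x i + (t - round t) * y i := by
    intro i
    have : w i = z i - (round s * x i + round t * y i) := by simp [hwdef]
    rw [this]
    push_cast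
    rw [hst i]
    ring
  have hs := abs_sub_round s
  have ht := abs_sub_round t
  have hwe : errVec ξ w = (s - round s) • errVec ξ x + (t - round t) • errVec ξ y := by
    ext
    · simp only [errVec_fst, Prod.fst_add, Prod.smul_fst, smul_eq_mul, hwi]
      ring
    · simp only [errVec_snd, Prod.snd_add, Prod.smul_snd, smul_eq_mul, hwi]
      ring
  have hxy' : |(x 0 : ℝ)| < |(y 0 : ℝ)| := by exact_mod_cast hxy
  have hw0 : |(w 0 : ℝ)| < |(y 0 : ℝ)| := by
    rw [hwi 0]
    refine (abs_add_le _ _).trans_lt ?_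
    rw [abs_mul, abs_mul]
    have b1 := mul_le_mul_of_nonneg_right hs (abs_nonneg (x 0 : ℝ))
    have b2 := mul_le_mul_of_nonneg_right ht (abs_nonneg (y 0 : ℝ))
    linarith
  have hwerr : ‖errVec ξ w‖ < ‖errVec ξ x‖ := by
    rw [hwe]
    refine (norm_add_le _ _).trans_lt ?_
    rw [norm_smul, norm_smul, Real.norm_eq_abs, Real.norm_eq_abs]
    have b1 := mul_le_mul_of_nonneg_right hs (norm_nonneg (errVec ξ x))
    have b2 := mul_le_mul_of_nonneg_right ht (norm_nonneg (errVec ξ y))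
    linarith [h.err_lt]
  have hwz : w = 0 := by
    by_contra hne
    have h1 := h.abs_le w hne hwerr
    have h2 : |(y 0 : ℝ)| ≤ |(w 0 : ℝ)| := by exact_mod_cast h1
    linarith
  exact sub_eq_zero.1 hwz

end IsNext

theorem triple_rotate (x y z : Fin 3 → ℤ) : triple y z x = triple x y z := by
  unfold triple; ring

theorem triple_combo (x y z : Fin 3 → ℤ) (a b c d : ℤ) :
    triple (a • x + b • y) y (c • y + d • z) = a * d * triple x y z := by
  simp [triple]; ring

namespace MinimalSeq

variable {ξ c : ℝ} {p : ℕ → Fin 3 → ℤ}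

theorem one_le_real (h : MinimalSeq ξ p c) (l : ℕ) : 1 ≤ |(p l 0 : ℝ)| := by
  exact_mod_cast h.one_le l

theorem err_pos (h : MinimalSeq ξ p c) (l : ℕ) : 0 < ‖errVec ξ (p l)‖ :=
  norm_errVec_pos h.irr (h.ne_zero l)

theorem strictMono (h : MinimalSeq ξ p c) : StrictMono fun l => |p l 0| :=
  strictMono_nat_of_lt_succ h.abs_lt

theorem strictAnti (h : MinimalSeq ξ p c) : StrictAnti fun l => ‖errVec ξ (p l)‖ :=
  strictAnti_nat_of_succ_lt fun l => (h.next l).err_lt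

theorem log_mono (h : MinimalSeq ξ p c) {k l : ℕ} (hkl : k ≤ l) :
    Real.log |(p k 0 : ℝ)| ≤ Real.log |(p l 0 : ℝ)| := by
  apply Real.log_le_log (by linarith [h.one_le_real k])
  exact_mod_cast h.strictMono.monotone hkl

theorem tendsto_log (h : MinimalSeq ξ p c) :
    Tendsto (fun l => Real.log |(p l 0 : ℝ)|) atTop atTop := by
  refine Real.tendsto_log_atTop.comp (tendsto_atTop_mono (fun l => ?_)
    tendsto_natCast_atTop_atTop)
  have : ∀ l : ℕ, (l : ℤ) ≤ |p l 0| := by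
    intro l
    induction l with
    | zero => simp
    | succ l ih =>
      have := h.abs_lt l
      push_cast
      omega
  exact_mod_cast this l

theorem le_wedgeNorm (h : MinimalSeq ξ p c) (l : ℕ) :
    |(p (l + 1) 0 : ℝ)| * ‖errVec ξ (p l)‖ ≤ 3 * wedgeNorm ξ (p l) (p (l + 1)) :=
  (h.next l).mul_le_wedgeNorm (h.one_le l) (h.abs_lt l)

theorem wedgeNorm_pos (h : MinimalSeq ξ p c) (l : ℕ) : 0 < wedgeNorm ξ (p l) (p (l + 1)) := by
  have h1 := h.le_wedgeNorm l
  have h2 := mul_pos (one_pos.trans_le (h.one_le_real (l + 1))) (h.err_pos l)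
  linarith

theorem combo_succ (h : MinimalSeq ξ p c) {l : ℕ}
    (hl : triple (p l) (p (l + 1)) (p (l + 2)) = 0) :
    ∃ a b : ℤ, p (l + 2) = a • p l + b • p (l + 1) :=
  (h.next l).exists_combo (h.abs_lt l) (h.wedgeNorm_pos l).ne' hl

theorem combo_pred (h : MinimalSeq ξ p c) {l : ℕ}
    (hl : triple (p l) (p (l + 1)) (p (l + 2)) = 0) :
    ∃ a b : ℤ, p l = a • p (l + 1) + b • p (l + 2) :=
  (h.next (l + 1)).exists_combo (h.abs_lt (l + 1)) (h.wedgeNorm_pos (l + 1)).ne'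
    ((triple_rotate _ _ _).trans hl)

/-- Going back, p_l is an integral combination of p_{l+1} and p_{l+2}, and the coefficient of
p_{l+2} cannot vanish. -/
theorem wedgeNorm_succ_le (h : MinimalSeq ξ p c) {l : ℕ}
    (hl : triple (p l) (p (l + 1)) (p (l + 2)) = 0) :
    wedgeNorm ξ (p (l + 1)) (p (l + 2)) ≤ wedgeNorm ξ (p l) (p (l + 1)) := by
  obtain ⟨a, b, hab⟩ := h.combo_pred hl
  have h1 := wedgeNorm_combo ξ (p (l + 1)) (p (l + 2)) a b
  rw [← hab, wedgeNorm_comm] at h1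
  have hb : b ≠ 0 := by
    rintro rfl
    have := h.wedgeNorm_pos l
    rw [h1] at this
    simp at this
  rw [h1]
  refine le_mul_of_one_le_left (norm_nonneg _) ?_
  exact_mod_cast Int.one_le_abs hb

section Dependent

variable {k d : ℕ}

theorem wedgeNorm_le_of_dependent (h : MinimalSeq ξ p c)
    (hk : ∀ j, k ≤ j → j < k + d → triple (p j) (p (j + 1)) (p (j + 2)) = 0) :
    wedgeNorm ξ (p (k + d)) (p (k + d + 1)) ≤ wedgeNorm ξ (p k) (p (k + 1)) := by
  induction d with
  | zero => exact le_rfl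
  | succ d ih =>
    exact (h.wedgeNorm_succ_le (hk (k + d) (by omega) (by omega))).trans
      (ih fun j h1 h2 => hk j h1 (by omega))

theorem combo_of_dependent (h : MinimalSeq ξ p c)
    (hk : ∀ j, k ≤ j → j < k + d → triple (p j) (p (j + 1)) (p (j + 2)) = 0) :
    (∃ a b : ℤ, p (k + d) = a • p k + b • p (k + 1)) ∧
      ∃ a b : ℤ, p (k + d + 1) = a • p k + b • p (k + 1) := by
  induction d with
  | zero => exact ⟨⟨1, 0, by simp⟩, 0, 1, by simp⟩
  | succ d ih =>
    obtain ⟨⟨a, b, h1⟩, a', b', h2⟩ := ih fun j h1 h2 => hk j h1 (by omega)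
    obtain ⟨s, t, h3⟩ := h.combo_succ (hk (k + d) (by omega) (by omega))
    refine ⟨⟨a', b', h2⟩, s * a + t * a', s * b + t * b', ?_⟩
    rw [show k + (d + 1) + 1 = k + d + 2 by ring, h3, h1, h2]
    module

theorem combo_of_dependent' (h : MinimalSeq ξ p c)
    (hk : ∀ j, k ≤ j → j < k + d → triple (p j) (p (j + 1)) (p (j + 2)) = 0) :
    (∃ a b : ℤ, p k = a • p (k + d) + b • p (k + d + 1)) ∧
      ∃ a b : ℤ, p (k + 1) = a • p (k + d) + b • p (k + d + 1) := by
  induction d generalizing k with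
  | zero => exact ⟨⟨1, 0, by simp⟩, 0, 1, by simp⟩
  | succ d ih =>
    obtain ⟨⟨a, b, h1⟩, a', b', h2⟩ := ih (k := k + 1) fun j h1 h2 => hk j (by omega) (by omega)
    obtain ⟨s, t, h3⟩ := h.combo_pred (hk k le_rfl (by omega))
    rw [show k + 1 + d = k + (d + 1) by ring] at h1 h2
    refine ⟨⟨s * a + t * a', s * b + t * b', ?_⟩, a, b, h1⟩
    rw [h3, h1, show k + 2 = k + 1 + 1 by ring, h2]
    module

end Dependent

theorem tendsto_err (h : MinimalSeq ξ p c) :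
    Tendsto (fun l => ‖errVec ξ (p l)‖) atTop (nhds 0) := by
  have hg := goldenRatio_bounds
  have h1 : Tendsto (fun l => c - (Real.goldenRatio - 1) * Real.log |(p (l + 1) 0 : ℝ)|)
      atTop atBot := by
    have := ((tendsto_add_atTop_iff_nat 1).2 h.tendsto_log).const_mul_atTop
      (by linarith : 0 < Real.goldenRatio - 1)
    simpa [sub_eq_add_neg] using
      tendsto_atBot_add_const_left _ c (tendsto_neg_atTop_atBot.comp this)
  refine squeeze_zero (fun l => norm_nonneg _) (fun l => ?_) (Real.tendsto_exp_atBot.comp h1)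
  exact (Real.log_le_iff_le_exp (h.err_pos l)).1 (h.log_err_le l)

/-- Otherwise all later minimal points satisfy one linear relation, whose coefficients are the
minors of two of them; since the errors tend to 0, ξ would be a root of the corresponding polynomial
of degree at most two. -/
theorem frequently_independent (h : MinimalSeq ξ p c) (m : ℕ) :
    ∃ l ≥ m, triple (p l) (p (l + 1)) (p (l + 2)) ≠ 0 := by
  by_contra! hcon
  set C := p m 1 * p (m + 1) 2 - p m 2 * p (m + 1) 1 with hC
  set B := p m 2 * p (m + 1) 0 - p m 0 * p (m + 1) 2 with hB
  set A := p m 0 * p (m + 1) 1 - p m 1 * p (m + 1) 0 with hA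
  have hrel : ∀ d, C * p (m + d) 0 + B * p (m + d) 1 + A * p (m + d) 2 = 0 := by
    intro d
    obtain ⟨⟨a, b, h1⟩, -⟩ := h.combo_of_dependent (k := m) (d := d) fun j hj _ => hcon j hj
    rw [h1, hA, hB, hC]
    simp only [Pi.add_apply, Pi.smul_apply, smul_eq_mul]
    ring
  set M := |(A : ℝ) * ξ + B| + |(A : ℝ)| with hM
  have hle : ∀ d, |(A : ℝ) * ξ ^ 2 + B * ξ + C| ≤ M * ‖errVec ξ (p (m + d))‖ := by
    intro d
    have h0 : (C : ℝ) * p (m + d) 0 + B * p (m + d) 1 + A * p (m + d) 2 = 0 := by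
      exact_mod_cast hrel d
    have h1 := abs_errVec_fst_le ξ (p (m + d))
    have h2 := abs_errVec_snd_le ξ (p (m + d))
    have e : ((A : ℝ) * ξ ^ 2 + B * ξ + C) * p (m + d) 0
        = (A * ξ + B) * (ξ * p (m + d) 0 - p (m + d) 1) + A * (ξ * p (m + d) 1 - p (m + d) 2) := by
      linear_combination h0
    calc |(A : ℝ) * ξ ^ 2 + B * ξ + C| ≤ |(A : ℝ) * ξ ^ 2 + B * ξ + C| * |(p (m + d) 0 : ℝ)| :=
          le_mul_of_one_le_right (abs_nonneg _) (h.one_le_real _)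
      _ ≤ |(A : ℝ) * ξ + B| * ‖errVec ξ (p (m + d))‖ + |(A : ℝ)| * ‖errVec ξ (p (m + d))‖ := by
          rw [← abs_mul, e]
          refine (abs_add_le _ _).trans ?_
          rw [abs_mul, abs_mul]
          gcongr
      _ = _ := by rw [hM]; ring
  have hlim : Tendsto (fun d => M * ‖errVec ξ (p (m + d))‖) atTop (nhds (M * 0)) := by
    refine Tendsto.const_mul _ ?_
    simpa [add_comm] using (tendsto_add_atTop_iff_nat m).2 h.tendsto_err
  rw [mul_zero] at hlim
  have hzero : |(A : ℝ) * ξ ^ 2 + B * ξ + C| ≤ 0 := ge_of_tendsto' hlim hle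
  obtain ⟨hA0, hB0, -⟩ := h.irr A B C (abs_nonpos_iff.1 hzero)
  apply (h.wedgeNorm_pos m).ne'
  apply wedgeNorm_eq_zero
  · rw [hA] at hA0; linarith
  · rw [hB] at hB0; linarith

end MinimalSeq

/-! ### Non-vanishing of the determinants of minimal points -/

/-- A triple of integers with `x₀ x₂ = x₁²` and `x₀ ≠ 0` is a multiple of `(m², m n, n²)`. -/
theorem exists_param {x : Fin 3 → ℤ} (h0 : x 0 ≠ 0) (h : x 0 * x 2 = x 1 * x 1) :
    ∃ s m n : ℤ, x 0 = s * m ^ 2 ∧ x 1 = s * (m * n) ∧ x 2 = s * n ^ 2 := by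
  obtain ⟨g, m, n, hg, hmn, h1, h2⟩ := Int.exists_gcd_one' (m := x 0) (n := x 1)
    (Int.gcd_pos_of_ne_zero_left _ h0)
  have hg' : (g : ℤ) ≠ 0 := by positivity
  have hcop : IsCoprime m n := Int.isCoprime_iff_gcd_eq_one.2 hmn
  have h3 : m * x 2 = g * n ^ 2 := by
    apply mul_right_cancel₀ hg'
    rw [h1, h2] at h
    linear_combination h
  have hdvd : m ∣ (g : ℤ) := by
    apply (hcop.pow_right (n := 2)).dvd_of_dvd_mul_right
    exact ⟨x 2, h3.symm⟩
  obtain ⟨s, hs⟩ := hdvd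
  have hm : m ≠ 0 := by
    rintro rfl
    apply h0
    rw [h1, zero_mul]
  refine ⟨s, m, n, by rw [h1, hs]; ring, by rw [h2, hs]; ring, mul_left_cancel₀ hm ?_⟩
  rw [h3, hs]
  ring

/-- Writing x = s(m², mn, n²), both quantities are divisible by sm and one is non-zero, while (sm)²
≥ |s|m² = |x₀|. -/
theorem abs_zero_le_sq_of_det_eq_zero {x w : Fin 3 → ℤ} (h0 : x 0 ≠ 0)
    (h : (symMat x).det = 0) (hw : x 0 * w 1 ≠ x 1 * w 0 ∨ x 0 * w 2 ≠ x 2 * w 0) :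
    |x 0| ≤ (x 0 * w 1 - x 1 * w 0) ^ 2 ∨ |x 0| ≤ (x 0 * w 2 - x 1 * w 1) ^ 2 := by
  rw [det_symMat, sub_eq_zero] at h
  obtain ⟨s, m, n, h1, h2, h3⟩ := exists_param h0 h
  have key : ∀ D : ℤ, D ≠ 0 → |x 0| ≤ (s * m * D) ^ 2 := by
    intro D hD
    have hD1 : 1 ≤ D ^ 2 := Int.one_le_abs hD |> fun h => by nlinarith [sq_abs D]
    have hs : s ≠ 0 := by
      rintro rfl
      exact h0 (by rw [h1, zero_mul])
    have hs1 := Int.one_le_abs hs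
    calc |x 0| = |s| * m ^ 2 := by rw [h1, abs_mul, abs_of_nonneg (sq_nonneg m)]
      _ ≤ |s| ^ 2 * m ^ 2 * D ^ 2 := by
          have : |s| ≤ |s| ^ 2 := by nlinarith
          have h4 : |s| * m ^ 2 ≤ |s| ^ 2 * m ^ 2 := by gcongr
          exact h4.trans (le_mul_of_one_le_right (by positivity) hD1)
      _ = _ := by rw [sq_abs]; ring
  by_cases hD : m * w 1 - n * w 0 = 0
  · by_cases hD' : m * w 2 - n * w 1 = 0
    · exfalso
      rcases hw with hw | hw
      · apply hw
        rw [h1, h2]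
        linear_combination s * m * hD
      · apply hw
        rw [h1, h3]
        linear_combination s * m * hD' + s * n * hD
    · right
      have e : x 0 * w 2 - x 1 * w 1 = s * m * (m * w 2 - n * w 1) := by rw [h1, h2]; ring
      rw [e]
      exact key _ hD'
  · left
    have e : x 0 * w 1 - x 1 * w 0 = s * m * (m * w 1 - n * w 0) := by rw [h1, h2]; ring
    rw [e]
    exact key _ hD

namespace MinimalSeq

variable {ξ c : ℝ} {p : ℕ → Fin 3 → ℤ}

/-- If p_{l+1} had determinant zero, one of the two expressions just considered, taken with p_l,
would be at least X_{l+1}^{1/2}, whereas both are ≪ X_{l+1}^{2−γ}. As 2 − γ < 1/2, this bounds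
X_{l+1}. -/
theorem eventually_det_ne_zero (h : MinimalSeq ξ p c) :
    ∀ᶠ l in atTop, (symMat (p l)).det ≠ 0 := by
  have hg := goldenRatio_bounds
  have hξ := abs_nonneg ξ
  set C := 2 * Real.log (2 + |ξ|) + 2 * c
  have hlarge := (h.tendsto_log.const_mul_atTop
    (by linarith : 0 < 2 * Real.goldenRatio - 3)).eventually_gt_atTop C
  obtain ⟨m, hm⟩ := eventually_atTop.1 (hlarge.and
    (h.tendsto_err.eventually_lt_const one_pos))
  refine eventually_atTop.2 ⟨m + 1, fun n hn => ?_⟩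
  obtain ⟨l, rfl⟩ := Nat.exists_eq_add_of_le' (show 1 ≤ n by omega)
  intro hdet
  obtain ⟨h1, -⟩ := hm (l + 1) (by omega)
  obtain ⟨-, h2⟩ := hm l (by omega)
  have hXr := h.one_le_real (l + 1)
  have hE := h.err_pos l
  have hlt : |(p l 0 : ℝ)| ≤ |(p (l + 1) 0 : ℝ)| := by exact_mod_cast (h.abs_lt l).le
  have herr := (h.next l).err_lt
  set X := |(p (l + 1) 0 : ℝ)| with hX
  set E := ‖errVec ξ (p l)‖
  have b1 : |((p (l + 1) 0 * p l 1 - p (l + 1) 1 * p l 0 : ℤ) : ℝ)| ≤ (2 + |ξ|) * (X * E) := by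
    have e : ((p (l + 1) 0 * p l 1 - p (l + 1) 1 * p l 0 : ℤ) : ℝ)
        = p l 0 * (ξ * p (l + 1) 0 - p (l + 1) 1) - p (l + 1) 0 * (ξ * p l 0 - p l 1) := by
      push_cast; ring
    rw [e]
    refine (abs_sub _ _).trans ?_
    rw [abs_mul, abs_mul]
    calc _ ≤ X * E + X * E := by
          gcongr
          · exact (abs_errVec_fst_le ξ _).trans herr.le
          · exact abs_errVec_fst_le ξ _
      _ ≤ _ := by nlinarith [mul_nonneg hξ (mul_pos (one_pos.trans_le hXr) hE).le]
  have b2 : |((p (l + 1) 0 * p l 2 - p (l + 1) 1 * p l 1 : ℤ) : ℝ)| ≤ (2 + |ξ|) * (X * E) := by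
    have e : ((p (l + 1) 0 * p l 2 - p (l + 1) 1 * p l 1 : ℤ) : ℝ)
        = p l 1 * (ξ * p (l + 1) 0 - p (l + 1) 1) - p (l + 1) 0 * (ξ * p l 1 - p l 2) := by
      push_cast; ring
    rw [e]
    refine (abs_sub _ _).trans ?_
    rw [abs_mul, abs_mul]
    have h3 := (abs_coord_bounds ξ (p l)).1
    calc _ ≤ (|ξ| * X + 1) * E + X * E := by
          gcongr
          · refine h3.trans ?_
            gcongr
          · exact (abs_errVec_fst_le ξ _).trans herr.le
          · exact abs_errVec_snd_le ξ _
      _ ≤ _ := by nlinarith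
  have hX0 : p (l + 1) 0 ≠ 0 := abs_pos.1 (by linarith [h.one_le (l + 1)])
  have hne : p (l + 1) 0 * p l 1 ≠ p (l + 1) 1 * p l 0 ∨
      p (l + 1) 0 * p l 2 ≠ p (l + 1) 2 * p l 0 := by
    by_contra! hcon
    have h3 := wedgeNorm_eq_zero (ξ := ξ) hcon.1 hcon.2
    rw [wedgeNorm_comm] at h3
    exact (h.wedgeNorm_pos l).ne' h3
  have hmain : X ≤ ((2 + |ξ|) * (X * E)) ^ 2 := by
    have conv : ∀ D : ℤ, |(D : ℝ)| ≤ (2 + |ξ|) * (X * E) → |p (l + 1) 0| ≤ D ^ 2 →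
        X ≤ ((2 + |ξ|) * (X * E)) ^ 2 := by
      intro D h3 h4
      have h5 : X ≤ (D : ℝ) ^ 2 := by rw [hX]; exact_mod_cast h4
      rw [← sq_abs] at h5
      exact h5.trans (by gcongr)
    rcases abs_zero_le_sq_of_det_eq_zero hX0 hdet hne with h3 | h3
    · exact conv _ b1 h3
    · exact conv _ b2 h3
  have hXpos : 0 < X := by linarith
  have hlog := Real.log_le_log hXpos hmain
  rw [Real.log_pow, Real.log_mul (by positivity) (by positivity),
    Real.log_mul hXpos.ne' hE.ne'] at hlog
  have h4 := h.log_err_le l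
  push_cast at hlog
  nlinarith

end MinimalSeq

/-! ### Extraction of a sequence of good approximations -/

namespace MinimalSeq

variable {ξ c : ℝ} {p : ℕ → Fin 3 → ℤ}

/-- A non-zero integer determinant is at least 1, and the dominant one among its three bounding
terms is X_{l+2} E_l E_{l+1}. -/
theorem log_triple_nonneg (h : MinimalSeq ξ p c) {l : ℕ}
    (hl : triple (p l) (p (l + 1)) (p (l + 2)) ≠ 0) :
    0 ≤ Real.log 6 + Real.log |(p (l + 2) 0 : ℝ)| + Real.log ‖errVec ξ (p l)‖
      + Real.log ‖errVec ξ (p (l + 1))‖ := by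
  have h0 := h.err_pos l
  have h1 := h.err_pos (l + 1)
  have h2 := h.err_pos (l + 2)
  have hX2 := h.one_le_real (l + 2)
  have l01 := (h.next l).err_lt.le
  have l12 := (h.next (l + 1)).err_lt.le
  have x12 : |(p (l + 1) 0 : ℝ)| ≤ |(p (l + 2) 0 : ℝ)| := by exact_mod_cast (h.abs_lt (l + 1)).le
  have x01 : |(p l 0 : ℝ)| ≤ |(p (l + 1) 0 : ℝ)| := by exact_mod_cast (h.abs_lt l).le
  have hone : (1 : ℝ) ≤ |(triple (p l) (p (l + 1)) (p (l + 2)) : ℝ)| := by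
    exact_mod_cast Int.one_le_abs hl
  have hb := abs_triple_le ξ (p l) (p (l + 1)) (p (l + 2))
  set X := |(p (l + 2) 0 : ℝ)|
  have hXpos : 0 < X := by linarith
  have b1 : |(p l 0 : ℝ)| * ‖errVec ξ (p (l + 1))‖ * ‖errVec ξ (p (l + 2))‖
      ≤ X * ‖errVec ξ (p (l + 1))‖ * ‖errVec ξ (p l)‖ := by
    gcongr
    · exact x01.trans x12
    · exact l12.trans l01
  have b2 : |(p (l + 1) 0 : ℝ)| * ‖errVec ξ (p l)‖ * ‖errVec ξ (p (l + 2))‖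
      ≤ X * ‖errVec ξ (p l)‖ * ‖errVec ξ (p (l + 1))‖ := by
    gcongr
  have h3 : 1 ≤ 6 * X * ‖errVec ξ (p l)‖ * ‖errVec ξ (p (l + 1))‖ := by linarith
  have h4 := Real.log_nonneg h3
  rwa [Real.log_mul (by positivity) h1.ne', Real.log_mul (by positivity) h0.ne',
    Real.log_mul (by norm_num) hXpos.ne'] at h4

theorem log_det_nonneg (h : MinimalSeq ξ p c) {l : ℕ} (hd : (symMat (p l)).det ≠ 0)
    (he : ‖errVec ξ (p l)‖ ≤ 1) :
    0 ≤ Real.log (2 * (1 + |ξ|)) + Real.log |(p l 0 : ℝ)| + Real.log ‖errVec ξ (p l)‖ := by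
  have h0 := h.err_pos l
  have hX := h.one_le_real l
  have hone : (1 : ℝ) ≤ |((symMat (p l)).det : ℝ)| := by exact_mod_cast Int.one_le_abs hd
  have hb := hone.trans (abs_det_symMat_le ξ (p l))
  set X := |(p l 0 : ℝ)|
  have hXpos : 0 < X := by linarith
  have h3 : 1 ≤ 2 * (1 + |ξ|) * X * ‖errVec ξ (p l)‖ := by
    refine hb.trans ?_
    have : (1 + |ξ|) * (X + ‖errVec ξ (p l)‖) ≤ 2 * (1 + |ξ|) * X := by
      nlinarith [abs_nonneg ξ]
    gcongr
  have h4 := Real.log_nonneg h3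
  rwa [Real.log_mul (by positivity) h0.ne', Real.log_mul (by positivity) hXpos.ne'] at h4

/-- The wedge norm does not increase along a run of dependent triples and is comparable with X_{j+1}
E_j; the 6 is the product of the comparison constants 3 and 2. -/
theorem log_wedge_le (h : MinimalSeq ξ p c) {l d : ℕ}
    (hk : ∀ j, l + 1 ≤ j → j < l + 1 + d → triple (p j) (p (j + 1)) (p (j + 2)) = 0) :
    Real.log |(p (l + 1 + d + 1) 0 : ℝ)| + Real.log ‖errVec ξ (p (l + 1 + d))‖
      ≤ Real.log 6 + Real.log |(p (l + 2) 0 : ℝ)| + Real.log ‖errVec ξ (p (l + 1))‖ := by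
  have h1 := h.le_wedgeNorm (l + 1 + d)
  have h2 := h.wedgeNorm_le_of_dependent hk
  have h3 := (h.next (l + 1)).wedgeNorm_le (h.abs_lt (l + 1))
  have e1 := h.err_pos (l + 1 + d)
  have e2 := h.err_pos (l + 1)
  have x1 : 0 < |(p (l + 1 + d + 1) 0 : ℝ)| := one_pos.trans_le (h.one_le_real _)
  have x2 : 0 < |(p (l + 2) 0 : ℝ)| := one_pos.trans_le (h.one_le_real _)
  have h4 : |(p (l + 1 + d + 1) 0 : ℝ)| * ‖errVec ξ (p (l + 1 + d))‖
      ≤ 6 * |(p (l + 2) 0 : ℝ)| * ‖errVec ξ (p (l + 1))‖ := by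
    rw [show l + 1 + 1 = l + 2 by ring] at h2 h3
    linarith
  have h5 := Real.log_le_log (by positivity) h4
  rwa [Real.log_mul x1.ne' e1.ne', Real.log_mul (by positivity) e2.ne',
    Real.log_mul (by norm_num) x2.ne'] at h5

/-- The indices of linearly independent consecutive minimal points select an extracted sequence of
approximations. -/
theorem exists_approxSeq (h : MinimalSeq ξ p c) :
    ∃ y a K, ApproxSeq ξ y a K ∧ ∀ k, (symMat (y k)).det ≠ 0 := by
  have hg := goldenRatio_bounds
  have hsq := Real.goldenRatio_sq
  obtain ⟨m, hm⟩ := eventually_atTop.1 (h.eventually_det_ne_zero.and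
    (h.tendsto_err.eventually_le_const one_pos))
  set I : ℕ → Prop := fun l => m ≤ l ∧ triple (p l) (p (l + 1)) (p (l + 2)) ≠ 0
  have hinf : (Set.ofPred I).Infinite := by
    rw [Set.infinite_iff_exists_gt]
    intro n
    obtain ⟨l, hl, hl'⟩ := h.frequently_independent (max m (n + 1))
    exact ⟨l, ⟨(le_max_left _ _).trans hl, hl'⟩, (le_max_right m (n + 1)).trans hl⟩
  set f := Nat.nth I
  have hfmono : StrictMono f := Nat.nth_strictMono hinf
  have hfI : ∀ k, I (f k) := Nat.nth_mem_of_infinite hinf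
  have hdep : ∀ k j, f k + 1 ≤ j → j < f (k + 1) →
      triple (p j) (p (j + 1)) (p (j + 2)) = 0 := by
    intro k j h1 h2
    by_contra hne
    have h3 : I j := ⟨(hfI k).1.trans (by omega), hne⟩
    have h4 : j ≤ f k := Nat.le_nth_of_lt_nth_succ h2 h3
    omega
  set A : ℕ → ℝ := fun l => Real.log |(p l 0 : ℝ)| with hA
  set ε : ℕ → ℝ := fun l => Real.log ‖errVec ξ (p l)‖ with hε
  set Q := Real.log (2 * (1 + |ξ|)) with hQ
  have hQ0 : 0 ≤ Q := Real.log_nonneg (by linarith [abs_nonneg ξ])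
  have hlog6 : 0 ≤ Real.log 6 := Real.log_nonneg (by norm_num)
  set C := |c|
  have hC0 : 0 ≤ C := abs_nonneg c
  have hcC : c ≤ C := le_abs_self c
  set D := 3 * (Real.log 6 + 2 * C) with hD
  have hD0 : 0 ≤ D := by positivity
  set D' := 2 * (Q + C) with hD'
  have hD'0 : 0 ≤ D' := by positivity
  have herr : ∀ l, ε l ≤ C - (Real.goldenRatio - 1) * A (l + 1) := fun l =>
    (h.log_err_le l).trans (by linarith)
  -- The non-zero determinant gives X_{l+1}^{γ−1} ≪ X_{l+2}^{2−γ}; raise to the power γ + 1, using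
  -- (γ+1)(γ−1) = γ and (γ+1)(2−γ) = 1.
  have lower : ∀ l, I l → Real.goldenRatio * A (l + 1) - D ≤ A (l + 2) := by
    intro l hl
    have h1 := h.log_triple_nonneg hl.2
    have h2 := herr l
    have h3 := herr (l + 1)
    rw [show l + 1 + 1 = l + 2 by ring] at h3
    have h4 : 0 ≤ Real.log 6 + 2 * C + ((2 - Real.goldenRatio) * A (l + 2)
        - (Real.goldenRatio - 1) * A (l + 1)) := by
      simp only [hA, hε] at *
      linarith
    have h5 : 0 ≤ (Real.goldenRatio + 1) * (Real.log 6 + 2 * C + ((2 - Real.goldenRatio) * A (l + 2)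
        - (Real.goldenRatio - 1) * A (l + 1))) := mul_nonneg (by linarith) h4
    have e : (Real.goldenRatio + 1) * (Real.log 6 + 2 * C + ((2 - Real.goldenRatio) * A (l + 2)
        - (Real.goldenRatio - 1) * A (l + 1))) = (Real.goldenRatio + 1) * (Real.log 6 + 2 * C)
          + (A (l + 2) - Real.goldenRatio * A (l + 1)) := by
      linear_combination (-A (l + 2) - A (l + 1)) * hsq
    rw [e] at h5
    have h6 : (Real.goldenRatio + 1) * (Real.log 6 + 2 * C) ≤ D := by
      rw [hD]
      gcongr
      linarith
    linarith
  -- A non-zero determinant forces X_l E_l ≫ 1, while E_l ≪ X_{l+1}^{1−γ}; raise to the power γ,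
  -- using γ(γ−1) = 1.
  have upper : ∀ l, m ≤ l → A (l + 1) ≤ Real.goldenRatio * A l + D' := by
    intro l hl
    have h1 := h.log_det_nonneg (hm l hl).1 (hm l hl).2
    have h2 := herr l
    have h3 : 0 ≤ Q + C + (A l - (Real.goldenRatio - 1) * A (l + 1)) := by
      simp only [hA, hε, hQ] at *
      linarith
    have h4 : 0 ≤ Real.goldenRatio * (Q + C + (A l - (Real.goldenRatio - 1) * A (l + 1))) :=
      mul_nonneg (by linarith) h3
    have e : Real.goldenRatio * (Q + C + (A l - (Real.goldenRatio - 1) * A (l + 1)))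
        = Real.goldenRatio * (Q + C) + (Real.goldenRatio * A l - A (l + 1)) := by
      linear_combination (-A (l + 1)) * hsq
    rw [e] at h4
    have h5 : Real.goldenRatio * (Q + C) ≤ D' := by
      rw [hD']
      gcongr
      linarith
    linarith
  have hεI : ∀ l, I l → ε (l + 1) ≤ -A (l + 1) + (C + D) := by
    intro l hl
    have h1 := herr (l + 1)
    have h2 := lower l hl
    rw [show l + 1 + 1 = l + 2 by ring] at h1
    have h3 : (Real.goldenRatio - 1) * (Real.goldenRatio * A (l + 1) - D)
        ≤ (Real.goldenRatio - 1) * A (l + 2) := by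
      gcongr
      linarith
    have e : (Real.goldenRatio - 1) * (Real.goldenRatio * A (l + 1) - D)
        = A (l + 1) - (Real.goldenRatio - 1) * D := by
      linear_combination A (l + 1) * hsq
    nlinarith
  set K := max (4 * (2 * Real.log 6 + 2 * D' + 2 * (C + D))) (C + D)
  have hK1 : 4 * (2 * Real.log 6 + 2 * D' + 2 * (C + D)) ≤ K := le_max_left _ _
  have hK2 : C + D ≤ K := le_max_right _ _
  have hK0 : 0 ≤ K := by linarith
  have hgap : ∀ k, ∃ d, f (k + 1) = f k + 1 + d := fun k => by
    have : f k < f (k + 1) := hfmono (Nat.lt_succ_self k)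
    exact ⟨f (k + 1) - (f k + 1), by omega⟩
  have hgrow : ∀ k, |A (f (k + 1) + 1) - Real.goldenRatio * A (f k + 1)| ≤ K := by
    intro k
    obtain ⟨d, hd⟩ := hgap k
    have hI0 := hfI k
    have hI1 := hfI (k + 1)
    rw [abs_le]
    constructor
    · have h1 := lower _ hI0
      have h2 : A (f k + 2) ≤ A (f (k + 1) + 1) := h.log_mono (by omega)
      linarith
    -- Let X and Z be the sizes of the selected points k and k + 1, and E the error at index f (k +
    -- 1). The run gives ZE ≪ X^{γ−1}, the independent triple gives E ≫ Z^{1−γ}, so Z^{2−γ} ≪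
    -- X^{γ−1}, that is Z ≪ X^γ.
    · have h1 := h.log_wedge_le (l := f k) (d := d) fun j h1 h2 => hdep k j h1 (by omega)
      rw [← hd] at h1
      have h2 := h.log_triple_nonneg hI1.2
      have h3 := upper (f (k + 1) + 1) (hI1.1.trans (Nat.le_succ _))
      have h4 := upper (f k + 1) (hI0.1.trans (Nat.le_succ _))
      have h5 := hεI _ hI0
      have h6 := hεI _ hI1
      rw [show f (k + 1) + 1 + 1 = f (k + 1) + 2 by ring] at h3
      rw [show f k + 1 + 1 = f k + 2 by ring] at h4
      have h7 : 0 ≤ 2 * Real.log 6 + 2 * D' + 2 * (C + D)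
          + ((Real.goldenRatio - 1) * A (f k + 1) - (2 - Real.goldenRatio) * A (f (k + 1) + 1)) := by
        simp only [hA, hε] at *
        linarith
      have h8 := mul_nonneg (by linarith : 0 ≤ Real.goldenRatio + 1) h7
      have e : (Real.goldenRatio + 1) * (2 * Real.log 6 + 2 * D' + 2 * (C + D)
          + ((Real.goldenRatio - 1) * A (f k + 1) - (2 - Real.goldenRatio) * A (f (k + 1) + 1)))
          = (Real.goldenRatio + 1) * (2 * Real.log 6 + 2 * D' + 2 * (C + D))
            + (Real.goldenRatio * A (f k + 1) - A (f (k + 1) + 1)) := by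
        linear_combination (A (f k + 1) + A (f (k + 1) + 1)) * hsq
      rw [e] at h8
      have h9 : (Real.goldenRatio + 1) * (2 * Real.log 6 + 2 * D' + 2 * (C + D))
          ≤ 4 * (2 * Real.log 6 + 2 * D' + 2 * (C + D)) := by
        gcongr
        linarith
      linarith
  have hXpos : ∀ l, 0 < |(p l 0 : ℝ)| := fun l => one_pos.trans_le (h.one_le_real l)
  -- The middle point of each independent triple is selected: it spans the intersection of two
  -- successive planes.
  refine ⟨fun k => p (f k + 1), fun k => A (f k + 1), K, ⟨hgrow, ?_, ?_, ?_, ?_, ?_, ?_⟩,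
    fun k => (hm _ ((hfI k).1.trans (Nat.le_succ _))).1⟩
  · exact h.tendsto_log.comp (tendsto_atTop_mono (fun k => Nat.le_succ (f k)) hfmono.tendsto_atTop)
  · exact fun k => Real.log_nonneg (h.one_le_real _)
  · intro k
    rw [Real.exp_add, hA, Real.exp_log (hXpos _)]
    exact le_mul_of_one_le_right (abs_nonneg _) (Real.one_le_exp hK0)
  · intro k
    rw [← Real.log_le_iff_le_exp (h.err_pos _)]
    exact (hεI _ (hfI k)).trans (by linarith)
  · intro k
    rw [Real.exp_sub, hA, Real.exp_log (hXpos _)]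
    refine (div_le_self (abs_nonneg _) (Real.one_le_exp hK0)).trans ?_
    linarith [norm_nonneg (errVec ξ (p (f k + 1)))]
  · intro k
    -- The outer two points lie in the planes of the two runs adjacent to the middle one, so the
    -- determinant is s · v times that of the independent triple at f (k + 1). If s = 0 the first
    -- coordinates could not increase strictly; if v = 0 the errors could not decrease strictly.
    obtain ⟨d, hd⟩ := hgap k
    obtain ⟨d', hd'⟩ := hgap (k + 1)
    obtain ⟨⟨s, t, h1⟩, -⟩ := h.combo_of_dependent' (k := f k + 1) (d := d)
      fun j h1 h2 => hdep k j h1 (by omega)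
    obtain ⟨-, u, v, h2⟩ := h.combo_of_dependent (k := f (k + 1) + 1) (d := d')
      fun j h1 h2 => hdep (k + 1) j h1 (by omega)
    rw [← hd] at h1
    rw [← hd'] at h2
    have hs : s ≠ 0 := by
      rintro rfl
      rw [zero_smul, zero_add] at h1
      have h3 : |p (f k + 1) 0| = |t| * |p (f (k + 1) + 1) 0| := by
        rw [h1, Pi.smul_apply, smul_eq_mul, abs_mul]
      have h4 : |p (f k + 1) 0| < |p (f (k + 1) + 1) 0| :=
        h.strictMono (by have := hfmono (Nat.lt_succ_self k); simp only [Nat.succ_eq_add_one] at this; omega)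
      have ht : t ≠ 0 := by
        rintro rfl
        rw [zero_smul] at h1
        exact h.ne_zero _ h1
      have h5 := mul_le_mul_of_nonneg_right (Int.one_le_abs ht) (abs_nonneg (p (f (k + 1) + 1) 0))
      linarith
    have hv : v ≠ 0 := by
      rintro rfl
      rw [zero_smul, add_zero] at h2
      have h3 : ‖errVec ξ (p (f (k + 1 + 1) + 1))‖
          = |(u : ℝ)| * ‖errVec ξ (p (f (k + 1) + 1))‖ := by rw [h2, norm_errVec_smul]
      have h4 : ‖errVec ξ (p (f (k + 1 + 1) + 1))‖ < ‖errVec ξ (p (f (k + 1) + 1))‖ :=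
        h.strictAnti (by have := hfmono (Nat.lt_succ_self (k + 1)); simp only [Nat.succ_eq_add_one] at this; omega)
      have hu : u ≠ 0 := by
        rintro rfl
        rw [zero_smul] at h2
        exact h.ne_zero _ h2
      have hu1 : (1 : ℝ) ≤ |(u : ℝ)| := by exact_mod_cast Int.one_le_abs hu
      nlinarith [norm_nonneg (errVec ξ (p (f (k + 1) + 1)))]
    have h5 := triple_combo (p (f (k + 1))) (p (f (k + 1) + 1)) (p (f (k + 1) + 1 + 1)) s t u v
    rw [← h1, ← h2] at h5
    change triple (p (f k + 1)) (p (f (k + 1) + 1)) (p (f (k + 1 + 1) + 1)) ≠ 0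
    rw [h5]
    exact mul_ne_zero (mul_ne_zero hs hv) (hfI (k + 1)).2

end MinimalSeq

theorem mainTheorem1 :
    (∀ ξ : ℝ, IsExtremal ξ →
      (∃ W : ℕ → PrimMat, IsAssociated ξ W) ∧
      (∀ W W' : ℕ → PrimMat, IsAssociated ξ W → IsAssociated ξ W' →
        ∃ (k l : ℕ) (ε : ℕ → ℤˣ), IsFibonacciSeq ε ∧
          ∀ i, 1 ≤ i → (W' (i + k)).toMat = (ε i : ℤ) • (W (i + l)).toMat)) ∧
    (∀ W : ℕ → PrimMat, IsFibonacciSeq W → IsAdmissible W → IsUnboundedSeq W →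
      SeqLL (fun i => ‖(W (i + 1)).toReal‖ * ‖(W i).toReal‖) (fun i => ‖(W (i + 2)).toReal‖) →
      SeqLL (fun i => |(W i).toReal.det|) (fun _ => 1) →
      ∃ ξ : ℝ, IsExtremal ξ ∧ SatisfiesEstimates ξ W) := by
  refine ⟨fun ξ hξ => ⟨?_, fun W W' h h' => h.eq_up_to_shift_and_sign h'⟩,
    fun W hF hA hU hG hD => ?_⟩
  · obtain ⟨p, c, hp⟩ := hξ.exists_minimalSeq
    obtain ⟨y, a, K, hy, hd⟩ := hp.exists_approxSeq
    exact hy.exists_associated hd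
  · obtain ⟨N, x, hx⟩ := hA.exists_symmetricPoints
    exact hx.exists_extremal hF hU hG hD
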